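/- Let $\Gamma$ be a discrete group. **Coarse side.** For a coarse space $(X,\mathcal E)$ let $\mathrm{Pen}_E(A)=\{x\mid\exists y\in A:(x,y)\in E\}$. A set is *bounded* if it lies in some $\mathrm{Pen}_E(\{y\})$ and *precompact* if it is a finite union of bounded sets; $X$ is *locally finite* if bounded sets are finite, and *of bornologically bounded geometry* if it has a coarsely dense locally finite subspace. A map is *coarse* if it maps entourages to entourages and preimages of bounded sets are precompact. A $\Gamma$-action by coarse equivalences is *proper* if $\{\gamma\mid K\gamma\cap K\neq\emptyset\}$ is finite for all bounded $K$, and *isocoarse* if every entourage lies in a $\Gamma$-invariant entourage. Let $\mathfrak C$ be the category of pairs $(X,A)$, where $X$ is a countably generated proper isocoarse $\Gamma$-space of bornologically bounded geometry and $A\subset X$ is $\Gamma$-invariant with the restricted coarse structure, with $\Gamma$-equivariant coarse maps $X\to Y$ sending $A$ to $B$ as morphisms $(X,A)\to(Y,B)$. Let $f,g:(X,A)\to(Y,B)$ be morphisms. * A *$\Gamma$-equivariant coarse homotopy* from $f$ to $g$ is a $\Gamma$-equivariant map $H:X\times\mathbb Z\to Y$ that maps entourages of the product coarse structure to entourages,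 with $H(A\times\mathbb Z)\subset B$, for which there are bornological $\rho^\pm:X\to\mathbb Z$ (bounded sets go to bounded sets) with $H(x,n)=f(x)$ for $n\le\rho^-(x)$, $H(x,n)=g(x)$ for $n\ge\rho^+(x)$, such that the restriction of $H$ to $\{(x,n)\mid\rho^-(x)\le n\le\rho^+(x)\}$ is a coarse map. * A *$\Gamma$-equivariant generalized coarse homotopy* from $f$ to $g$ is a $\Gamma$-equivariant coarse map $H:X\times[a,b]\to Y$ with $H(\cdot,a)=f$, $H(\cdot,b)=g$, $H(A\times[a,b])\subset B$, where $X\times[a,b]$ has the coarse structure generated by the sets $\{((x,s),(y,s))\mid(x,y)\in E\}$ for $E\in\mathcal E_X$ and $\{((x,s),(x,t))\mid(s,t)\in U_x\}$ for some family of neighbourhoods $U_x$ of the diagonal of $[a,b]^2$ with $U_{x\gamma}=U_x$. * An *excision* is an inclusion $(X\setminus C,A\setminus C)\subset(X,A)$ in $\mathfrak C$ with $C\subset A$ such that for every entourage $E$ there is an entourage $F$ with $\mathrm{Pen}_E(A)\setminus C\subset\mathrm{Pen}_F(A\setminus C)$. A *$\Gamma$-equivariant coarse homology theory* on $\mathfrak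 C$ is a family of functors $\mathrm{EX}_p:\mathfrak C\to\mathrm{Ab}$, $p\in\mathbb Z$, with natural connecting homomorphisms $\mathrm{EX}_p(X,A)\to\mathrm{EX}_{p-1}(A,\emptyset)$ such that equivariantly coarsely homotopic morphisms induce the same maps, the long sequences of all pairs are exact, and excisions induce isomorphisms; dually for cohomology. It satisfies the *strong homotopy axiom* if morphisms related by an equivariant generalized coarse homotopy induce the same maps. **Topological side.** A *$\sigma$-locally compact $\Gamma$-space* $\mathcal X$ is a sequence $X_0\subset X_1\subset\cdots$ of locally compact Hausdorff $\Gamma$-spaces, each closed in the later ones with the subspace topology and restricted action; $\mathcal X=\bigcup X_n$ has the final topology. Consider pairs $(\mathcal X,\mathcal A)$ with $\mathcal A$ a closed $\Gamma$-invariant subspace, filtered by $\mathcal A\cap X_n$. Morphisms $(\mathcal X,\mathcal A)\to(\mathcal Y,\mathcal B)$ are $\Gamma$-equivariant maps $f$ with $f(\mathcal A)\subset\mathcal B$ such that for every $m$ there is $n$ for which $f$ restricts to a proper continuous map $X_m\to Y_n$. A *homotopy* is a morphism from $(\mathcal X\times[0,1],\mathcal A\times[0,1])$, filtered by the $X_n\times[0,1]$.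 By a *$\Gamma$-equivariant (co)homology theory* $\mathrm E$ on this category we mean one in the sense of Eilenberg–Steenrod satisfying homotopy, exactness and excision (for $\mathcal U$ open with closure contained in the interior of $\mathcal A$), but not necessarily dimension or additivity. **Coarsification.** A *discretization* of $(X,A)\in\mathfrak C$ is a pair $A'\subset X'$ of $\Gamma$-invariant, locally finite, coarsely dense subsets $X'\subset X$, $A'\subset A$ for which there is a $\Gamma$-equivariant coarse equivalence $\pi_X:X\to X'$ that is the identity on $X'$ and restricts to a coarse equivalence $A\to A'$. For a sequence $\Delta_{X'}=E_0\subset E_1\subset\cdots$ of $\Gamma$-invariant entourages of $X'$ such that every entourage lies in some $E_n$, the *Rips complex* $\mathcal P(X')$ is the $\sigma$-locally compact $\Gamma$-space with filtration by the geometric realizations $P_n(X')$ of the simplicial complex on $X'$ in which $x_0,\dots,x_k$ span a simplex iff all $(x_i,x_j)\in E_n$; $\mathcal P(A')\subset\mathcal P(X')$ is the closed subspace of points supported in $A'$. For a morphism $f:(X,A)\to(Y,B)$ and discretizations of both pairs, the affine linear extension of $\pi_Y\circ f|_{X'}$ is a morphism $f':(\mathcal P(X'),\mathcal P(A'))\to(\mathcal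 P(Y'),\mathcal P(B'))$. **Theorem.** Every pair in $\mathfrak C$ has a discretization and a sequence $(E_n)$ as above. Let $\mathrm E$ be a $\Gamma$-equivariant homology or cohomology theory on pairs of $\sigma$-locally compact $\Gamma$-spaces. 1. The maps induced by $f'$ on $\mathrm E$ do not depend on $\pi_Y$. For two discretizations $(X',A')$, $(X'',A'')$ of $(X,A)$, with chosen sequences $(E_n)$, the map between $\mathrm E(\mathcal P(X'),\mathcal P(A'))$ and $\mathrm E(\mathcal P(X''),\mathcal P(A''))$ induced in this way by $\mathrm{id}_{(X,A)}$ is an isomorphism. These canonical isomorphisms compose correctly, and the one from a discretization with its sequence to itself is the identity. 2. For any choice of a discretization and sequence for each pair, the groups $\mathrm{EX}(X,A):=\mathrm E(\mathcal P(X'),\mathcal P(A'))$, with the induced maps of the $f'$ and the connecting homomorphisms of $\mathrm E$ (composed with the canonical isomorphism between $\mathrm E(\mathcal P(A'))$ and $\mathrm{EX}(A,\emptyset)$), form a $\Gamma$-equivariant coarse homology, respectively cohomology, theory on $\mathfrak C$ that satisfies the strong homotopy axiom. 3. For two such choices, the canonical isomorphisms form an isomorphism of coarse (co)homology theories. -/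

import Mathlib

open CategoryTheory Topology

universe w u v

/-! ## Coarse structures -/

/-- A coarse structure on a set `X`. The elements of `entourages` are the controlled sets. -/
structure CoarseStructure (X : Type u) where
  /-- The predicate of being an entourage. -/
  Controlled : SetRel X X → Prop
  diag : Controlled SetRel.id
  subset : ∀ {E E' : SetRel X X}, Controlled E → E' ⊆ E → Controlled E'
  inv : ∀ {E : SetRel X X}, Controlled E → Controlled E.inv
  comp : ∀ {E F : SetRel X X}, Controlled E → Controlled F → Controlled (E.comp F)
  union : ∀ {E F : SetRel X X}, Controlled E → Controlled F → Controlled (E ∪ F)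

namespace CoarseStructure

variable {X : Type u} {Y : Type v}

/-- The sets obtained from the members of `S` and the diagonal by the operations in the definition
of a coarse structure. -/
inductive GenerateControlled (S : Set (SetRel X X)) : SetRel X X → Prop
  | basic (E : SetRel X X) : E ∈ S → GenerateControlled S E
  | diag : GenerateControlled S SetRel.id
  | subset (E E' : SetRel X X) : GenerateControlled S E → E' ⊆ E → GenerateControlled S E'
  | inv (E : SetRel X X) : GenerateControlled S E → GenerateControlled S E.inv
  | comp (E F : SetRel X X) : GenerateControlled S E → GenerateControlled S F →
      GenerateControlled S (E.comp F)
  | union (E F : SetRel X X) : GenerateControlled S E → GenerateControlled S F →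
      GenerateControlled S (E ∪ F)

/-- The coarse structure generated by `S`, i.e. the smallest one for which all members of `S`
are entourages. -/
def generate (S : Set (SetRel X X)) : CoarseStructure X where
  Controlled := GenerateControlled S
  diag := .diag
  subset h h' := .subset _ _ h h'
  inv h := .inv _ h
  comp h h' := .comp _ _ h h'
  union h h' := .union _ _ h h'

/-- `𝓔` is generated by countably many entourages. -/
def CountablyGenerated (𝓔 : CoarseStructure X) : Prop :=
  ∃ S : Set (SetRel X X), S.Countable ∧ ∀ E, 𝓔.Controlled E ↔ (generate S).Controlled E

/-- The penumbra `Pen_E(A)`. -/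
def pen (E : SetRel X X) (A : Set X) : Set X := {x | ∃ y ∈ A, (x, y) ∈ E}

/-- `A` is coarsely dense. -/
def CoarselyDense (𝓔 : CoarseStructure X) (A : Set X) : Prop :=
  ∃ E, 𝓔.Controlled E ∧ ∀ x, x ∈ pen E A

/-- Bounded sets: subsets of some `E`-ball. -/
def Bounded (𝓔 : CoarseStructure X) (K : Set X) : Prop :=
  ∃ E, 𝓔.Controlled E ∧ ∃ y, K ⊆ pen E {y}

/-- Precompact sets: finite unions of bounded sets. -/
def Precompact (𝓔 : CoarseStructure X) (K : Set X) : Prop :=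
  ∃ F : Set (Set X), F.Finite ∧ (∀ L ∈ F, 𝓔.Bounded L) ∧ K = ⋃₀ F

/-- Locally finite (discrete) coarse spaces: bounded sets are finite. -/
def LocallyFinite (𝓔 : CoarseStructure X) : Prop := ∀ K, 𝓔.Bounded K → K.Finite

/-- The restricted coarse structure on a subset `A`: the sets `E ∩ (A × A)`, viewed as
subsets of `A × A`. -/
def restrict (𝓔 : CoarseStructure X) (A : Set X) : CoarseStructure A where
  Controlled F := ∃ E, 𝓔.Controlled E ∧ F = Prod.map Subtype.val Subtype.val ⁻¹' E
  diag := ⟨_, 𝓔.diag, by ext ⟨a, b⟩; simp [Subtype.ext_iff]⟩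
  subset := by
    rintro _ F' ⟨E, hE, rfl⟩ h
    refine ⟨Prod.map Subtype.val Subtype.val '' F', 𝓔.subset hE ?_, ?_⟩
    · rintro _ ⟨p, hp, rfl⟩
      exact h hp
    · exact (Set.preimage_image_eq _ (Subtype.val_injective.prodMap Subtype.val_injective)).symm
  inv := by
    rintro _ ⟨E, hE, rfl⟩
    exact ⟨_, 𝓔.inv hE, rfl⟩
  comp := by
    rintro _ _ ⟨E, hE, rfl⟩ ⟨F, hF, rfl⟩
    refine ⟨Prod.map Subtype.val Subtype.val ''
      (SetRel.comp (Prod.map Subtype.val Subtype.val ⁻¹' E)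
        (Prod.map Subtype.val Subtype.val ⁻¹' F)), 𝓔.subset (𝓔.comp hE hF) ?_,
      (Set.preimage_image_eq _ (Subtype.val_injective.prodMap Subtype.val_injective)).symm⟩
    rintro _ ⟨⟨a, b⟩, ⟨c, h1, h2⟩, rfl⟩
    exact ⟨c, h1, h2⟩
  union := by
    rintro _ _ ⟨E, hE, rfl⟩ ⟨F, hF, rfl⟩
    exact ⟨_, 𝓔.union hE hF, rfl⟩

/-- Bornologically bounded geometry: there is a coarsely dense, locally finite subspace. -/
def BornologicallyBoundedGeometry (𝓔 : CoarseStructure X) : Prop :=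
  ∃ X' : Set X, 𝓔.CoarselyDense X' ∧ (𝓔.restrict X').LocallyFinite

/-- The product coarse structure. -/
def prod (𝓔 : CoarseStructure X) (𝓕 : CoarseStructure Y) : CoarseStructure (X × Y) :=
  generate {G | ∃ E F, 𝓔.Controlled E ∧ 𝓕.Controlled F ∧
    G = {p | (p.1.1, p.2.1) ∈ E ∧ (p.1.2, p.2.2) ∈ F}}

/-- The metric coarse structure of `ℤ`. -/
def int : CoarseStructure ℤ where
  Controlled E := ∃ R : ℤ, ∀ p ∈ E, |p.1 - p.2| ≤ R
  diag := ⟨0, by rintro ⟨a, b⟩ (rfl : a = b); simp⟩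
  subset := fun ⟨R, h⟩ h' => ⟨R, fun p hp => h p (h' hp)⟩
  inv := fun ⟨R, h⟩ => ⟨R, fun p hp => by rw [abs_sub_comm]; exact h p.swap hp⟩
  comp := by
    rintro E F ⟨R, h⟩ ⟨R', h'⟩
    refine ⟨R + R', ?_⟩
    rintro ⟨a, c⟩ ⟨b, h1, h2⟩
    exact (abs_sub_le a b c).trans (add_le_add (h _ h1) (h' _ h2))
  union := by
    rintro E F ⟨R, h⟩ ⟨R', h'⟩
    exact ⟨max R R', fun p hp => hp.elim (fun hp => (h p hp).trans (le_max_left _ _))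
      (fun hp => (h' p hp).trans (le_max_right _ _))⟩

/-- The coarse structure `𝓔_U` on `X × I`, `I = [a, b]`, associated to a family `U` of subsets of
`I × I` (later on: of neighbourhoods of the diagonal). It is generated by the sets
`{((x, s), (y, s)) | (x, y) ∈ E}` for entourages `E`, and `{((x, s), (x, t)) | (s, t) ∈ U x}`. -/
def cylinder (𝓔 : CoarseStructure X) {a b : ℝ}
    (U : X → Set (Set.Icc a b × Set.Icc a b)) : CoarseStructure (X × Set.Icc a b) :=
  generate ({G | ∃ E, 𝓔.Controlled E ∧ G = {p | (p.1.1, p.2.1) ∈ E ∧ p.1.2 = p.2.2}} ∪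
    {{p | p.1.1 = p.2.1 ∧ (p.1.2, p.2.2) ∈ U p.1.1}})

end CoarseStructure

section Maps

variable {S : Type*} {X : Type*} {Y : Type*}

/-- Two maps into a coarse space are close. -/
def AreClose (𝓕 : CoarseStructure Y) (f g : S → Y) : Prop :=
  𝓕.Controlled (Set.range fun x => (f x, g x))

/-- Controlled maps. -/
def IsControlledMap (𝓔 : CoarseStructure X) (𝓕 : CoarseStructure Y) (f : X → Y) : Prop :=
  ∀ E, 𝓔.Controlled E → 𝓕.Controlled (Prod.map f f '' E)

/-- (Coarsely) proper maps. -/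
def IsCoarselyProper (𝓔 : CoarseStructure X) (𝓕 : CoarseStructure Y) (f : X → Y) : Prop :=
  ∀ B, 𝓕.Bounded B → 𝓔.Precompact (f ⁻¹' B)

/-- Coarse maps. -/
structure IsCoarseMap (𝓔 : CoarseStructure X) (𝓕 : CoarseStructure Y) (f : X → Y) : Prop where
  controlled : IsControlledMap 𝓔 𝓕 f
  proper : IsCoarselyProper 𝓔 𝓕 f

/-- Coarse equivalences. -/
def IsCoarseEquivalence (𝓔 : CoarseStructure X) (𝓕 : CoarseStructure Y) (f : X → Y) : Prop :=
  IsCoarseMap 𝓔 𝓕 f ∧ ∃ g : Y → X, IsCoarseMap 𝓕 𝓔 g ∧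
    AreClose 𝓔 (g ∘ f) id ∧ AreClose 𝓕 (f ∘ g) id

/-- Bornological maps. -/
def IsBornological (𝓔 : CoarseStructure X) (𝓕 : CoarseStructure Y) (f : X → Y) : Prop :=
  ∀ B, 𝓔.Bounded B → 𝓕.Bounded (f '' B)

end Maps

/-! ### Elementary facts needed to construct subspaces and compositions -/

namespace CoarseStructure

variable {X : Type u} {Y : Type v}

theorem Bounded.mono {𝓔 : CoarseStructure X} {K L : Set X} (h : 𝓔.Bounded L) (hK : K ⊆ L) :
    𝓔.Bounded K := by
  obtain ⟨E, hE, y, hy⟩ := h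
  exact ⟨E, hE, y, hK.trans hy⟩

theorem Bounded.prod {𝓔 : CoarseStructure X} {K : Set X} (h : 𝓔.Bounded K) :
    𝓔.Controlled (K ×ˢ K) := by
  obtain ⟨E, hE, y, hy⟩ := h
  refine 𝓔.subset (𝓔.comp hE (𝓔.inv hE)) ?_
  rintro ⟨a, b⟩ ⟨ha, hb⟩
  obtain ⟨_, rfl, h1⟩ := hy ha
  obtain ⟨_, rfl, h2⟩ := hy hb
  exact ⟨_, h1, h2⟩

theorem bounded_of_prod {𝓔 : CoarseStructure X} {K : Set X} (h : 𝓔.Controlled (K ×ˢ K))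
    (hK : K.Nonempty) : 𝓔.Bounded K := by
  obtain ⟨y, hy⟩ := hK
  exact ⟨_, h, y, fun x hx => ⟨y, rfl, hx, hy⟩⟩

theorem Bounded.precompact {𝓔 : CoarseStructure X} {K : Set X} (h : 𝓔.Bounded K) :
    𝓔.Precompact K := ⟨{K}, Set.finite_singleton _, by simpa using h, by simp⟩

theorem Precompact.mono {𝓔 : CoarseStructure X} {K L : Set X} (h : 𝓔.Precompact L) (hK : K ⊆ L) :
    𝓔.Precompact K := by
  obtain ⟨F, hF, hb, rfl⟩ := h
  refine ⟨(fun M => M ∩ K) '' F, hF.image _, ?_, ?_⟩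
  · rintro _ ⟨M, hM, rfl⟩
    exact (hb M hM).mono Set.inter_subset_left
  · ext x
    constructor
    · intro hx
      obtain ⟨M, hM, hxM⟩ := hK hx
      exact ⟨_, ⟨M, hM, rfl⟩, hxM, hx⟩
    · rintro ⟨_, ⟨M, hM, rfl⟩, hxM, hx⟩
      exact hx

theorem Precompact.preimage {𝓔 : CoarseStructure X} {𝓕 : CoarseStructure Y} {f : X → Y}
    (hf : IsCoarselyProper 𝓔 𝓕 f) {K : Set Y} (h : 𝓕.Precompact K) : 𝓔.Precompact (f ⁻¹' K) := by
  obtain ⟨F, hF, hb, rfl⟩ := h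
  choose! G hG hGb hGe using fun L (hL : L ∈ F) => hf L (hb L hL)
  refine ⟨⋃ L ∈ F, G L, hF.biUnion hG, ?_, ?_⟩
  · intro M hM
    simp only [Set.mem_iUnion] at hM
    obtain ⟨L, hL, hM⟩ := hM
    exact hGb L hL M hM
  · ext x
    constructor
    · rintro ⟨L, hL, hx⟩
      have : x ∈ ⋃₀ G L := hGe L hL ▸ hx
      obtain ⟨M, hM, hxM⟩ := this
      exact ⟨M, by simp only [Set.mem_iUnion]; exact ⟨L, hL, hM⟩, hxM⟩
    · rintro ⟨M, hM, hxM⟩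
      simp only [Set.mem_iUnion] at hM
      obtain ⟨L, hL, hM⟩ := hM
      have : x ∈ f ⁻¹' L := (hGe L hL).symm ▸ ⟨M, hM, hxM⟩
      exact ⟨L, hL, this⟩

theorem LocallyFinite.finite_of_precompact {𝓔 : CoarseStructure X} (h : 𝓔.LocallyFinite)
    {K : Set X} (hK : 𝓔.Precompact K) : K.Finite := by
  obtain ⟨F, hF, hb, rfl⟩ := hK
  exact hF.sUnion fun L hL => h L (hb L hL)

theorem controlled_restrict_iff {𝓔 : CoarseStructure X} {A : Set X} {F : SetRel A A} :
    (𝓔.restrict A).Controlled F ↔ 𝓔.Controlled (Prod.map Subtype.val Subtype.val '' F) := by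
  constructor
  · rintro ⟨E, hE, rfl⟩
    exact 𝓔.subset hE (Set.image_preimage_subset _ _)
  · intro h
    exact ⟨_, h, (Set.preimage_image_eq _
      (Subtype.val_injective.prodMap Subtype.val_injective)).symm⟩

theorem Bounded.of_restrict {𝓔 : CoarseStructure X} {A : Set X} {K : Set A}
    (h : (𝓔.restrict A).Bounded K) : 𝓔.Bounded (Subtype.val '' K) := by
  obtain ⟨_, ⟨E, hE, rfl⟩, y, hy⟩ := h
  refine ⟨E, hE, y, ?_⟩
  rintro _ ⟨x, hx, rfl⟩
  obtain ⟨_, rfl, h1⟩ := hy hx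
  exact ⟨_, rfl, h1⟩

theorem Precompact.to_restrict {𝓔 : CoarseStructure X} {A : Set X} {K : Set X}
    (h : 𝓔.Precompact K) : (𝓔.restrict A).Precompact (Subtype.val ⁻¹' K) := by
  obtain ⟨F, hF, hb, rfl⟩ := h
  refine ⟨{M | M.Nonempty ∧ ∃ L ∈ F, M = Subtype.val ⁻¹' L}, ?_, ?_, ?_⟩
  · refine (hF.image fun L => (Subtype.val ⁻¹' L : Set A)).subset ?_
    rintro M ⟨-, L, hL, rfl⟩
    exact ⟨L, hL, rfl⟩
  · rintro M ⟨hM, L, hL, rfl⟩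
    exact bounded_of_prod ⟨_, (hb L hL).prod, rfl⟩ hM
  · ext x
    constructor
    · rintro ⟨L, hL, hx⟩
      exact ⟨_, ⟨⟨x, hx⟩, L, hL, rfl⟩, hx⟩
    · rintro ⟨_, ⟨-, L, hL, rfl⟩, hx⟩
      exact ⟨L, hL, hx⟩

theorem LocallyFinite.restrict {𝓔 : CoarseStructure X} (h : 𝓔.LocallyFinite) (A : Set X) :
    (𝓔.restrict A).LocallyFinite := fun _ hK =>
  Set.Finite.of_finite_image (h _ hK.of_restrict) Subtype.val_injective.injOn

theorem isCoarseMap_val (𝓔 : CoarseStructure X) (A : Set X) :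
    IsCoarseMap (𝓔.restrict A) 𝓔 Subtype.val :=
  ⟨fun _ hE => controlled_restrict_iff.1 hE, fun _ hB => hB.precompact.to_restrict⟩

theorem _root_.IsCoarseMap.id (𝓔 : CoarseStructure X) : IsCoarseMap 𝓔 𝓔 id :=
  ⟨fun E hE => by simpa using hE, fun _ hB => hB.precompact⟩

theorem _root_.IsCoarseMap.comp {Z : Type*} {𝓔 : CoarseStructure X} {𝓕 : CoarseStructure Y}
    {𝓖 : CoarseStructure Z} {g : Y → Z} {f : X → Y} (hg : IsCoarseMap 𝓕 𝓖 g)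
    (hf : IsCoarseMap 𝓔 𝓕 f) : IsCoarseMap 𝓔 𝓖 (g ∘ f) :=
  ⟨fun E hE => by
    have := hg.controlled _ (hf.controlled E hE)
    rwa [← Set.image_comp, Prod.map_comp_map] at this,
   fun B hB => (hg.proper B hB).preimage hf.proper⟩

theorem _root_.IsCoarseMap.restrict {𝓔 : CoarseStructure X} {𝓕 : CoarseStructure Y} {f : X → Y}
    (hf : IsCoarseMap 𝓔 𝓕 f) {A : Set X} {B : Set Y} (h : Set.MapsTo f A B) :
    IsCoarseMap (𝓔.restrict A) (𝓕.restrict B) (h.restrict f A B) := by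
  constructor
  · rintro _ ⟨E, hE, rfl⟩
    rw [controlled_restrict_iff]
    refine 𝓕.subset (hf.controlled E hE) ?_
    rintro _ ⟨_, ⟨p, hp, rfl⟩, rfl⟩
    exact ⟨_, hp, rfl⟩
  · intro C hC
    refine ((hf.proper _ hC.of_restrict).to_restrict (A := A)).mono ?_
    intro x hx
    exact ⟨_, hx, rfl⟩

/-- A countably generated coarse structure has a cofinal sequence of entourages. -/
theorem CountablyGenerated.exists_seq {𝓔 : CoarseStructure X} (h : 𝓔.CountablyGenerated) :
    ∃ F : ℕ → SetRel X X, (∀ n, 𝓔.Controlled (F n)) ∧ ∀ E, 𝓔.Controlled E → ∃ n, E ⊆ F n := by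
  obtain ⟨S, hS, hE⟩ := h
  obtain ⟨s, hs⟩ := (hS.insert SetRel.id).exists_eq_range (Set.insert_nonempty _ _)
  let F : ℕ → SetRel X X := fun n =>
    Nat.rec SetRel.id (fun n G => G ∪ G.comp G ∪ G.inv ∪ s n) n
  have hF : ∀ n, F (n + 1) = F n ∪ (F n).comp (F n) ∪ (F n).inv ∪ s n := fun n => rfl
  have hmono : Monotone F := monotone_nat_of_le_succ fun n => by
    rw [hF]; intro p hp; exact Or.inl (Or.inl (Or.inl hp))
  refine ⟨F, fun n => ?_, fun E h => ?_⟩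
  · induction n with
    | zero => exact 𝓔.diag
    | succ n ih =>
      rw [hF]
      refine 𝓔.union (𝓔.union (𝓔.union ih (𝓔.comp ih ih)) (𝓔.inv ih)) ?_
      have : s n ∈ insert SetRel.id S := hs ▸ ⟨n, rfl⟩
      rcases this with h | h
      · rw [h]; exact 𝓔.diag
      · exact (hE _).2 (.basic _ h)
  · replace h : GenerateControlled S E := (hE E).1 h
    induction h with
    | basic E hES =>
      have : E ∈ Set.range s := hs ▸ Or.inr hES
      obtain ⟨n, rfl⟩ := this
      exact ⟨n + 1, by rw [hF]; exact Set.subset_union_right⟩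
    | diag => exact ⟨0, le_rfl⟩
    | subset E E' _ h ih =>
      obtain ⟨n, hn⟩ := ih
      exact ⟨n, h.trans hn⟩
    | inv E _ ih =>
      obtain ⟨n, hn⟩ := ih
      refine ⟨n + 1, ?_⟩
      rw [hF]
      intro p hp
      exact Or.inl (Or.inr (hn hp))
    | comp E E' _ _ ih ih' =>
      obtain ⟨n, hn⟩ := ih
      obtain ⟨m, hm⟩ := ih'
      refine ⟨max n m + 1, ?_⟩
      rw [hF]
      rintro ⟨a, c⟩ ⟨b, h1, h2⟩
      exact Or.inl (Or.inl (Or.inr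
        ⟨b, hmono (le_max_left n m) (hn h1), hmono (le_max_right n m) (hm h2)⟩))
    | union E E' _ _ ih ih' =>
      obtain ⟨n, hn⟩ := ih
      obtain ⟨m, hm⟩ := ih'
      exact ⟨max n m, Set.union_subset (hn.trans (hmono (le_max_left n m)))
        (hm.trans (hmono (le_max_right n m)))⟩

theorem countablyGenerated_of_seq {𝓔 : CoarseStructure X} (F : ℕ → SetRel X X)
    (hF : ∀ n, 𝓔.Controlled (F n)) (h : ∀ E, 𝓔.Controlled E → ∃ n, E ⊆ F n) :
    𝓔.CountablyGenerated := by
  refine ⟨Set.range F, Set.countable_range F, fun E => ⟨fun hE => ?_, fun hE => ?_⟩⟩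
  · obtain ⟨n, hn⟩ := h E hE
    exact .subset _ _ (.basic _ ⟨n, rfl⟩) hn
  · replace hE : GenerateControlled (Set.range F) E := hE
    induction hE with
    | basic E h => obtain ⟨n, rfl⟩ := h; exact hF n
    | diag => exact 𝓔.diag
    | subset E E' _ h ih => exact 𝓔.subset ih h
    | inv E _ ih => exact 𝓔.inv ih
    | comp E E' _ _ ih ih' => exact 𝓔.comp ih ih'
    | union E E' _ _ ih ih' => exact 𝓔.union ih ih'

theorem CountablyGenerated.restrict {𝓔 : CoarseStructure X} (h : 𝓔.CountablyGenerated)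
    (A : Set X) : (𝓔.restrict A).CountablyGenerated := by
  obtain ⟨F, hF, hc⟩ := h.exists_seq
  refine countablyGenerated_of_seq (fun n => Prod.map Subtype.val Subtype.val ⁻¹' F n)
    (fun n => ⟨_, hF n, rfl⟩) ?_
  rintro _ ⟨E, hE, rfl⟩
  obtain ⟨n, hn⟩ := hc E hE
  exact ⟨n, Set.preimage_mono hn⟩

theorem BornologicallyBoundedGeometry.restrict {𝓔 : CoarseStructure X}
    (h : 𝓔.BornologicallyBoundedGeometry) (A : Set X) :
    (𝓔.restrict A).BornologicallyBoundedGeometry := by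
  classical
  obtain ⟨X', ⟨E, hE, hd⟩, hf⟩ := h
  choose p hpX hpE using hd
  -- for each point of `X'` near `A` choose a point of `A` near it
  let q : X → Set A := fun y => if h : ∃ a : A, p a = y then {h.choose} else ∅
  have hq : ∀ y, ∀ a ∈ q y, p a = y := by
    intro y a ha
    by_cases h : ∃ a : A, p a = y
    · simp only [q, dif_pos h, Set.mem_singleton_iff] at ha
      rw [ha]; exact h.choose_spec
    · simp only [q, dif_neg h] at ha
      exact ha.elim
  have hq1 : ∀ y, (q y).Subsingleton := by
    intro y
    by_cases h : ∃ a : A, p a = y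
    · simp only [q, dif_pos h]; exact Set.subsingleton_singleton
    · simp only [q, dif_neg h]; exact Set.subsingleton_empty
  refine ⟨⋃ y, q y, ⟨Prod.map Subtype.val Subtype.val ⁻¹' (E.comp E.inv),
    ⟨_, 𝓔.comp hE (𝓔.inv hE), rfl⟩, fun a => ?_⟩, fun K hK => ?_⟩
  · have h : ∃ b : A, p b = p a := ⟨a, rfl⟩
    have hm : h.choose ∈ q (p a) := by
      simp only [q, dif_pos h]; rfl
    refine ⟨h.choose, Set.mem_iUnion.2 ⟨_, hm⟩, p a, hpE a, ?_⟩
    have := hpE h.choose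
    rw [h.choose_spec] at this
    exact this
  · let K' : Set X := Subtype.val '' (Subtype.val '' K)
    have hK' : 𝓔.Bounded K' := hK.of_restrict.of_restrict
    have hb : 𝓔.Bounded (p '' K') := by
      obtain ⟨F, hF, y, hy⟩ := hK'
      refine ⟨E.inv.comp F, 𝓔.comp (𝓔.inv hE) hF, y, ?_⟩
      rintro _ ⟨x, hx, rfl⟩
      obtain ⟨_, rfl, hxy⟩ := hy hx
      exact ⟨_, rfl, x, hpE x, hxy⟩
    have hfin : (p '' K').Finite := by
      have h1 : (𝓔.restrict X').Precompact (Subtype.val ⁻¹' (p '' K')) :=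
        hb.precompact.to_restrict
      have h2 := (hf.finite_of_precompact h1).image Subtype.val
      refine h2.subset ?_
      rintro _ ⟨x, hx, rfl⟩
      exact ⟨⟨p x, hpX x⟩, ⟨x, hx, rfl⟩, rfl⟩
    refine Set.Finite.of_finite_image (f := fun k => p k.1.1) (hfin.subset ?_) ?_
    · rintro _ ⟨k, hk, rfl⟩
      exact ⟨_, ⟨_, ⟨k, hk, rfl⟩, rfl⟩, rfl⟩
    · rintro ⟨a, ha⟩ _ ⟨b, hb⟩ _ hab
      obtain ⟨y, hy⟩ := Set.mem_iUnion.1 ha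
      obtain ⟨z, hz⟩ := Set.mem_iUnion.1 hb
      have : y = z := by rw [← hq y a hy, ← hq z b hz]; exact hab
      subst this
      exact Subtype.ext (hq1 y hy hz)

end CoarseStructure

/-! ## Pairs of coarse `Γ`-spaces -/

/-- `E` is invariant under the diagonal action. -/
def IsInvariantRel (Γ : Type v) [Group Γ] {X : Type u} [MulAction Γ X] (E : SetRel X X) : Prop :=
  ∀ (γ : Γ) (x y : X), (x, y) ∈ E → (γ • x, γ • y) ∈ E

/-- The induced action on an invariant subset. -/
abbrev invariantAction {Γ : Type v} [Group Γ] {X : Type u} [MulAction Γ X] (S : Set X)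
    (hS : ∀ (γ : Γ), ∀ x ∈ S, γ • x ∈ S) : MulAction Γ S where
  smul γ x := ⟨γ • x.1, hS γ x.1 x.2⟩
  one_smul x := Subtype.ext (one_smul Γ x.1)
  mul_smul γ γ' x := Subtype.ext (mul_smul γ γ' x.1)

/-- Pairs `(X, A)` of countably generated proper isocoarse `Γ`-spaces of bornologically bounded
geometry, for a discrete group `Γ`. (For `A` these properties are inherited from `X`.) -/
structure CoarsePair (Γ : Type v) [Group Γ] where
  carrier : Type u
  [action : MulAction Γ carrier]
  coarse : CoarseStructure carrier
  /-- The subspace `A`. -/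
  sub : Set carrier
  smul_mem_sub : ∀ (γ : Γ), ∀ x ∈ sub, γ • x ∈ sub
  smul_isCoarseEquivalence : ∀ γ : Γ, IsCoarseEquivalence coarse coarse (fun x => γ • x)
  proper : ∀ K, coarse.Bounded K → {γ : Γ | ∃ x ∈ K, γ • x ∈ K}.Finite
  isocoarse : ∀ E, coarse.Controlled E → ∃ F, coarse.Controlled F ∧ E ⊆ F ∧ IsInvariantRel Γ F
  countablyGenerated : coarse.CountablyGenerated
  boundedGeometry : coarse.BornologicallyBoundedGeometry

namespace CoarsePair

variable {Γ : Type v} [Group Γ]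

attribute [instance] CoarsePair.action

/-- Morphisms: `Γ`-equivariant coarse maps `X → Y` which map `A` into `B`. -/
@[ext]
structure Hom (P Q : CoarsePair.{u} Γ) where
  toFun : P.carrier → Q.carrier
  isCoarseMap : IsCoarseMap P.coarse Q.coarse toFun
  map_smul : ∀ (γ : Γ) (x : P.carrier), toFun (γ • x) = γ • toFun x
  mapsTo : Set.MapsTo toFun P.sub Q.sub

instance : Category (CoarsePair.{u} Γ) where
  Hom := Hom
  id P := ⟨id, .id _, fun _ _ => rfl, fun _ h => h⟩
  comp f g := ⟨g.toFun ∘ f.toFun, g.isCoarseMap.comp f.isCoarseMap,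
    fun γ x => by simp [f.map_smul, g.map_smul], g.mapsTo.comp f.mapsTo⟩

theorem isCoarseEquivalence_smul_of_isocoarse {X : Type u} [MulAction Γ X] {𝓔 : CoarseStructure X}
    (h : ∀ E, 𝓔.Controlled E → ∃ F, 𝓔.Controlled F ∧ E ⊆ F ∧ IsInvariantRel Γ F) (γ : Γ) :
    IsCoarseEquivalence 𝓔 𝓔 (fun x => γ • x) := by
  have key : ∀ γ : Γ, IsCoarseMap 𝓔 𝓔 (fun x => γ • x) := by
    intro γ
    refine ⟨fun E hE => ?_, fun B hB => ?_⟩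
    · obtain ⟨F, hF, hEF, hi⟩ := h E hE
      refine 𝓔.subset hF ?_
      rintro _ ⟨⟨x, y⟩, hp, rfl⟩
      exact hi γ x y (hEF hp)
    · obtain ⟨E, hE, y, hy⟩ := hB
      obtain ⟨F, hF, hEF, hi⟩ := h E hE
      refine CoarseStructure.Bounded.precompact ⟨F, hF, γ⁻¹ • y, fun x hx => ?_⟩
      obtain ⟨_, rfl, hxy⟩ := hy hx
      have := hi γ⁻¹ _ _ (hEF hxy)
      rw [inv_smul_smul] at this
      exact ⟨_, rfl, this⟩
  refine ⟨key γ, _, key γ⁻¹, ?_, ?_⟩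
  · refine 𝓔.subset 𝓔.diag ?_
    rintro _ ⟨x, rfl⟩
    simp
  · refine 𝓔.subset 𝓔.diag ?_
    rintro _ ⟨x, rfl⟩
    simp

/-- The pair `(S, T)` for an invariant subset `S ⊆ X` with the restricted coarse structure and an
invariant subset `T` of `S`. -/
def restrict (P : CoarsePair.{u} Γ) (S : Set P.carrier) (hS : ∀ (γ : Γ), ∀ x ∈ S, γ • x ∈ S)
    (T : Set S) (hT : ∀ (γ : Γ) (x : S), x ∈ T → (⟨γ • x.1, hS γ x.1 x.2⟩ : S) ∈ T) :
    CoarsePair.{u} Γ :=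
  letI := invariantAction S hS
  have hiso : ∀ E, (P.coarse.restrict S).Controlled E →
      ∃ F, (P.coarse.restrict S).Controlled F ∧ E ⊆ F ∧ IsInvariantRel Γ F := by
    rintro _ ⟨E, hE, rfl⟩
    obtain ⟨F, hF, hEF, hi⟩ := P.isocoarse E hE
    exact ⟨_, ⟨F, hF, rfl⟩, Set.preimage_mono hEF, fun γ x y h => hi γ x.1 y.1 h⟩
  { carrier := S
    coarse := P.coarse.restrict S
    sub := T
    smul_mem_sub := hT
    smul_isCoarseEquivalence := isCoarseEquivalence_smul_of_isocoarse hiso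
    proper := fun K hK => (P.proper _ hK.of_restrict).subset (by
      rintro γ ⟨x, hx, hγ⟩
      exact ⟨x.1, ⟨x, hx, rfl⟩, ⟨_, hγ, rfl⟩⟩)
    isocoarse := hiso
    countablyGenerated := P.countablyGenerated.restrict S
    boundedGeometry := P.boundedGeometry.restrict S }

/-- `(X, A) ↦ (X, ∅)` -/
def absolute (P : CoarsePair.{u} Γ) : CoarsePair.{u} Γ :=
  { P with
    sub := ∅
    smul_mem_sub := fun _ _ h => h.elim }

/-- `(X, A) ↦ (A, ∅)` -/
def subspace (P : CoarsePair.{u} Γ) : CoarsePair.{u} Γ :=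
  P.restrict P.sub P.smul_mem_sub ∅ fun _ _ h => h.elim

/-- Functoriality of `(X, A) ↦ (A, ∅)`. -/
def subspaceMap {P Q : CoarsePair.{u} Γ} (f : P ⟶ Q) : P.subspace ⟶ Q.subspace where
  toFun := f.mapsTo.restrict
  isCoarseMap := f.isCoarseMap.restrict f.mapsTo
  map_smul γ x := Subtype.ext (f.map_smul γ x.1)
  mapsTo := fun _ h => h.elim

/-- The inclusion `(A, ∅) → (X, ∅)`. -/
def incl (P : CoarsePair.{u} Γ) : P.subspace ⟶ P.absolute where
  toFun := Subtype.val
  isCoarseMap := CoarseStructure.isCoarseMap_val _ _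
  map_smul _ _ := rfl
  mapsTo := fun _ h => h.elim

/-- The inclusion `(X, ∅) → (X, A)`. -/
def toPair (P : CoarsePair.{u} Γ) : P.absolute ⟶ P where
  toFun := id
  isCoarseMap := .id _
  map_smul _ _ := rfl
  mapsTo := fun _ h => h.elim

/-- `f` and `g` are related by a `Γ`-equivariant coarse homotopy: an equivariant controlled
map `H : X × ℤ → Y` mapping `A × ℤ` into `B`, which agrees with `f` for `n ≤ ρ⁻(x)` and with `g` for
`n ≥ ρ⁺(x)`, with `ρ⁻, ρ⁺ : X → ℤ` bornological, and whose restriction to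
`{(x, n) | ρ⁻(x) ≤ n ≤ ρ⁺(x)}` is a coarse map. -/
def CoarselyHomotopic {P Q : CoarsePair.{u} Γ} (f g : P ⟶ Q) : Prop :=
  ∃ (H : P.carrier × ℤ → Q.carrier) (ρm ρp : P.carrier → ℤ),
    (∀ (γ : Γ) x n, H (γ • x, n) = γ • H (x, n)) ∧
    (∀ x ∈ P.sub, ∀ n, H (x, n) ∈ Q.sub) ∧
    IsBornological P.coarse CoarseStructure.int ρm ∧
    IsBornological P.coarse CoarseStructure.int ρp ∧
    (∀ x n, n ≤ ρm x → H (x, n) = f.toFun x) ∧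
    (∀ x n, ρp x ≤ n → H (x, n) = g.toFun x) ∧
    IsControlledMap (P.coarse.prod CoarseStructure.int) Q.coarse H ∧
    IsCoarseMap
      ((P.coarse.prod CoarseStructure.int).restrict {z | ρm z.1 ≤ z.2 ∧ z.2 ≤ ρp z.1})
      Q.coarse (fun z => H z.1)

/-- `f` and `g` are related by a `Γ`-equivariant generalized coarse homotopy, i.e. by an
equivariant coarse map `H` on some `(X × [a, b], 𝓔_U)`, where `U` is a `Γ`-invariant family of
neighbourhoods of the diagonal of `[a, b]`. -/
def GeneralizedCoarselyHomotopic {P Q : CoarsePair.{u} Γ} (f g : P ⟶ Q) : Prop :=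
  ∃ (a b : ℝ) (hab : a ≤ b) (U : P.carrier → Set (Set.Icc a b × Set.Icc a b))
    (H : P.carrier × Set.Icc a b → Q.carrier),
    (∀ x, U x ∈ 𝓝ˢ (Set.diagonal (Set.Icc a b))) ∧
    (∀ (γ : Γ) x, U (γ • x) = U x) ∧
    IsCoarseMap (P.coarse.cylinder U) Q.coarse H ∧
    (∀ (γ : Γ) x s, H (γ • x, s) = γ • H (x, s)) ∧
    (∀ x ∈ P.sub, ∀ s, H (x, s) ∈ Q.sub) ∧
    (∀ x, H (x, ⟨a, Set.left_mem_Icc.2 hab⟩) = f.toFun x) ∧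
    (∀ x, H (x, ⟨b, Set.right_mem_Icc.2 hab⟩) = g.toFun x)

/-- Excisions: up to the identification of the source with its image, `f` is the inclusion of
`(X ∖ C, A ∖ C)` into `(X, A)`, where `C ⊆ A` is the complement of the image of `f`, and for every
entourage `E` there is an entourage `F` with `Pen_E(A) ∖ C ⊆ Pen_F(A ∖ C)`. -/
def IsExcision {P Q : CoarsePair.{u} Γ} (f : P ⟶ Q) : Prop :=
  Function.Injective f.toFun ∧
  (∀ E, P.coarse.Controlled E ↔ Q.coarse.Controlled (Prod.map f.toFun f.toFun '' E)) ∧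
  (Set.range f.toFun)ᶜ ⊆ Q.sub ∧
  P.sub = f.toFun ⁻¹' Q.sub ∧
  ∀ E, Q.coarse.Controlled E → ∃ F, Q.coarse.Controlled F ∧
    CoarseStructure.pen E Q.sub ∩ Set.range f.toFun ⊆
      CoarseStructure.pen F (Q.sub ∩ Set.range f.toFun)

end CoarsePair

/-! ## Pairs of `σ`-locally compact `Γ`-spaces -/

/-- Pairs `(𝒳, 𝒜)` of `σ`-locally compact `Γ`-spaces, for a discrete group `Γ`: `𝒳` is the union of
an increasing sequence `X₀ ⊆ X₁ ⊆ ⋯` of locally compact Hausdorff `Γ`-spaces, each of which is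
closed in the later ones and carries the subspace topology, and `𝒜` is a closed invariant
subspace. -/
structure SigmaPair (Γ : Type v) [Group Γ] where
  carrier : Type u
  [action : MulAction Γ carrier]
  /-- The filtration `Xₙ`. -/
  filt : ℕ → Set carrier
  filt_mono : Monotone filt
  exists_mem_filt : ∀ x, ∃ n, x ∈ filt n
  [top : ∀ n, TopologicalSpace (filt n)]
  [t2 : ∀ n, T2Space (filt n)]
  [locallyCompact : ∀ n, LocallyCompactSpace (filt n)]
  isClosedEmbedding : ∀ {m n : ℕ} (h : m ≤ n), IsClosedEmbedding (Set.inclusion (filt_mono h))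
  smul_mem_filt : ∀ (γ : Γ) (n : ℕ), ∀ x ∈ filt n, γ • x ∈ filt n
  continuous_smul : ∀ (γ : Γ) (n : ℕ),
    Continuous fun x : filt n => (⟨γ • x.1, smul_mem_filt γ n x.1 x.2⟩ : filt n)
  /-- The subspace `𝒜`. -/
  sub : Set carrier
  isClosed_sub : ∀ n, IsClosed {x : filt n | x.1 ∈ sub}
  smul_mem_sub : ∀ (γ : Γ), ∀ x ∈ sub, γ • x ∈ sub

namespace SigmaPair

variable {Γ : Type v} [Group Γ]

attribute [instance] SigmaPair.action SigmaPair.top SigmaPair.t2 SigmaPair.locallyCompact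

/-- The final topology on `𝒳 = ⋃ Xₙ`: a set is open iff its intersection with each `Xₙ` is. -/
@[reducible] def finalTopology (P : SigmaPair.{u} Γ) : TopologicalSpace P.carrier :=
  ⨆ n, TopologicalSpace.coinduced (Subtype.val : P.filt n → P.carrier) (P.top n)

/-- Morphisms: proper continuous `Γ`-equivariant `σ`-maps `𝒳 → 𝒴` which map `𝒜` into `ℬ`.
(`IsProperMap` includes continuity.) -/
@[ext]
structure Hom (P Q : SigmaPair.{u} Γ) where
  toFun : P.carrier → Q.carrier
  isProper : ∀ m, ∃ n, ∃ h : Set.MapsTo toFun (P.filt m) (Q.filt n), IsProperMap h.restrict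
  map_smul : ∀ (γ : Γ) (x : P.carrier), toFun (γ • x) = γ • toFun x
  mapsTo : Set.MapsTo toFun P.sub Q.sub

instance : Category (SigmaPair.{u} Γ) where
  Hom := Hom
  id P := ⟨id, fun m => ⟨m, Set.mapsTo_id _, isProperMap_id⟩, fun _ _ => rfl, fun _ h => h⟩
  comp f g := ⟨g.toFun ∘ f.toFun, fun m => by
      obtain ⟨n, h, hp⟩ := f.isProper m
      obtain ⟨k, h', hp'⟩ := g.isProper n
      exact ⟨k, h'.comp h, hp'.comp hp⟩,
    fun γ x => by simp [f.map_smul, g.map_smul], g.mapsTo.comp f.mapsTo⟩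

/-- `(𝒳, 𝒜) ↦ (𝒳, ∅)` -/
def absolute (P : SigmaPair.{u} Γ) : SigmaPair.{u} Γ :=
  { P with
    sub := ∅
    isClosed_sub := fun n => by simp
    smul_mem_sub := fun _ _ h => h.elim }

/-- The `n`-th stage `𝒜 ∩ Xₙ` of `𝒜`, viewed inside `Xₙ`. -/
def subToFilt (P : SigmaPair.{u} Γ) (n : ℕ) (x : (Subtype.val ⁻¹' P.filt n : Set P.sub)) :
    P.filt n := ⟨x.1.1, x.2⟩

instance (P : SigmaPair.{u} Γ) (n : ℕ) :
    TopologicalSpace (Subtype.val ⁻¹' P.filt n : Set P.sub) :=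
  TopologicalSpace.induced (P.subToFilt n) inferInstance

theorem isClosedEmbedding_subToFilt (P : SigmaPair.{u} Γ) (n : ℕ) :
    IsClosedEmbedding (P.subToFilt n) := by
  refine ⟨⟨⟨rfl⟩, fun x y h =>
    Subtype.ext (Subtype.ext (congrArg (fun z : P.filt n => z.1) h))⟩, ?_⟩
  convert P.isClosed_sub n using 1
  ext x
  constructor
  · rintro ⟨y, rfl⟩
    exact y.1.2
  · intro hx
    exact ⟨⟨⟨x.1, hx⟩, x.2⟩, rfl⟩

/-- `(𝒳, 𝒜) ↦ (𝒜, ∅)`, where `𝒜` carries the filtration by the subspaces `𝒜 ∩ Xₙ` of `Xₙ`. -/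
def subspace (P : SigmaPair.{u} Γ) : SigmaPair.{u} Γ :=
  letI := invariantAction P.sub P.smul_mem_sub
  { carrier := P.sub
    filt := fun n => Subtype.val ⁻¹' P.filt n
    filt_mono := fun _ _ h => Set.preimage_mono (P.filt_mono h)
    exists_mem_filt := fun x => P.exists_mem_filt x.1
    t2 := fun n => (P.isClosedEmbedding_subToFilt n).isEmbedding.t2Space
    locallyCompact := fun n => (P.isClosedEmbedding_subToFilt n).locallyCompactSpace
    isClosedEmbedding := fun {m n} h =>
      .of_comp (P.isClosedEmbedding_subToFilt n).isEmbedding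
        ((P.isClosedEmbedding h).comp (P.isClosedEmbedding_subToFilt m))
    smul_mem_filt := fun γ n x hx => P.smul_mem_filt γ n x.1 hx
    continuous_smul := fun γ n =>
      (P.isClosedEmbedding_subToFilt n).isEmbedding.isInducing.continuous_iff.2
        ((P.continuous_smul γ n).comp (P.isClosedEmbedding_subToFilt n).continuous)
    sub := ∅
    isClosed_sub := fun n => by simp
    smul_mem_sub := fun _ _ h => h.elim }

/-- Functoriality of `(𝒳, 𝒜) ↦ (𝒜, ∅)`. -/
def subspaceMap {P Q : SigmaPair.{u} Γ} (f : P ⟶ Q) : P.subspace ⟶ Q.subspace where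
  toFun := f.mapsTo.restrict
  isProper m := by
    obtain ⟨n, h, hp⟩ := f.isProper m
    refine ⟨n, fun x hx => h hx, ?_⟩
    have h1 := hp.comp (P.isClosedEmbedding_subToFilt m).isProperMap
    exact isProperMap_of_comp_of_inj
      ((Q.isClosedEmbedding_subToFilt n).isEmbedding.isInducing.continuous_iff.2 h1.continuous)
      (Q.isClosedEmbedding_subToFilt n).continuous h1
      (Q.isClosedEmbedding_subToFilt n).isEmbedding.injective
  map_smul γ x := Subtype.ext (f.map_smul γ x.1)
  mapsTo := fun _ h => h.elim

/-- The inclusion `(𝒜, ∅) → (𝒳, ∅)`. -/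
def incl (P : SigmaPair.{u} Γ) : P.subspace ⟶ P.absolute where
  toFun := Subtype.val
  isProper m := ⟨m, fun _ hx => hx, (P.isClosedEmbedding_subToFilt m).isProperMap⟩
  map_smul _ _ := rfl
  mapsTo := fun _ h => h.elim

/-- The inclusion `(𝒳, ∅) → (𝒳, 𝒜)`. -/
def toPair (P : SigmaPair.{u} Γ) : P.absolute ⟶ P where
  toFun := id
  isProper m := ⟨m, fun _ hx => hx, isProperMap_id⟩
  map_smul _ _ := rfl
  mapsTo := fun _ h => h.elim

/-- `f` and `g` are homotopic: there is a morphism `(𝒳 × [0, 1], 𝒜 × [0, 1]) → (𝒴, ℬ)` restricting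
to `f` and `g` at the ends, where `𝒳 × [0, 1]` carries the filtration by the `Xₙ × [0, 1]`. -/
def Homotopic {P Q : SigmaPair.{u} Γ} (f g : P ⟶ Q) : Prop :=
  ∃ H : P.carrier × unitInterval → Q.carrier,
    (∀ m, ∃ n, ∃ h : ∀ (x : P.filt m) (t : unitInterval), H (x.1, t) ∈ Q.filt n,
      IsProperMap fun z : P.filt m × unitInterval => (⟨H (z.1.1, z.2), h z.1 z.2⟩ : Q.filt n)) ∧
    (∀ (γ : Γ) x t, H (γ • x, t) = γ • H (x, t)) ∧
    (∀ x ∈ P.sub, ∀ t, H (x, t) ∈ Q.sub) ∧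
    (∀ x, H (x, 0) = f.toFun x) ∧
    (∀ x, H (x, 1) = g.toFun x)

/-- Excisions: up to the identification of the source with its image, `f` is the inclusion of the
pair of closed subspaces `(𝒳 ∖ 𝒰, 𝒜 ∖ 𝒰)` into `(𝒳, 𝒜)`, where the closure of the open set `𝒰` (the
complement of the image of `f`) is contained in the interior of `𝒜`. -/
def IsExcision {P Q : SigmaPair.{u} Γ} (f : P ⟶ Q) : Prop :=
  Function.Injective f.toFun ∧
  (∀ n, ∃ h : Set.MapsTo f.toFun (P.filt n) (Q.filt n), IsClosedEmbedding h.restrict) ∧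
  (∀ n, P.filt n = f.toFun ⁻¹' Q.filt n) ∧
  P.sub = f.toFun ⁻¹' Q.sub ∧
  @closure _ Q.finalTopology (Set.range f.toFun)ᶜ ⊆ @interior _ Q.finalTopology Q.sub

end SigmaPair

/-! ## Rips complexes -/

namespace CoarsePair

variable {Γ : Type v} [Group Γ]

/-- A generating sequence `Δ = E₀ ⊆ E₁ ⊆ ⋯` of `Γ`-invariant entourages of `X` such that every
entourage is contained in one of the `Eₙ`. -/
structure GeneratingSequence (P : CoarsePair.{u} Γ) where
  ent : ℕ → SetRel P.carrier P.carrier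
  ent_zero : ent 0 = SetRel.id
  mono : Monotone ent
  controlled : ∀ n, P.coarse.Controlled (ent n)
  cofinal : ∀ E, P.coarse.Controlled E → ∃ n, E ⊆ ent n
  invariant : ∀ n, IsInvariantRel Γ (ent n)

/-- The underlying set of the Rips complex: formal convex combinations `∑ₓ λₓ x` of finitely many
points of `X` whose support is a simplex of some `P_E(X)`, given by their barycentric
coordinates. -/
@[ext]
structure RipsPoint (P : CoarsePair.{u} Γ) where
  coords : P.carrier →₀ ℝ
  nonneg : ∀ x, 0 ≤ coords x
  sum_eq_one : coords.sum (fun _ r => r) = 1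
  controlled : P.coarse.Controlled {p | p.1 ∈ coords.support ∧ p.2 ∈ coords.support}

/-- The subset `P_m(X)` of all points which lie in a simplex with vertices `x₀, …, xₙ` such that
`(xᵢ, xⱼ) ∈ E_m` for all `i, j`. -/
def GeneratingSequence.level {P : CoarsePair.{u} Γ} (S : P.GeneratingSequence) (m : ℕ) :
    Set P.RipsPoint :=
  {l | ∀ x ∈ l.coords.support, ∀ y ∈ l.coords.support, (x, y) ∈ S.ent m}

/-- The topology of the geometric realization `P_m(X)`: as `P_m(X)` is a locally finite simplicial
complex for locally finite `X`, it is the topology of pointwise convergence of the barycentric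
coordinates. -/
instance {P : CoarsePair.{u} Γ} (S : P.GeneratingSequence) (m : ℕ) :
    TopologicalSpace (S.level m) :=
  TopologicalSpace.induced (fun l x => l.1.coords x) (inferInstance : TopologicalSpace (_ → ℝ))

theorem mapDomain_apply_sum {X Y : Type*} [DecidableEq Y] (f : X → Y) (l : X →₀ ℝ) (y : Y) :
    Finsupp.mapDomain f l y = ∑ x ∈ l.support with f x = y, l x := by
  simp [Finsupp.mapDomain, Finsupp.sum, Finsupp.finsetSum_apply, Finsupp.single_apply,
    Finset.sum_filter]

theorem mem_support_mapDomain {X Y : Type*} (f : X → Y) (l : X →₀ ℝ) (hl : ∀ x, 0 ≤ l x) {x : X}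
    (hx : x ∈ l.support) : f x ∈ (Finsupp.mapDomain f l).support := by
  classical
  rw [Finsupp.mem_support_iff, mapDomain_apply_sum]
  have h0 : 0 < l x := lt_of_le_of_ne (hl x) (Finsupp.mem_support_iff.1 hx).symm
  have h1 : l x ≤ ∑ x' ∈ l.support with f x' = f x, l x' :=
    Finset.single_le_sum (f := fun x => l x) (fun x _ => hl x) (Finset.mem_filter.2 ⟨hx, rfl⟩)
  exact (h0.trans_le h1).ne'

theorem exists_of_mem_support_mapDomain {X Y : Type*} (f : X → Y) (l : X →₀ ℝ) {y : Y}
    (hy : y ∈ (Finsupp.mapDomain f l).support) : ∃ x ∈ l.support, f x = y := by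
  classical
  have := Finsupp.mapDomain_support hy
  simpa only [Finset.mem_image] using this

/-- Affine linear extension of a controlled map. -/
noncomputable def RipsPoint.map {P Q : CoarsePair.{u} Γ} (f : P.carrier → Q.carrier)
    (hf : IsControlledMap P.coarse Q.coarse f) (l : P.RipsPoint) : Q.RipsPoint where
  coords := Finsupp.mapDomain f l.coords
  nonneg y := by
    classical
    rw [mapDomain_apply_sum]
    exact Finset.sum_nonneg fun x _ => l.nonneg x
  sum_eq_one := by
    rw [Finsupp.sum_mapDomain_index (fun _ => rfl) (fun _ _ _ => rfl)]
    exact l.sum_eq_one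
  controlled := by
    refine Q.coarse.subset (hf _ l.controlled) ?_
    rintro ⟨y, z⟩ ⟨hy, hz⟩
    obtain ⟨x, hx, rfl⟩ := exists_of_mem_support_mapDomain f _ hy
    obtain ⟨x', hx', rfl⟩ := exists_of_mem_support_mapDomain f _ hz
    exact ⟨(x, x'), ⟨hx, hx'⟩, rfl⟩

noncomputable instance (P : CoarsePair.{u} Γ) : MulAction Γ P.RipsPoint where
  smul γ := RipsPoint.map (fun x => γ • x) (P.smul_isCoarseEquivalence γ).1.controlled
  one_smul l := by
    apply RipsPoint.ext
    change Finsupp.mapDomain (fun x => (1 : Γ) • x) l.coords = l.coords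
    simp only [one_smul]
    exact Finsupp.mapDomain_id
  mul_smul γ γ' l := by
    apply RipsPoint.ext
    change Finsupp.mapDomain (fun x => (γ * γ') • x) l.coords =
      Finsupp.mapDomain (fun x => γ • x) (Finsupp.mapDomain (fun x => γ' • x) l.coords)
    rw [← Finsupp.mapDomain_comp]
    congr 1
    ext x
    exact mul_smul γ γ' x

theorem RipsPoint.coords_smul {P : CoarsePair.{u} Γ} (γ : Γ) (l : P.RipsPoint) :
    (γ • l).coords = Finsupp.mapDomain (fun x => γ • x) l.coords := rfl

section Rips

variable {P Q : CoarsePair.{u} Γ} (S : P.GeneratingSequence) (T : Q.GeneratingSequence)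

theorem continuous_coord (m : ℕ) (x : P.carrier) :
    Continuous fun l : S.level m => l.1.coords x :=
  (continuous_apply x).comp continuous_induced_dom

theorem continuous_to_level {Z : Type*} [TopologicalSpace Z] {m : ℕ} {f : Z → S.level m}
    (h : ∀ x, Continuous fun z => (f z).1.coords x) : Continuous f :=
  continuous_induced_rng.2 (continuous_pi h)

instance (m : ℕ) : T2Space (S.level m) := by
  refine T2Space.of_injective_continuous (f := fun (l : S.level m) x => l.1.coords x) ?_
    continuous_induced_dom
  intro l l' h
  exact Subtype.ext (RipsPoint.ext (Finsupp.ext fun x => congrFun h x))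

theorem isCompact_level_of_finite (m : ℕ) {V : Set P.carrier} (hV : V.Finite) :
    IsCompact {l : S.level m | ∀ x ∈ l.1.coords.support, x ∈ V} := by
  classical
  have hind : IsInducing (fun (l : S.level m) x => l.1.coords x) := ⟨rfl⟩
  rw [hind.isCompact_iff]
  have hset : (fun (l : S.level m) x => l.1.coords x) ''
        {l : S.level m | ∀ x ∈ l.1.coords.support, x ∈ V} =
      Set.univ.pi (fun _ => Set.Icc (0 : ℝ) 1) ∩ ((⋂ x ∈ Vᶜ, {c | c x = 0}) ∩
        ({c | ∑ x ∈ hV.toFinset, c x = 1} ∩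
          ⋂ x, ⋂ y, ⋂ (_ : (x, y) ∉ S.ent m), {c | c x * c y = 0})) := by
    ext c
    constructor
    · rintro ⟨l, hl, rfl⟩
      have hsub : l.1.coords.support ⊆ hV.toFinset := fun x hx => hV.mem_toFinset.2 (hl x hx)
      have hsum : ∑ x ∈ hV.toFinset, l.1.coords x = 1 := by
        rw [← l.1.sum_eq_one, Finsupp.sum_of_support_subset _ hsub _ (fun _ _ => rfl)]
      have hz : ∀ x, x ∉ V → l.1.coords x = 0 := by
        intro x hx
        by_contra h
        exact hx (hl x (Finsupp.mem_support_iff.2 h))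
      refine ⟨fun x _ => ⟨l.1.nonneg x, ?_⟩, ?_, hsum, ?_⟩
      · by_cases hx : x ∈ V
        · rw [← hsum]
          exact Finset.single_le_sum (f := fun x => l.1.coords x) (fun x _ => l.1.nonneg x)
            (hV.mem_toFinset.2 hx)
        · change l.1.coords x ≤ 1
          rw [hz x hx]
          exact zero_le_one
      · simp only [Set.mem_iInter]
        exact fun x hx => hz x hx
      · simp only [Set.mem_iInter]
        intro x y hxy
        by_contra h
        have h' := mul_ne_zero_iff.1 h
        exact hxy (l.2 x (Finsupp.mem_support_iff.2 h'.1) y (Finsupp.mem_support_iff.2 h'.2))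
    · rintro ⟨h1, h2, h3, h4⟩
      simp only [Set.mem_iInter] at h2 h4
      have hz : ∀ x, c x ≠ 0 → x ∈ hV.toFinset := by
        intro x hx
        rw [hV.mem_toFinset]
        by_contra h
        exact hx (h2 x h)
      let l : P.carrier →₀ ℝ := Finsupp.onFinset hV.toFinset c hz
      have hent : ∀ x ∈ l.support, ∀ y ∈ l.support, (x, y) ∈ S.ent m := by
        intro x hx y hy
        by_contra h
        exact mul_ne_zero (Finsupp.mem_support_iff.1 hx) (Finsupp.mem_support_iff.1 hy) (h4 x y h)
      refine ⟨⟨⟨l, fun x => (h1 x trivial).1, ?_, ?_⟩, hent⟩, ?_, rfl⟩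
      · rw [Finsupp.sum_of_support_subset l (s := hV.toFinset) Finsupp.support_onFinset_subset _
          (fun _ _ => rfl)]
        exact h3
      · exact P.coarse.subset (S.controlled m) fun p hp => hent p.1 hp.1 p.2 hp.2
      · intro x hx
        exact hV.mem_toFinset.1 (hz x (Finsupp.mem_support_iff.1 hx))
  rw [hset]
  refine (isCompact_univ_pi fun _ => isCompact_Icc).inter_right ?_
  refine IsClosed.inter ?_ (IsClosed.inter ?_ ?_)
  · exact isClosed_biInter fun x _ => isClosed_eq (continuous_apply x) continuous_const
  · exact isClosed_eq (continuous_finsetSum _ fun x _ => continuous_apply x) continuous_const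
  · exact isClosed_iInter fun x => isClosed_iInter fun y => isClosed_iInter fun _ =>
      isClosed_eq ((continuous_apply x).mul (continuous_apply y)) continuous_const

theorem exists_mem_support (l : P.RipsPoint) : ∃ x, 0 < l.coords x := by
  by_contra! h
  have h0 : l.coords = 0 := Finsupp.ext fun x => le_antisymm (h x) (l.nonneg x)
  have := l.sum_eq_one
  rw [h0, Finsupp.sum_zero_index] at this
  exact zero_ne_one this

theorem finite_neighbors (hP : P.coarse.LocallyFinite) (m : ℕ) (x : P.carrier) :
    {y | (y, x) ∈ S.ent m}.Finite :=
  hP _ ⟨_, S.controlled m, x, fun _ hy => ⟨x, rfl, hy⟩⟩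

theorem support_subset_neighbors {m : ℕ} {l : S.level m} {x : P.carrier}
    (hx : 0 < l.1.coords x) : ∀ y ∈ l.1.coords.support, y ∈ {y | (y, x) ∈ S.ent m} :=
  fun y hy => l.2 y hy x (Finsupp.mem_support_iff.2 hx.ne')

theorem isOpen_coord_pos (m : ℕ) (x : P.carrier) : IsOpen {l : S.level m | 0 < l.1.coords x} :=
  isOpen_lt continuous_const (continuous_coord S m x)

theorem locallyCompactSpace_level (hP : P.coarse.LocallyFinite) (m : ℕ) :
    LocallyCompactSpace (S.level m) := by
  have : WeaklyLocallyCompactSpace (S.level m) := ⟨fun l => by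
    obtain ⟨x, hx⟩ := exists_mem_support l.1
    refine ⟨_, isCompact_level_of_finite S m (finite_neighbors S hP m x), ?_⟩
    filter_upwards [(isOpen_coord_pos S m x).mem_nhds hx] with l' hl'
    exact support_subset_neighbors S hl'⟩
  infer_instance

theorem IsCompact.exists_finite_support (hP : P.coarse.LocallyFinite) {m : ℕ}
    {K : Set (S.level m)} (hK : IsCompact K) :
    ∃ V : Set P.carrier, V.Finite ∧ ∀ l ∈ K, ∀ x ∈ l.1.coords.support, x ∈ V := by
  refine hK.induction_on (p := fun K => ∃ V : Set P.carrier, V.Finite ∧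
    ∀ l ∈ K, ∀ x ∈ l.1.coords.support, x ∈ V) ?_ ?_ ?_ ?_
  · exact ⟨∅, Set.finite_empty, fun _ h => h.elim⟩
  · rintro s t hst ⟨V, hV, h⟩
    exact ⟨V, hV, fun l hl => h l (hst hl)⟩
  · rintro s t ⟨V, hV, h⟩ ⟨V', hV', h'⟩
    exact ⟨V ∪ V', hV.union hV', fun l hl x hx => hl.imp (fun hl => h l hl x hx)
      (fun hl => h' l hl x hx)⟩
  · intro l _
    obtain ⟨x, hx⟩ := exists_mem_support l.1
    exact ⟨_, mem_nhdsWithin_of_mem_nhds ((isOpen_coord_pos S m x).mem_nhds hx), _,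
      finite_neighbors S hP m x, fun l' hl' => support_subset_neighbors S hl'⟩

theorem continuous_mapDomain {f : P.carrier → Q.carrier} (hf : ∀ y, (f ⁻¹' {y}).Finite) {m : ℕ}
    (y : Q.carrier) : Continuous fun l : S.level m => Finsupp.mapDomain f l.1.coords y := by
  classical
  have : (fun l : S.level m => Finsupp.mapDomain f l.1.coords y) =
      fun l => ∑ x ∈ (hf y).toFinset, l.1.coords x := by
    ext l
    rw [mapDomain_apply_sum]
    refine Finset.sum_subset (fun x hx => ?_) (fun x hx hx' => ?_)
    · simpa using (Finset.mem_filter.1 hx).2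
    · by_contra h
      exact hx' (Finset.mem_filter.2 ⟨Finsupp.mem_support_iff.2 h, by simpa using hx⟩)
  rw [this]
  exact continuous_finsetSum _ fun x _ => continuous_coord S m x

theorem finite_preimage {f : P.carrier → Q.carrier} (hP : P.coarse.LocallyFinite)
    (hf : IsCoarselyProper P.coarse Q.coarse f) {V : Set Q.carrier} (hV : V.Finite) :
    (f ⁻¹' V).Finite := by
  have : f ⁻¹' V = ⋃ y ∈ V, f ⁻¹' {y} := by ext; simp
  rw [this]
  refine hV.biUnion fun y _ => hP.finite_of_precompact (hf _ ?_)
  exact ⟨_, Q.coarse.diag, y, fun z hz => ⟨y, rfl, hz⟩⟩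

theorem level_mono : Monotone S.level := fun _ _ h _ hl x hx y hy => S.mono h (hl x hx y hy)

theorem isClosedEmbedding_level {m n : ℕ} (h : m ≤ n) :
    IsClosedEmbedding (Set.inclusion (level_mono S h)) := by
  refine ⟨⟨⟨?_⟩, Set.inclusion_injective _⟩, ?_⟩
  · exact (induced_compose (f := Set.inclusion _)
      (g := fun (l : S.level n) x => l.1.coords x)).symm
  · have : Set.range (Set.inclusion (level_mono S h)) =
        ⋂ x, ⋂ y, ⋂ (_ : (x, y) ∉ S.ent m), {l | l.1.coords x * l.1.coords y = 0} := by
      rw [Set.range_inclusion]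
      ext l
      simp only [Set.mem_iInter]
      constructor
      · intro hl x y hxy
        by_contra h
        have h' := mul_ne_zero_iff.1 h
        exact hxy (hl x (Finsupp.mem_support_iff.2 h'.1) y (Finsupp.mem_support_iff.2 h'.2))
      · intro hl x hx y hy
        by_contra h
        exact mul_ne_zero (Finsupp.mem_support_iff.1 hx) (Finsupp.mem_support_iff.1 hy)
          (hl x y h)
    rw [this]
    exact isClosed_iInter fun x => isClosed_iInter fun y => isClosed_iInter fun _ =>
      isClosed_eq ((continuous_coord S n x).mul (continuous_coord S n y)) continuous_const

/-- The Rips complex `(𝒫(X), 𝒫(A))` of a pair `(X, A)` with `X` locally finite, with respect to a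
generating sequence. -/
noncomputable def rips (hP : P.coarse.LocallyFinite) : SigmaPair.{u} Γ where
  carrier := P.RipsPoint
  filt := S.level
  filt_mono := level_mono S
  exists_mem_filt l := by
    obtain ⟨n, hn⟩ := S.cofinal _ l.controlled
    exact ⟨n, fun x hx y hy => hn ⟨hx, hy⟩⟩
  locallyCompact := locallyCompactSpace_level S hP
  isClosedEmbedding h := isClosedEmbedding_level S h
  smul_mem_filt γ n l hl x hx y hy := by
    obtain ⟨x, hx', rfl⟩ := exists_of_mem_support_mapDomain _ _ hx
    obtain ⟨y, hy', rfl⟩ := exists_of_mem_support_mapDomain _ _ hy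
    exact S.invariant n γ x y (hl x hx' y hy')
  continuous_smul γ n := continuous_to_level S fun x =>
    continuous_mapDomain S (fun y => finite_preimage hP
      (P.smul_isCoarseEquivalence γ).1.proper (Set.finite_singleton y)) x
  sub := {l | ∀ x ∈ l.coords.support, x ∈ P.sub}
  isClosed_sub n := by
    have : {l : S.level n | l.1 ∈ {l : P.RipsPoint | ∀ x ∈ l.coords.support, x ∈ P.sub}} =
        ⋂ x ∈ P.subᶜ, {l | l.1.coords x = 0} := by
      ext l
      simp only [Set.mem_iInter]
      constructor
      · intro hl x hx
        by_contra h
        exact hx (hl x (Finsupp.mem_support_iff.2 h))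
      · intro hl x hx
        by_contra h
        exact Finsupp.mem_support_iff.1 hx (hl x h)
    rw [this]
    exact isClosed_biInter fun x _ => isClosed_eq (continuous_coord S n x) continuous_const
  smul_mem_sub γ l hl x hx := by
    obtain ⟨x, hx', rfl⟩ := exists_of_mem_support_mapDomain _ _ hx
    exact P.smul_mem_sub γ x (hl x hx')

/-- The morphism `𝒫(f) : (𝒫(X), 𝒫(A)) → (𝒫(Y), 𝒫(B))` given by affine linear extension of `f`. -/
noncomputable def ripsMap (hP : P.coarse.LocallyFinite) (hQ : Q.coarse.LocallyFinite) (f : P ⟶ Q) :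
    rips S hP ⟶ rips T hQ where
  toFun := RipsPoint.map f.toFun f.isCoarseMap.controlled
  isProper m := by
    obtain ⟨n, hn⟩ := T.cofinal _ (f.isCoarseMap.controlled _ (S.controlled m))
    have hmaps : Set.MapsTo (RipsPoint.map f.toFun f.isCoarseMap.controlled) (S.level m)
        (T.level n) := by
      intro l hl x hx y hy
      obtain ⟨x, hx', rfl⟩ := exists_of_mem_support_mapDomain _ _ hx
      obtain ⟨y, hy', rfl⟩ := exists_of_mem_support_mapDomain _ _ hy
      exact hn ⟨(x, y), hl x hx' y hy', rfl⟩
    refine ⟨n, hmaps, ?_⟩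
    have hcont : Continuous (hmaps.restrict : S.level m → T.level n) :=
      continuous_to_level T fun x => continuous_mapDomain S (fun y => finite_preimage hP
        f.isCoarseMap.proper (Set.finite_singleton y)) x
    have := locallyCompactSpace_level T hQ n
    refine (isProperMap_iff_isCompact_preimage (X := S.level m) (Y := T.level n)).2
      ⟨hcont, fun K hK => ?_⟩
    obtain ⟨V, hV, hKV⟩ := IsCompact.exists_finite_support T hQ hK
    refine (isCompact_level_of_finite S m
      (finite_preimage hP f.isCoarseMap.proper hV)).of_isClosed_subset
      (hK.isClosed.preimage hcont) ?_
    intro l hl x hx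
    exact hKV _ hl _ (mem_support_mapDomain f.toFun l.1.coords l.1.nonneg hx)
  map_smul γ l := by
    apply RipsPoint.ext
    change Finsupp.mapDomain f.toFun (Finsupp.mapDomain (fun x => γ • x) l.coords) =
      Finsupp.mapDomain (fun x => γ • x) (Finsupp.mapDomain f.toFun l.coords)
    rw [← Finsupp.mapDomain_comp, ← Finsupp.mapDomain_comp]
    congr 1
    ext x
    exact f.map_smul γ x
  mapsTo := by
    intro l hl y hy
    obtain ⟨x, hx', rfl⟩ := exists_of_mem_support_mapDomain _ _ hy
    exact f.mapsTo (hl x hx')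

/-- The restricted generating sequence `Eₙ ∩ (A × A)`. -/
def GeneratingSequence.restrict (S : P.GeneratingSequence) : P.subspace.GeneratingSequence where
  ent n := Prod.map Subtype.val Subtype.val ⁻¹' S.ent n
  ent_zero := by
    rw [S.ent_zero]
    ext ⟨x, y⟩
    exact Subtype.ext_iff.symm
  mono _ _ h := Set.preimage_mono (S.mono h)
  controlled n := ⟨_, S.controlled n, rfl⟩
  cofinal := by
    rintro _ ⟨E, hE, rfl⟩
    obtain ⟨n, hn⟩ := S.cofinal E hE
    exact ⟨n, Set.preimage_mono hn⟩
  invariant n γ x y h := S.invariant n γ x.1 y.1 h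

theorem mem_support_subtypeDomain {l : P.RipsPoint} {x : P.sub} :
    x ∈ (l.coords.subtypeDomain (· ∈ P.sub)).support ↔ x.1 ∈ l.coords.support := by
  rw [Finsupp.mem_support_iff, Finsupp.mem_support_iff, Finsupp.subtypeDomain_apply]

/-- A point of `𝒫(X)` with support in `A`, viewed as a point of the Rips complex of `A`. -/
noncomputable def RipsPoint.toSubspace (l : P.RipsPoint) (hl : ∀ x ∈ l.coords.support, x ∈ P.sub) :
    P.subspace.RipsPoint where
  coords := l.coords.subtypeDomain (· ∈ P.sub)
  nonneg x := l.nonneg x.1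
  sum_eq_one := by
    rw [← l.sum_eq_one]
    exact Finsupp.sum_subtypeDomain_index (h := fun _ r => r) hl
  controlled := by
    refine ⟨_, l.controlled, ?_⟩
    ext ⟨x, y⟩
    exact and_congr mem_support_subtypeDomain mem_support_subtypeDomain

/-- The homeomorphism between `𝒫(A) ∩ P_m(X)` and `P_m(A)`. -/
noncomputable def ripsSubspaceHomeo (hP : P.coarse.LocallyFinite) (m : ℕ) :
    (rips S hP).subspace.filt m ≃ₜ S.restrict.level m where
  toFun l := ⟨l.1.1.toSubspace l.1.2, fun x hx y hy =>
    l.2 x.1 (mem_support_subtypeDomain.1 hx) y.1 (mem_support_subtypeDomain.1 hy)⟩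
  invFun l := ⟨⟨l.1.map (P := P.subspace) (Q := P) Subtype.val
      (CoarseStructure.isCoarseMap_val P.coarse P.sub).controlled, fun x hx => by
        obtain ⟨x, -, rfl⟩ := exists_of_mem_support_mapDomain _ _ hx
        exact x.2⟩, fun x hx y hy => by
      obtain ⟨x, hx', rfl⟩ := exists_of_mem_support_mapDomain _ _ hx
      obtain ⟨y, hy', rfl⟩ := exists_of_mem_support_mapDomain _ _ hy
      exact l.2 x hx' y hy'⟩
  left_inv l := by
    refine Subtype.ext (Subtype.ext (RipsPoint.ext (Finsupp.ext fun x => ?_)))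
    change Finsupp.mapDomain Subtype.val (l.1.1.coords.subtypeDomain (· ∈ P.sub)) x =
      l.1.1.coords x
    by_cases hx : x ∈ P.sub
    · exact Finsupp.mapDomain_apply Subtype.val_injective _ (⟨x, hx⟩ : P.sub)
    · rw [Finsupp.mapDomain_of_notMem_range _ _ (by simpa using hx)]
      by_contra h
      exact hx (l.1.2 x (Finsupp.mem_support_iff.2 (Ne.symm h)))
  right_inv l := by
    refine Subtype.ext (RipsPoint.ext (Finsupp.ext fun x => ?_))
    exact Finsupp.mapDomain_apply Subtype.val_injective _ x
  continuous_toFun := continuous_to_level _ fun x =>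
    (continuous_coord S m x.1).comp ((rips S hP).isClosedEmbedding_subToFilt m).continuous
  continuous_invFun := by
    refine ((rips S hP).isClosedEmbedding_subToFilt m).isEmbedding.isInducing.continuous_iff.2 ?_
    refine continuous_to_level S fun x => ?_
    by_cases hx : x ∈ P.sub
    · refine (continuous_coord S.restrict m ⟨x, hx⟩).congr fun l => ?_
      exact (Finsupp.mapDomain_apply Subtype.val_injective _ (⟨x, hx⟩ : P.sub)).symm
    · refine (continuous_const (y := (0 : ℝ))).congr fun l => ?_
      exact (Finsupp.mapDomain_of_notMem_range _ _ (fun ⟨z, hz⟩ => hx (hz ▸ z.2))).symm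

/-- The identification of the subspace `𝒫(A)` of `𝒫(X)` with the Rips complex of `A`. -/
noncomputable def ripsSubspace (hP : P.coarse.LocallyFinite) :
    (rips S hP).subspace ⟶ rips S.restrict (hP.restrict P.sub) where
  toFun l := l.1.toSubspace l.2
  isProper m := ⟨m, fun l hl => (ripsSubspaceHomeo S hP m ⟨l, hl⟩).2,
    (ripsSubspaceHomeo S hP m).isClosedEmbedding.isProperMap⟩
  map_smul γ l := by
    refine RipsPoint.ext (Finsupp.ext fun x => ?_)
    have h1 := Finsupp.mapDomain_apply (MulAction.injective γ) l.1.coords (γ⁻¹ • x.1)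
    rw [smul_inv_smul] at h1
    let d : P.subspace.carrier →₀ ℝ := l.1.coords.subtypeDomain (· ∈ P.sub)
    have h2 : Finsupp.mapDomain (fun x : P.subspace.carrier => γ • x) d (γ • γ⁻¹ • x) =
        d (γ⁻¹ • x) := Finsupp.mapDomain_apply (MulAction.injective γ) d (γ⁻¹ • x)
    rw [smul_inv_smul] at h2
    exact h1.trans h2.symm
  mapsTo := fun _ h => h.elim

end Rips

end CoarsePair

/-! ## (Co-)homology theories -/

/-- The structure on a category of pairs needed to state the Eilenberg–Steenrod axioms:
the operations `(X, A) ↦ (X, ∅)` and `(X, A) ↦ (A, ∅)`, the inclusions between these, a notion of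
homotopy and a notion of excision. -/
class PairCategory (C : Type u) extends Category.{v} C where
  absolute : C → C
  subspace : C → C
  subspaceMap : ∀ {P Q : C}, (P ⟶ Q) → (subspace P ⟶ subspace Q)
  incl : ∀ P : C, subspace P ⟶ absolute P
  toPair : ∀ P : C, absolute P ⟶ P
  Homotopic : ∀ {P Q : C}, (P ⟶ Q) → (P ⟶ Q) → Prop
  IsExcision : ∀ {P Q : C}, (P ⟶ Q) → Prop

instance {Γ : Type v} [Group Γ] : PairCategory (CoarsePair.{u} Γ) where
  absolute := CoarsePair.absolute
  subspace := CoarsePair.subspace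
  subspaceMap := CoarsePair.subspaceMap
  incl := CoarsePair.incl
  toPair := CoarsePair.toPair
  Homotopic := CoarsePair.CoarselyHomotopic
  IsExcision := CoarsePair.IsExcision

instance {Γ : Type v} [Group Γ] : PairCategory (SigmaPair.{u} Γ) where
  absolute := SigmaPair.absolute
  subspace := SigmaPair.subspace
  subspaceMap := SigmaPair.subspaceMap
  incl := SigmaPair.incl
  toPair := SigmaPair.toPair
  Homotopic := SigmaPair.Homotopic
  IsExcision := SigmaPair.IsExcision

open PairCategory

/-- Abelian groups `E_p(X, A)`, induced maps and connecting homomorphisms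
`∂_{p+1} : E_{p+1}(X, A) → E_p(A)`, without any axioms. -/
structure HomologyData (C : Type u) [PairCategory.{u, v} C] where
  obj : ℤ → C → AddCommGrpCat.{w}
  map : ∀ (p : ℤ) {P Q : C}, (P ⟶ Q) → (obj p P ⟶ obj p Q)
  bdry : ∀ (p : ℤ) (P : C), obj (p + 1) P ⟶ obj p (subspace P)

/-- The axioms of a homology theory: functoriality, naturality of the connecting homomorphisms,
homotopy, exactness, excision. -/
structure IsHomologyTheory {C : Type u} [PairCategory.{u, v} C] (E : HomologyData.{w} C) : Prop where
  map_id : ∀ p (P : C), E.map p (𝟙 P) = 𝟙 _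
  map_comp : ∀ p {P Q R : C} (f : P ⟶ Q) (g : Q ⟶ R), E.map p (f ≫ g) = E.map p f ≫ E.map p g
  bdry_natural : ∀ p {P Q : C} (f : P ⟶ Q),
    E.map (p + 1) f ≫ E.bdry p Q = E.bdry p P ≫ E.map p (subspaceMap f)
  homotopy : ∀ p {P Q : C} (f g : P ⟶ Q), Homotopic f g → E.map p f = E.map p g
  exact_absolute : ∀ p (P : C), Function.Exact (E.map p (incl P)) (E.map p (toPair P))
  exact_pair : ∀ p (P : C), Function.Exact (E.map (p + 1) (toPair P)) (E.bdry p P)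
  exact_subspace : ∀ p (P : C), Function.Exact (E.bdry p P) (E.map p (incl P))
  excision : ∀ p {P Q : C} (f : P ⟶ Q), IsExcision f → IsIso (E.map p f)

/-- Abelian groups `E^p(X, A)`, induced maps and connecting homomorphisms
`δ^p : E^p(A) → E^{p+1}(X, A)`, without any axioms. -/
structure CohomologyData (C : Type u) [PairCategory.{u, v} C] where
  obj : ℤ → C → AddCommGrpCat.{w}
  map : ∀ (p : ℤ) {P Q : C}, (P ⟶ Q) → (obj p Q ⟶ obj p P)
  cobdry : ∀ (p : ℤ) (P : C), obj p (subspace P) ⟶ obj (p + 1) P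

/-- The axioms of a cohomology theory. -/
structure IsCohomologyTheory {C : Type u} [PairCategory.{u, v} C] (E : CohomologyData.{w} C) :
    Prop where
  map_id : ∀ p (P : C), E.map p (𝟙 P) = 𝟙 _
  map_comp : ∀ p {P Q R : C} (f : P ⟶ Q) (g : Q ⟶ R), E.map p (f ≫ g) = E.map p g ≫ E.map p f
  cobdry_natural : ∀ p {P Q : C} (f : P ⟶ Q),
    E.cobdry p Q ≫ E.map (p + 1) f = E.map p (subspaceMap f) ≫ E.cobdry p P
  homotopy : ∀ p {P Q : C} (f g : P ⟶ Q), Homotopic f g → E.map p f = E.map p g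
  exact_absolute : ∀ p (P : C), Function.Exact (E.map p (toPair P)) (E.map p (incl P))
  exact_subspace : ∀ p (P : C), Function.Exact (E.map p (incl P)) (E.cobdry p P)
  exact_pair : ∀ p (P : C), Function.Exact (E.cobdry p P) (E.map (p + 1) (toPair P))
  excision : ∀ p {P Q : C} (f : P ⟶ Q), IsExcision f → IsIso (E.map p f)

/-- `φ` is an isomorphism of homology theories: it consists of isomorphisms and is compatible with
induced maps and connecting homomorphisms. -/
structure IsHomologyIso {C : Type u} [PairCategory.{u, v} C] (E F : HomologyData.{w} C)
    (φ : ∀ p P, E.obj p P ⟶ F.obj p P) : Prop where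
  isIso : ∀ p P, IsIso (φ p P)
  natural : ∀ p {P Q : C} (f : P ⟶ Q), E.map p f ≫ φ p Q = φ p P ≫ F.map p f
  bdry : ∀ p P, E.bdry p P ≫ φ p (subspace P) = φ (p + 1) P ≫ F.bdry p P

/-- `φ` is an isomorphism of cohomology theories. -/
structure IsCohomologyIso {C : Type u} [PairCategory.{u, v} C] (E F : CohomologyData.{w} C)
    (φ : ∀ p P, E.obj p P ⟶ F.obj p P) : Prop where
  isIso : ∀ p P, IsIso (φ p P)
  natural : ∀ p {P Q : C} (f : P ⟶ Q), E.map p f ≫ φ p P = φ p Q ≫ F.map p f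
  cobdry : ∀ p P, E.cobdry p P ≫ φ (p + 1) P = φ p (subspace P) ≫ F.cobdry p P

/-- The strong homotopy axiom for homology. -/
def HomologyData.StrongHomotopy {Γ : Type v} [Group Γ]
    (E : HomologyData.{w} (CoarsePair.{u} Γ)) : Prop :=
  ∀ p {P Q : CoarsePair.{u} Γ} (f g : P ⟶ Q),
    CoarsePair.GeneralizedCoarselyHomotopic f g → E.map p f = E.map p g

/-- The strong homotopy axiom for cohomology. -/
def CohomologyData.StrongHomotopy {Γ : Type v} [Group Γ]
    (E : CohomologyData.{w} (CoarsePair.{u} Γ)) : Prop :=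
  ∀ p {P Q : CoarsePair.{u} Γ} (f g : P ⟶ Q),
    CoarsePair.GeneralizedCoarselyHomotopic f g → E.map p f = E.map p g

/-! ## Discretizations and coarsification -/

/-- A `Γ`-invariant discretization `(X', A')` of `(X, A)`, with a generating sequence of the coarse
structure of `X'`. We take `A' = X' ∩ A`: this is forced by `A' ⊆ X' ∩ A` and the existence of a
retraction `X → X'` which is the identity on `X'` and maps `A` into `A'`. -/
structure Discretization {Γ : Type v} [Group Γ] (P : CoarsePair.{u} Γ) where
  /-- The subset `X'`. -/
  pts : Set P.carrier
  smul_mem : ∀ (γ : Γ), ∀ x ∈ pts, γ • x ∈ pts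
  dense : P.coarse.CoarselyDense pts
  dense_sub : (P.coarse.restrict P.sub).CoarselyDense (Subtype.val ⁻¹' pts)
  locallyFinite : (P.coarse.restrict pts).LocallyFinite
  /-- The generating sequence of `X'`. -/
  gen : (P.restrict pts smul_mem (Subtype.val ⁻¹' P.sub)
    fun γ x h => P.smul_mem_sub γ x.1 h).GeneratingSequence

namespace Discretization

variable {Γ : Type v} [Group Γ] {P Q R : CoarsePair.{u} Γ}

/-- The pair `(X', A')`. -/
def pair (D : Discretization P) : CoarsePair.{u} Γ :=
  P.restrict D.pts D.smul_mem (Subtype.val ⁻¹' P.sub) fun γ x h => P.smul_mem_sub γ x.1 h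

/-- The inclusion `ι : (X', A') → (X, A)`. -/
def ι (D : Discretization P) : D.pair ⟶ P where
  toFun := Subtype.val
  isCoarseMap := CoarseStructure.isCoarseMap_val _ _
  map_smul _ _ := rfl
  mapsTo := fun _ h => h

/-- The Rips complex `(𝒫(X'), 𝒫(A'))`. -/
noncomputable def rips (D : Discretization P) : SigmaPair.{u} Γ :=
  CoarsePair.rips (P := D.pair) D.gen D.locallyFinite

/-- A `Γ`-equivariant coarse equivalence `π : X → X'` which is the identity on `X'` and which
restricts to a coarse equivalence `A → A'`. -/
structure Retraction (D : Discretization P) where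
  π : P ⟶ D.pair
  π_ι : D.ι ≫ π = 𝟙 _
  isCoarseEquivalence : IsCoarseEquivalence P.coarse D.pair.coarse π.toFun
  isCoarseEquivalence_sub : IsCoarseEquivalence P.subspace.coarse D.pair.subspace.coarse
    (CoarsePair.subspaceMap π).toFun

/-- For `f : (X, A) → (Y, B)`, the morphism
`𝒫(π_Y ∘ f ∘ ι_X) : (𝒫(X'), 𝒫(A')) → (𝒫(Y'), 𝒫(B'))`. -/
noncomputable def ripsInduced (D : Discretization P) (D' : Discretization Q) (r : D'.Retraction)
    (f : P ⟶ Q) : D.rips ⟶ D'.rips :=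
  CoarsePair.ripsMap (P := D.pair) (Q := D'.pair) D.gen D'.gen D.locallyFinite D'.locallyFinite
    (D.ι ≫ f ≫ r.π)

/-- For discretizations `(X', A')` of `(X, A)` and `A''` of `A`, the morphism
`𝒫(A') → 𝒫(A'')` induced by a retraction `A → A''`, where `𝒫(A')` is the subspace of `𝒫(X')`. -/
noncomputable def ripsSubspace (D : Discretization P) (D' : Discretization P.subspace)
    (r : D'.Retraction) : D.rips.subspace ⟶ D'.rips :=
  CoarsePair.ripsSubspace (P := D.pair) D.gen D.locallyFinite ≫
    CoarsePair.ripsMap (P := D.pair.subspace) (Q := D'.pair) (CoarsePair.GeneratingSequence.restrict D.gen)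
      D'.gen _ D'.locallyFinite (CoarsePair.subspaceMap D.ι ≫ r.π)

end Discretization

/-- A discretization together with a retraction. -/
structure RetractedDiscretization {Γ : Type v} [Group Γ] (P : CoarsePair.{u} Γ) extends
    Discretization P where
  retraction : toDiscretization.Retraction

namespace RetractedDiscretization

variable {Γ : Type v} [Group Γ] {P Q : CoarsePair.{u} Γ}

/-- The morphism `𝒫(π_Y ∘ f ∘ ι_X)`. -/
noncomputable def induced (D : RetractedDiscretization P) (D' : RetractedDiscretization Q)
    (f : P ⟶ Q) : D.rips ⟶ D'.rips :=
  D.toDiscretization.ripsInduced D'.toDiscretization D'.retraction f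

/-- The comparison morphism between the Rips complexes of two discretizations of `(X, A)`. -/
noncomputable def comparison (D D' : RetractedDiscretization P) : D.rips ⟶ D'.rips :=
  D.induced D' (𝟙 P)

end RetractedDiscretization

section Coarsification

variable {Γ : Type v} [Group Γ]

/-- The coarsification `EX_*(X, A) = E_*(𝒫(X'), 𝒫(A'))` of a homology theory `E`, where `(X', A')`
is the discretization of `(X, A)` provided by `c`. The connecting homomorphism is
`E_{p+1}(𝒫(X'), 𝒫(A')) → E_p(𝒫(A')) → E_p(𝒫(A''))`, where `A''` is the discretization of `A`
provided by `c`. -/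
noncomputable def HomologyData.coarsification (E : HomologyData.{w} (SigmaPair.{u} Γ))
    (c : ∀ P : CoarsePair.{u} Γ, RetractedDiscretization P) :
    HomologyData.{w} (CoarsePair.{u} Γ) where
  obj p P := E.obj p (c P).rips
  map p {P Q} f := E.map p ((c P).induced (c Q) f)
  bdry p P := E.bdry p (c P).rips ≫
    E.map p ((c P).ripsSubspace (c (subspace P)).toDiscretization (c (subspace P)).retraction)

/-- The coarsification `EX^*(X, A) = E^*(𝒫(X'), 𝒫(A'))` of a cohomology theory `E`. -/
noncomputable def CohomologyData.coarsification (E : CohomologyData.{w} (SigmaPair.{u} Γ))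
    (c : ∀ P : CoarsePair.{u} Γ, RetractedDiscretization P) :
    CohomologyData.{w} (CoarsePair.{u} Γ) where
  obj p P := E.obj p (c P).rips
  map p {P Q} f := E.map p ((c P).induced (c Q) f)
  cobdry p P :=
    E.map p ((c P).ripsSubspace (c (subspace P)).toDiscretization (c (subspace P)).retraction) ≫
      E.cobdry p (c P).rips

/-- The groups `E_*(𝒫(X'), 𝒫(A'))` are independent of the discretization up to canonical
isomorphism: the induced maps, in particular the comparison maps, do not depend on the retraction
used to define them, and the comparison maps are isomorphisms which are compatible with each
other. -/
structure HomologyData.IndependentOfDiscretization (E : HomologyData.{w} (SigmaPair.{u} Γ)) :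
    Prop where
  retraction : ∀ p {P Q : CoarsePair.{u} Γ} (D : Discretization P) (D' : Discretization Q)
    (r r' : D'.Retraction) (f : P ⟶ Q),
    E.map p (D.ripsInduced D' r f) = E.map p (D.ripsInduced D' r' f)
  isIso : ∀ p {P : CoarsePair.{u} Γ} (D D' : RetractedDiscretization P),
    IsIso (E.map p (D.comparison D'))
  refl : ∀ p {P : CoarsePair.{u} Γ} (D : RetractedDiscretization P),
    E.map p (D.comparison D) = 𝟙 _
  trans : ∀ p {P : CoarsePair.{u} Γ} (D D' D'' : RetractedDiscretization P),
    E.map p (D.comparison D') ≫ E.map p (D'.comparison D'') = E.map p (D.comparison D'')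

/-- The same for cohomology. -/
structure CohomologyData.IndependentOfDiscretization (E : CohomologyData.{w} (SigmaPair.{u} Γ)) :
    Prop where
  retraction : ∀ p {P Q : CoarsePair.{u} Γ} (D : Discretization P) (D' : Discretization Q)
    (r r' : D'.Retraction) (f : P ⟶ Q),
    E.map p (D.ripsInduced D' r f) = E.map p (D.ripsInduced D' r' f)
  isIso : ∀ p {P : CoarsePair.{u} Γ} (D D' : RetractedDiscretization P),
    IsIso (E.map p (D.comparison D'))
  refl : ∀ p {P : CoarsePair.{u} Γ} (D : RetractedDiscretization P),
    E.map p (D.comparison D) = 𝟙 _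
  trans : ∀ p {P : CoarsePair.{u} Γ} (D D' D'' : RetractedDiscretization P),
    E.map p (D'.comparison D'') ≫ E.map p (D.comparison D') = E.map p (D.comparison D'')

end Coarsification

/-! A point of a Rips complex is a formal convex combination of points with controlled support. An
equivariant assignment of convex combinations to vertices therefore extends linearly, and maps whose
supports stay uniformly close can be joined by straight segments. Everything reduces to homotopies
written in barycentric coordinates, whose properness follows from local finiteness
(`IsProperFamily.exists_isProperMap`).

The main tool is `homotopic_ripsMap`. It starts from an equivariant family of paths in `Y`, one for
each vertex of `X`, which need not be continuous. Each path is subdivided finely enough, with a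
number of pieces depending on the vertex, replaced by a piecewise affine path in the Rips complex,
and extended linearly. Close maps, generalized coarse homotopies and coarse homotopies (after
compactifying `ℤ` to an interval) all give such families. Since close maps become homotopic, the
construction is functorial up to homotopy and independent of retractions and discretizations. The
long exact sequences are carried over along ladders of isomorphisms.

Discretizations come from an equivariant idempotent (`exists_equivariant_idempotent`). A projection
onto a separated set of points could fail to be equivariant because of stabilizers. Instead orbits
are classified by a nearby point, by the stabilizer and by membership in `A`, and each orbit moves
to the representative of its class. Properness of the action leaves only finitely many classes near
a bounded set.

Excision is the delicate axiom: a simplex may have vertices both in `C` and outside `A`, so `𝒫(X ∖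
C) → 𝒫(X)` is not a topological excision. First `𝒫(A)` is replaced by the homotopy equivalent closed
set of points with weight at least `1/4` on `A`. Then the open set of points with weight above `1/2`
on `C` is excised. What remains deforms to `𝒫(X ∖ C)` by dropping the vertices in `C`,
renormalizing, and shifting mass to nearest points of `A ∖ C`. The coarse excision condition is
exactly what makes this shift controlled (`exists_controlled_shrinkCoords`). -/

/-! ## Convex combinations -/

/-- Formal convex combinations. -/
structure IsConvexCombination {X : Type*} (l : X →₀ ℝ) : Prop where
  nonneg : ∀ x, 0 ≤ l x
  total : Finsupp.linearCombination ℝ (fun _ => (1 : ℝ)) l = 1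

section LinearCombination

variable {X Y M : Type*}

theorem linearCombination_coord (κ : X → Y →₀ ℝ) (l : X →₀ ℝ) (y : Y) :
    Finsupp.linearCombination ℝ κ l y = Finsupp.linearCombination ℝ (fun x => κ x y) l :=
  Finsupp.apply_linearCombination ℝ (Finsupp.lapply y) κ l

theorem linearCombination_linearCombination (w : Y → ℝ) (κ : X → Y →₀ ℝ) (l : X →₀ ℝ) :
    Finsupp.linearCombination ℝ w (Finsupp.linearCombination ℝ κ l) =
      Finsupp.linearCombination ℝ (fun x => Finsupp.linearCombination ℝ w (κ x)) l :=
  Finsupp.apply_linearCombination ℝ (Finsupp.linearCombination ℝ w) κ l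

theorem mapDomain_eq_linearCombination (f : X → Y) (l : X →₀ ℝ) :
    Finsupp.mapDomain f l = Finsupp.linearCombination ℝ (fun x => Finsupp.single (f x) (1 : ℝ)) l := by
  simp [Finsupp.mapDomain, Finsupp.linearCombination_apply]

theorem linearCombination_congr [AddCommGroup M] [Module ℝ M] {v w : X → M} {l : X →₀ ℝ}
    (h : ∀ x ∈ l.support, v x = w x) :
    Finsupp.linearCombination ℝ v l = Finsupp.linearCombination ℝ w l := by
  simp only [Finsupp.linearCombination_apply]
  exact Finsupp.sum_congr fun x hx => by rw [h x hx]

theorem linearCombination_nonneg {w : X → ℝ} {l : X →₀ ℝ} (hl : ∀ x, 0 ≤ l x)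
    (hw : ∀ x ∈ l.support, 0 ≤ w x) : 0 ≤ Finsupp.linearCombination ℝ w l := by
  rw [Finsupp.linearCombination_apply]
  exact Finset.sum_nonneg fun x hx => mul_nonneg (hl x) (hw x hx)

theorem linearCombination_mono {v w : X → ℝ} {l : X →₀ ℝ} (hl : ∀ x, 0 ≤ l x)
    (h : ∀ x ∈ l.support, v x ≤ w x) :
    Finsupp.linearCombination ℝ v l ≤ Finsupp.linearCombination ℝ w l := by
  simp only [Finsupp.linearCombination_apply]
  exact Finset.sum_le_sum fun x hx => mul_le_mul_of_nonneg_left (h x hx) (hl x)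

theorem exists_of_linearCombination_ne_zero [AddCommGroup M] [Module ℝ M] {w : X → M} {l : X →₀ ℝ}
    (h : Finsupp.linearCombination ℝ w l ≠ 0) : ∃ x ∈ l.support, w x ≠ 0 := by
  rw [Finsupp.linearCombination_apply] at h
  obtain ⟨x, hx, h⟩ := Finset.exists_ne_zero_of_sum_ne_zero h
  exact ⟨x, hx, fun h' => h (by simp only [h', smul_zero])⟩

theorem exists_of_mem_support_linearCombination {κ : X → Y →₀ ℝ} {l : X →₀ ℝ} {y : Y}
    (h : y ∈ (Finsupp.linearCombination ℝ κ l).support) :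
    ∃ x ∈ l.support, y ∈ (κ x).support := by
  rw [Finsupp.mem_support_iff, linearCombination_coord] at h
  obtain ⟨x, hx, h⟩ := exists_of_linearCombination_ne_zero h
  exact ⟨x, hx, Finsupp.mem_support_iff.2 h⟩

/-- With `f` and `g` translations by a group element, this reduces equivariance of a linear
extension to vertices. Two kernels are allowed because some kernels below have coefficients
depending on the point `l` itself. -/
theorem mapDomain_linearCombination {Z W : Type*} (g : Y → Z) (f : X → W) {κ : X → Y →₀ ℝ}
    {κ' : W → Z →₀ ℝ} (h : ∀ x, Finsupp.mapDomain g (κ x) = κ' (f x)) (l : X →₀ ℝ) :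
    Finsupp.mapDomain g (Finsupp.linearCombination ℝ κ l) =
      Finsupp.linearCombination ℝ κ' (Finsupp.mapDomain f l) := by
  rw [Finsupp.linearCombination_mapDomain]
  refine (Finsupp.apply_linearCombination ℝ (Finsupp.lmapDomain ℝ ℝ g) κ l).trans ?_
  exact congrArg (fun v => Finsupp.linearCombination ℝ v l) (funext h)

/-- The nonvanishing of the coefficient is recorded because a cutoff reaching `0` or `1` removes one
of the two summands, and the excision argument relies on that. -/
theorem mem_support_of_mem_support_add_smul {a b : X →₀ ℝ} {s t : ℝ} {x : X}
    (h : x ∈ (s • a + t • b).support) : s ≠ 0 ∧ x ∈ a.support ∨ t ≠ 0 ∧ x ∈ b.support := by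
  simp only [Finsupp.mem_support_iff, Finsupp.add_apply, Finsupp.smul_apply, smul_eq_mul] at h ⊢
  by_contra! h'
  apply h
  rcases eq_or_ne s 0 with hs | hs
  · rcases eq_or_ne t 0 with ht | ht
    · simp [hs, ht]
    · simp [hs, h'.2 ht]
  · rcases eq_or_ne t 0 with ht | ht
    · simp [ht, h'.1 hs]
    · simp [h'.1 hs, h'.2 ht]

end LinearCombination

namespace IsConvexCombination

variable {X Y : Type*}

theorem single (x : X) : IsConvexCombination (Finsupp.single x (1 : ℝ)) where
  nonneg y := by
    classical
    rw [Finsupp.single_apply]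
    split_ifs <;> norm_num
  total := by simp

theorem exists_mem_support {l : X →₀ ℝ} (hl : IsConvexCombination l) : ∃ x, x ∈ l.support := by
  obtain ⟨x, hx, -⟩ := exists_of_linearCombination_ne_zero (hl.total.trans_ne one_ne_zero)
  exact ⟨x, hx⟩

theorem linearCombination_const {l : X →₀ ℝ} (hl : IsConvexCombination l) (r : ℝ) :
    Finsupp.linearCombination ℝ (fun _ => r) l = r := by
  have h := hl.total
  rw [Finsupp.linearCombination_apply] at h ⊢
  simp only [smul_eq_mul, mul_one, Finsupp.sum] at h ⊢
  rw [← Finset.sum_mul, h, one_mul]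

theorem linearCombination {l : X →₀ ℝ} (hl : IsConvexCombination l) {κ : X → Y →₀ ℝ}
    (hκ : ∀ x ∈ l.support, IsConvexCombination (κ x)) :
    IsConvexCombination (Finsupp.linearCombination ℝ κ l) where
  nonneg y := by
    rw [linearCombination_coord]
    exact linearCombination_nonneg hl.nonneg fun x hx => (hκ x hx).nonneg y
  total := by
    rw [linearCombination_linearCombination]
    refine Eq.trans ?_ hl.total
    exact linearCombination_congr fun x hx => (hκ x hx).total

theorem add_smul {a b : X →₀ ℝ} (ha : IsConvexCombination a) (hb : IsConvexCombination b)
    {s t : ℝ} (hs : 0 ≤ s) (ht : 0 ≤ t) (hst : s + t = 1) :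
    IsConvexCombination (s • a + t • b) where
  nonneg x := by
    rw [Finsupp.add_apply, Finsupp.smul_apply, Finsupp.smul_apply]
    exact add_nonneg (mul_nonneg hs (ha.nonneg x)) (mul_nonneg ht (hb.nonneg x))
  total := by
    rw [map_add, map_smul, map_smul, ha.total, hb.total, smul_eq_mul, smul_eq_mul, mul_one,
      mul_one, hst]

end IsConvexCombination

namespace CoarsePair

variable {Γ : Type v} [Group Γ] {P Q R : CoarsePair.{u} Γ}

theorem RipsPoint.isConvexCombination (l : P.RipsPoint) : IsConvexCombination l.coords where
  nonneg := l.nonneg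
  total := by
    rw [Finsupp.linearCombination_apply]
    simpa using l.sum_eq_one

/-- A formal convex combination with controlled support, as a point of the Rips complex. -/
def RipsPoint.ofConvex (d : P.carrier →₀ ℝ) (hd : IsConvexCombination d)
    (h : P.coarse.Controlled {p | p.1 ∈ d.support ∧ p.2 ∈ d.support}) : P.RipsPoint where
  coords := d
  nonneg := hd.nonneg
  sum_eq_one := by
    rw [← hd.total, Finsupp.linearCombination_apply]
    simp
  controlled := h

/-- On a locally finite complex, convex combinations of continuous functions with coefficients
given by the barycentric coordinates are continuous. -/
theorem continuous_linearCombination (hP : P.coarse.LocallyFinite) (S : P.GeneratingSequence)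
    {m : ℕ} {Z : Type*} [TopologicalSpace Z] {L : Z → S.level m} (hL : Continuous L)
    {w : P.carrier → Z → ℝ} (hw : ∀ x, Continuous (w x)) :
    Continuous fun z => Finsupp.linearCombination ℝ (fun x => w x z) (L z).1.coords := by
  rw [continuous_iff_continuousAt]
  intro z₀
  -- A vertex with positive coordinate at `z₀` keeps it nearby, so all supports near `z₀` lie among
  -- its finitely many neighbours and the function is locally one fixed finite sum.
  obtain ⟨x₀, hx₀⟩ := CoarsePair.exists_mem_support (L z₀).1
  have hfin := finite_neighbors S hP m x₀
  have hcont : Continuous fun z => ∑ x ∈ hfin.toFinset, (L z).1.coords x * w x z :=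
    continuous_finsetSum _ fun x _ => ((continuous_coord S m x).comp hL).mul (hw x)
  refine hcont.continuousAt.congr ?_
  filter_upwards [((isOpen_coord_pos S m x₀).preimage hL).mem_nhds hx₀] with z hz
  rw [Finsupp.linearCombination_apply]
  exact (Finsupp.sum_of_support_subset _
    (fun x hx => hfin.mem_toFinset.2 (support_subset_neighbors S hz x hx))
    (fun x a => a • w x z) (fun _ _ => zero_smul _ _)).symm

end CoarsePair

/-! ## Subspaces of Rips complexes -/

namespace SigmaPair

variable {Γ : Type v} [Group Γ]

/-- Replace the subspace of a pair by another closed invariant subspace. -/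
def withSub (P : SigmaPair.{u} Γ) (B : Set P.carrier)
    (hB : ∀ n, IsClosed {x : P.filt n | x.1 ∈ B}) (hΓ : ∀ (γ : Γ), ∀ x ∈ B, γ • x ∈ B) :
    SigmaPair.{u} Γ :=
  { P with
    sub := B
    isClosed_sub := hB
    smul_mem_sub := hΓ }

/-- A closed embedding of a `σ`-locally compact space into a Rips complex which is compatible with
the filtrations. -/
structure RipsEmbedding (W : SigmaPair.{u} Γ) {P : CoarsePair.{u} Γ} (S : P.GeneratingSequence) where
  toFun : W.carrier → P.RipsPoint
  mem_filt : ∀ m w, w ∈ W.filt m ↔ toFun w ∈ S.level m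
  isClosedEmbedding : ∀ m, IsClosedEmbedding
    fun w : W.filt m => (⟨toFun w.1, (mem_filt m w.1).1 w.2⟩ : S.level m)
  injective : Function.Injective toFun
  map_smul : ∀ (γ : Γ) w, toFun (γ • w) = γ • toFun w

namespace RipsEmbedding

variable {P Q : CoarsePair.{u} Γ} {S : P.GeneratingSequence} {T : Q.GeneratingSequence}
  {W V : SigmaPair.{u} Γ}

/-- The identity of a Rips complex. -/
def refl (S : P.GeneratingSequence) (hP : P.coarse.LocallyFinite) :
    RipsEmbedding (CoarsePair.rips S hP) S where
  toFun := id
  mem_filt _ _ := Iff.rfl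
  isClosedEmbedding _ := .id
  injective := Function.injective_id
  map_smul _ _ := rfl

/-- Change of the subspace. -/
def withSub (e : RipsEmbedding W S) {B : Set W.carrier}
    {hB : ∀ n, IsClosed {x : W.filt n | x.1 ∈ B}} {hΓ : ∀ (γ : Γ), ∀ x ∈ B, γ • x ∈ B} :
    RipsEmbedding (W.withSub B hB hΓ) S where
  toFun := e.toFun
  mem_filt := e.mem_filt
  isClosedEmbedding := e.isClosedEmbedding
  injective := e.injective
  map_smul := e.map_smul

/-- Restriction to the subspace. -/
def subspace (e : RipsEmbedding W S) : RipsEmbedding W.subspace S where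
  toFun w := e.toFun w.1
  mem_filt m w := e.mem_filt m w.1
  isClosedEmbedding m := (e.isClosedEmbedding m).comp (W.isClosedEmbedding_subToFilt m)
  injective := e.injective.comp Subtype.val_injective
  map_smul γ w := e.map_smul γ w.1

/-- A map of `σ`-locally compact spaces depending on a parameter in `Z`, in terms of barycentric
coordinates: on every stage it is continuous with uniformly controlled image, and stars
of vertices have preimages with finitely many vertices. -/
structure IsProperFamily {Z : Type*} [TopologicalSpace Z] (e : RipsEmbedding W S)
    (e' : RipsEmbedding V T) (F : W.carrier → Z → V.carrier) : Prop where
  controlled : ∀ m, ∃ E, Q.coarse.Controlled E ∧ ∀ w ∈ W.filt m, ∀ t,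
    ∀ y ∈ (e'.toFun (F w t)).coords.support, ∀ y' ∈ (e'.toFun (F w t)).coords.support, (y, y') ∈ E
  continuous : ∀ m y, Continuous fun z : W.filt m × Z => (e'.toFun (F z.1.1 z.2)).coords y
  finite : ∀ m y, ∃ U : Set P.carrier, U.Finite ∧ ∀ w ∈ W.filt m, ∀ t,
    y ∈ (e'.toFun (F w t)).coords.support → ∃ x ∈ U, x ∈ (e.toFun w).coords.support

/-- A compact set in the target involves finitely many vertices, so every point in its preimage has
a vertex in a fixed finite set. Being in stage `m`, it has all its vertices among the finitely many
`E_m`-neighbours of that set. Such points form a compact set, and the parameter space is compact. -/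
theorem IsProperFamily.exists_isProperMap {Z : Type*} [TopologicalSpace Z] [CompactSpace Z]
    (hP : P.coarse.LocallyFinite) (hQ : Q.coarse.LocallyFinite) {e : RipsEmbedding W S}
    {e' : RipsEmbedding V T} {F : W.carrier → Z → V.carrier} (hF : IsProperFamily e e' F) (m : ℕ) :
    ∃ n, ∃ h : ∀ (x : W.filt m) (t : Z), F x.1 t ∈ V.filt n,
      IsProperMap fun z : W.filt m × Z => (⟨F z.1.1 z.2, h z.1 z.2⟩ : V.filt n) := by
  obtain ⟨E, hE, hE'⟩ := hF.controlled m
  obtain ⟨n, hn⟩ := T.cofinal E hE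
  have hmem : ∀ (x : W.filt m) (t : Z), F x.1 t ∈ V.filt n := fun x t =>
    (e'.mem_filt n _).2 fun y hy y' hy' => hn (hE' x.1 x.2 t y hy y' hy')
  refine ⟨n, hmem, ?_⟩
  have hcont : Continuous fun z : W.filt m × Z => (⟨F z.1.1 z.2, hmem z.1 z.2⟩ : V.filt n) :=
    (e'.isClosedEmbedding n).isEmbedding.isInducing.continuous_iff.2
      (CoarsePair.continuous_to_level T fun y => hF.continuous m y)
  refine isProperMap_iff_isCompact_preimage.2 ⟨hcont, fun K hK => ?_⟩
  obtain ⟨U, hU, hKU⟩ := CoarsePair.IsCompact.exists_finite_support T hQ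
    (hK.image (e'.isClosedEmbedding n).continuous)
  choose G hG hG' using hF.finite m
  have hfin : (⋃ y ∈ U, ⋃ x ∈ G y, {x' | (x', x) ∈ S.ent m}).Finite :=
    hU.biUnion fun y _ => (hG y).biUnion fun x _ => CoarsePair.finite_neighbors S hP m x
  refine (((e.isClosedEmbedding m).isCompact_preimage
    (CoarsePair.isCompact_level_of_finite S m hfin)).prod isCompact_univ).of_isClosed_subset
    (hK.isClosed.preimage hcont) ?_
  rintro ⟨x, t⟩ hx
  refine ⟨fun a ha => ?_, trivial⟩
  obtain ⟨y, hy⟩ := (e'.toFun (F x.1 t)).isConvexCombination.exists_mem_support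
  obtain ⟨b, hb, hb'⟩ := hG' y x.1 x.2 t hy
  simp only [Set.mem_iUnion]
  exact ⟨y, hKU _ ⟨_, hx, rfl⟩ y hy, b, hb, (e.mem_filt m x.1).1 x.2 a ha b hb'⟩

theorem IsProperFamily.isProper (hP : P.coarse.LocallyFinite) (hQ : Q.coarse.LocallyFinite)
    {e : RipsEmbedding W S} {e' : RipsEmbedding V T} {F : W.carrier → V.carrier}
    (hF : IsProperFamily e e' fun w (_ : Unit) => F w) (m : ℕ) :
    ∃ n, ∃ h : Set.MapsTo F (W.filt m) (V.filt n), IsProperMap h.restrict := by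
  obtain ⟨n, h, hp⟩ := hF.exists_isProperMap hP hQ m
  exact ⟨n, fun x hx => h ⟨x, hx⟩ (), hp.comp (Homeomorph.prodPUnit (W.filt m)).symm.isProperMap⟩

theorem IsProperFamily.homotopic (hP : P.coarse.LocallyFinite) (hQ : Q.coarse.LocallyFinite)
    {e : RipsEmbedding W S} {e' : RipsEmbedding V T} {F : W.carrier → unitInterval → V.carrier}
    (hF : IsProperFamily e e' F) {f g : W ⟶ V} (hΓ : ∀ (γ : Γ) w t, F (γ • w) t = γ • F w t)
    (hsub : ∀ w ∈ W.sub, ∀ t, F w t ∈ V.sub) (h0 : ∀ w, F w 0 = f.toFun w)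
    (h1 : ∀ w, F w 1 = g.toFun w) : Homotopic f g :=
  ⟨fun z => F z.1 z.2, hF.exists_isProperMap hP hQ, hΓ, hsub, h0, h1⟩

end RipsEmbedding

end SigmaPair

/-! ## Piecewise linear paths -/

/-- The tent function. -/
noncomputable def tent (s : ℝ) : ℝ := max 0 (1 - |s|)

theorem tent_nonneg (s : ℝ) : 0 ≤ tent s := le_max_left _ _

theorem abs_lt_one_of_tent_ne_zero {s : ℝ} (h : tent s ≠ 0) : |s| < 1 := by
  by_contra! h'
  exact h (max_eq_left (by linarith))

theorem continuous_tent : Continuous tent := by unfold tent; fun_prop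

/-- The hat functions centred at `0, …, n` add up to `1` on `[0, n]` and then descend to `0` at `n +
1`. The descent is part of the statement because the induction step adds the next hat exactly there.
-/
theorem sum_tent_eq {s : ℝ} (hs : 0 ≤ s) (n : ℕ) :
    ∑ k ∈ Finset.range (n + 1), tent (s - k) = min 1 (max 0 (n + 1 - s)) := by
  induction n with
  | zero =>
    simp only [zero_add, Finset.range_one, Finset.sum_singleton, tent, Nat.cast_zero, sub_zero]
    rw [abs_of_nonneg hs, min_eq_right]
    exact max_le zero_le_one (by linarith)
  | succ n ih =>
    rw [Finset.sum_range_succ, ih, tent]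
    push_cast
    rcases le_total s (n + 1) with h | h
    · rw [abs_of_nonpos (by linarith), max_eq_right (b := (n : ℝ) + 1 - s) (by linarith),
        max_eq_right (b := (n : ℝ) + 1 + 1 - s) (by linarith),
        min_eq_left (b := (n : ℝ) + 1 + 1 - s) (by linarith)]
      rcases le_total s n with h' | h'
      · rw [min_eq_left (by linarith), max_eq_left (by linarith), add_zero]
      · rw [min_eq_right (by linarith), max_eq_right (by linarith)]
        ring
    · rw [abs_of_nonneg (by linarith), max_eq_left (b := (n : ℝ) + 1 - s) (by linarith),
        min_eq_right (b := (0 : ℝ)) zero_le_one, zero_add,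
        show 1 - (s - ((n : ℝ) + 1)) = (n : ℝ) + 1 + 1 - s by ring, min_eq_right]
      exact max_le zero_le_one (by linarith)

theorem sum_tent {s : ℝ} (hs : 0 ≤ s) {n : ℕ} (hn : s ≤ n) :
    ∑ k ∈ Finset.range (n + 1), tent (s - k) = 1 := by
  rw [sum_tent_eq hs, max_eq_right (by linarith), min_eq_left (by linarith)]

theorem tent_sub_natCast_of_ne {j k : ℕ} (h : j ≠ k) : tent ((j : ℝ) - k) = 0 := by
  refine max_eq_left ?_
  have : (1 : ℤ) ≤ |(j : ℤ) - k| := Int.one_le_abs (by omega)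
  have : (1 : ℝ) ≤ |(j : ℝ) - k| := by exact_mod_cast this
  linarith

section PiecewiseLinear

variable {Y Z : Type*}

/-- The node `k / n` of the subdivision of the unit interval into `n` pieces. -/
noncomputable def node (n k : ℕ) : unitInterval := Set.projIcc 0 1 zero_le_one ((k : ℝ) / n)

theorem coe_node {n k : ℕ} (h : k ≤ n) : (node n k : ℝ) = (k : ℝ) / n := by
  have : (k : ℝ) / n ∈ Set.Icc (0 : ℝ) 1 :=
    ⟨by positivity, div_le_one_of_le₀ (by exact_mod_cast h) (by positivity)⟩
  rw [node, Set.projIcc_of_mem _ this]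

/-- The piecewise affine path through the points `h (k / n)`. -/
noncomputable def piecewiseLinear (n : ℕ) (h : unitInterval → Y) (t : unitInterval) : Y →₀ ℝ :=
  ∑ k ∈ Finset.range (n + 1), Finsupp.single (h (node n k)) (tent (n * (t : ℝ) - k))

theorem isConvexCombination_piecewiseLinear (n : ℕ) (h : unitInterval → Y) (t : unitInterval) :
    IsConvexCombination (piecewiseLinear n h t) where
  nonneg y := by
    classical
    rw [piecewiseLinear, Finsupp.finsetSum_apply]
    refine Finset.sum_nonneg fun k _ => ?_
    rw [Finsupp.single_apply]
    split_ifs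
    exacts [tent_nonneg _, le_rfl]
  total := by
    rw [piecewiseLinear, map_sum]
    simp only [Finsupp.linearCombination_single, smul_eq_mul, mul_one]
    exact sum_tent (mul_nonneg n.cast_nonneg t.2.1) (mul_le_of_le_one_right n.cast_nonneg t.2.2)

theorem continuous_piecewiseLinear (n : ℕ) (h : unitInterval → Y) (y : Y) :
    Continuous fun t => piecewiseLinear n h t y := by
  classical
  simp only [piecewiseLinear, Finsupp.finsetSum_apply, Finsupp.single_apply]
  refine continuous_finsetSum _ fun k _ => ?_
  split_ifs
  · exact continuous_tent.comp (by fun_prop)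
  · exact continuous_const

/-- A hat function vanishes at distance at least `1` from its centre, so only nodes closer to `t`
than one mesh width contribute. Every vertex of the affine path is thus a nearby value of the
original one. -/
theorem exists_of_mem_support_piecewiseLinear {n : ℕ} (hn : 0 < n) {h : unitInterval → Y}
    {t : unitInterval} {y : Y} (hy : y ∈ (piecewiseLinear n h t).support) :
    ∃ s : unitInterval, |(t : ℝ) - s| < 1 / n ∧ h s = y := by
  classical
  rw [Finsupp.mem_support_iff, piecewiseLinear, Finsupp.finsetSum_apply] at hy
  obtain ⟨k, hk, hy⟩ := Finset.exists_ne_zero_of_sum_ne_zero hy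
  rw [Finsupp.single_apply] at hy
  split_ifs at hy with hky
  · refine ⟨_, ?_, hky⟩
    have hn' : (0 : ℝ) < n := by exact_mod_cast hn
    rw [coe_node (Nat.lt_succ_iff.1 (Finset.mem_range.1 hk)), lt_div_iff₀ hn', ← abs_of_pos hn',
      ← abs_mul, abs_of_pos hn', sub_mul, div_mul_cancel₀ _ hn'.ne', mul_comm (t : ℝ)]
    exact abs_lt_one_of_tent_ne_zero hy
  · exact (hy rfl).elim

theorem piecewiseLinear_node {n j : ℕ} (hn : 0 < n) (hj : j ≤ n) (h : unitInterval → Y) :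
    piecewiseLinear n h (node n j) = Finsupp.single (h (node n j)) 1 := by
  have hn' : (n : ℝ) ≠ 0 := by exact_mod_cast hn.ne'
  rw [piecewiseLinear, Finset.sum_eq_single j]
  · rw [coe_node hj, mul_div_cancel₀ _ hn', sub_self]
    simp [tent]
  · intro k _ hk
    rw [coe_node hj, mul_div_cancel₀ _ hn', tent_sub_natCast_of_ne hk.symm, Finsupp.single_zero]
  · intro h
    exact (h (Finset.mem_range.2 (Nat.lt_succ_iff.2 hj))).elim

theorem node_zero (n : ℕ) : node n 0 = 0 := Subtype.ext (by rw [coe_node n.zero_le]; simp)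

theorem node_self {n : ℕ} (hn : 0 < n) : node n n = 1 := by
  have hn' : (n : ℝ) ≠ 0 := by exact_mod_cast hn.ne'
  exact Subtype.ext (by rw [coe_node le_rfl, div_self hn']; simp)

theorem mapDomain_piecewiseLinear (g : Y → Z) (n : ℕ) (h : unitInterval → Y) (t : unitInterval) :
    Finsupp.mapDomain g (piecewiseLinear n h t) = piecewiseLinear n (fun s => g (h s)) t := by
  simp only [piecewiseLinear, Finsupp.mapDomain_finsetSum, Finsupp.mapDomain_single]

end PiecewiseLinear

namespace CoarsePair

variable {Γ : Type v} [Group Γ] {P Q R : CoarsePair.{u} Γ}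

theorem IsInvariantRel.iff {X : Type u} [MulAction Γ X] {E : SetRel X X}
    (h : IsInvariantRel Γ E) (γ : Γ) (x y : X) : (γ • x, γ • y) ∈ E ↔ (x, y) ∈ E := by
  refine ⟨fun h' => ?_, h γ x y⟩
  have := h γ⁻¹ _ _ h'
  rwa [inv_smul_smul, inv_smul_smul] at this

/-- A `Γ`-equivariant family of (not necessarily continuous) paths in `Y`, parametrized by a
locally finite `X`, which is horizontally controlled, uniformly controlled along the paths
after subdividing each of them, and proper, yields a homotopy between Rips complexes. -/
theorem homotopic_ripsMap (hP : P.coarse.LocallyFinite) (hQ : Q.coarse.LocallyFinite)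
    (S : P.GeneratingSequence) (T : Q.GeneratingSequence) {f g : P ⟶ Q}
    (H : P.carrier → unitInterval → Q.carrier)
    (hΓ : ∀ (γ : Γ) x t, H (γ • x) t = γ • H x t)
    (hsub : ∀ x ∈ P.sub, ∀ t, H x t ∈ Q.sub)
    (h0 : ∀ x, H x 0 = f.toFun x) (h1 : ∀ x, H x 1 = g.toFun x)
    (hhor : ∀ E, P.coarse.Controlled E → ∃ F, Q.coarse.Controlled F ∧
      ∀ x y t, (x, y) ∈ E → (H x t, H y t) ∈ F)
    (hvert : ∃ F, Q.coarse.Controlled F ∧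
      ∀ x, {p | (H x p.1, H x p.2) ∈ F} ∈ 𝓝ˢ (Set.diagonal unitInterval))
    (hfin : ∀ y, {x | ∃ t, H x t = y}.Finite) :
    SigmaPair.Homotopic (ripsMap S T hP hQ f) (ripsMap S T hP hQ g) := by
  obtain ⟨F₀, hF₀, hvert⟩ := hvert
  obtain ⟨F, hF, hF₀F, hFinv⟩ := Q.isocoarse F₀ hF₀
  -- No modulus uniform in `x` is available, so the subdivision depends on `x`. Taking the least
  -- admissible number for an invariant entourage makes it constant on orbits, which an arbitrary
  -- choice would not be.
  let N : P.carrier → ℕ := fun x => sInf {n | 0 < n ∧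
    ∀ s t : unitInterval, |(s : ℝ) - t| < 1 / n → (H x s, H x t) ∈ F}
  have hN : ∀ x, 0 < N x ∧
      ∀ s t : unitInterval, |(s : ℝ) - t| < 1 / N x → (H x s, H x t) ∈ F := by
    intro x
    refine Nat.sInf_mem (s := {n | 0 < n ∧
      ∀ s t : unitInterval, |(s : ℝ) - t| < 1 / n → (H x s, H x t) ∈ F}) ?_
    have h := hvert x
    -- Lebesgue number: by compactness of the interval, a neighbourhood of the diagonal contains a
    -- strip of positive width.
    rw [nhdsSet_diagonal_eq_uniformity, Metric.mem_uniformity_dist] at h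
    obtain ⟨ε, hε, h⟩ := h
    obtain ⟨n, hn⟩ := exists_nat_one_div_lt hε
    refine ⟨n + 1, n.succ_pos, fun s t hst => hF₀F (h ?_)⟩
    push_cast at hst
    exact hst.trans hn
  have hNΓ : ∀ (γ : Γ) x, N (γ • x) = N x := by
    intro γ x
    simp only [N, hΓ, IsInvariantRel.iff hFinv]
  let p : P.carrier → unitInterval → Q.carrier →₀ ℝ := fun x => piecewiseLinear (N x) (H x)
  have hpc : ∀ x t, IsConvexCombination (p x t) := fun x t =>
    isConvexCombination_piecewiseLinear _ _ _
  -- The vertices of the affine path are values of `H` itself. Control comes from the first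
  -- component; properness and compatibility with the subspaces come from the second.
  have hps : ∀ x t, ∀ y ∈ (p x t).support, (H x t, y) ∈ F ∧ ∃ s, H x s = y := by
    intro x t y hy
    obtain ⟨s, hs, rfl⟩ := exists_of_mem_support_piecewiseLinear (hN x).1 hy
    exact ⟨(hN x).2 t s hs, s, rfl⟩
  have key : ∀ E, P.coarse.Controlled E → ∃ G, Q.coarse.Controlled G ∧ ∀ (l : P.carrier →₀ ℝ),
      (∀ x ∈ l.support, ∀ x' ∈ l.support, (x, x') ∈ E) → ∀ t,
      ∀ y ∈ (Finsupp.linearCombination ℝ (fun x => p x t) l).support,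
      ∀ y' ∈ (Finsupp.linearCombination ℝ (fun x => p x t) l).support, (y, y') ∈ G := by
    intro E hE
    obtain ⟨G, hG, hEG⟩ := hhor E hE
    -- Two vertices over the same simplex are compared through `H x t` and `H x' t` at the common
    -- time `t`, so it does not matter that the paths have different subdivisions.
    refine ⟨F.inv.comp (G.comp F), Q.coarse.comp (Q.coarse.inv hF) (Q.coarse.comp hG hF), ?_⟩
    intro l hl t y hy y' hy'
    obtain ⟨x, hx, hy⟩ := exists_of_mem_support_linearCombination hy
    obtain ⟨x', hx', hy'⟩ := exists_of_mem_support_linearCombination hy'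
    exact ⟨H x t, (hps x t y hy).1, H x' t, hEG x x' t (hl x hx x' hx'), (hps x' t y' hy').1⟩
  let K : P.RipsPoint → unitInterval → Q.RipsPoint := fun l t =>
    .ofConvex (Finsupp.linearCombination ℝ (fun x => p x t) l.coords)
      (l.isConvexCombination.linearCombination fun x _ => hpc x t) (by
        obtain ⟨G, hG, h⟩ := key _ l.controlled
        exact Q.coarse.subset hG fun q hq =>
          h l.coords (fun x hx x' hx' => ⟨hx, hx'⟩) t q.1 hq.1 q.2 hq.2)
  have hK : SigmaPair.RipsEmbedding.IsProperFamily (.refl S hP) (.refl T hQ) K := by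
    refine ⟨fun m => ?_, fun m y => ?_, fun m y => ⟨_, hfin y, ?_⟩⟩
    · obtain ⟨G, hG, h⟩ := key _ (S.controlled m)
      exact ⟨G, hG, fun l hl t => h l.coords hl t⟩
    · refine (continuous_linearCombination hP S (m := m)
        (L := fun z : S.level m × unitInterval => z.1)
        (w := fun x z => p x z.2 y) continuous_fst
        fun x => (continuous_piecewiseLinear _ _ _).comp continuous_snd).congr fun z => ?_
      exact (linearCombination_coord _ _ _).symm
    · intro l _ t hy
      obtain ⟨x, hx, hy⟩ := exists_of_mem_support_linearCombination hy
      obtain ⟨s, hs⟩ := (hps x t y hy).2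
      exact ⟨x, ⟨s, hs⟩, hx⟩
  refine hK.homotopic hP hQ ?_ ?_ ?_ ?_
  · intro γ l t
    refine RipsPoint.ext (Eq.symm ?_)
    refine mapDomain_linearCombination (fun y => γ • y) (fun x => γ • x) (fun x => ?_) l.coords
    simp only [p, mapDomain_piecewiseLinear, ← hΓ, hNΓ]
  · intro l hl t y hy
    obtain ⟨x, hx, hy⟩ := exists_of_mem_support_linearCombination hy
    obtain ⟨s, rfl⟩ := (hps x t y hy).2
    exact hsub x (hl x hx) s
  · intro l
    refine RipsPoint.ext (Eq.trans ?_ (mapDomain_eq_linearCombination f.toFun l.coords).symm)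
    refine linearCombination_congr fun x _ => ?_
    have := piecewiseLinear_node (hN x).1 (Nat.zero_le _) (H x)
    rwa [node_zero, h0] at this
  · intro l
    refine RipsPoint.ext (Eq.trans ?_ (mapDomain_eq_linearCombination g.toFun l.coords).symm)
    refine linearCombination_congr fun x _ => ?_
    have := piecewiseLinear_node (hN x).1 le_rfl (H x)
    rwa [node_self (hN x).1, h1] at this

/-- The path that stays at `f x` and jumps to `g x` at time `1` is admissible: continuity is not
asked for, and closeness bounds the jump uniformly. -/
theorem homotopic_ripsMap_of_areClose (hP : P.coarse.LocallyFinite) (hQ : Q.coarse.LocallyFinite)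
    (S : P.GeneratingSequence) (T : Q.GeneratingSequence) {f g : P ⟶ Q}
    (h : AreClose Q.coarse f.toFun g.toFun) :
    SigmaPair.Homotopic (ripsMap S T hP hQ f) (ripsMap S T hP hQ g) := by
  classical
  refine homotopic_ripsMap hP hQ S T (fun x t => if t = 1 then g.toFun x else f.toFun x)
    ?_ ?_ ?_ ?_ ?_ ?_ ?_
  · intro γ x t
    split_ifs
    exacts [g.map_smul γ x, f.map_smul γ x]
  · intro x hx t
    split_ifs
    exacts [g.mapsTo hx, f.mapsTo hx]
  · intro x
    exact if_neg zero_ne_one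
  · intro x
    exact if_pos rfl
  · intro E hE
    refine ⟨_, Q.coarse.union (f.isCoarseMap.controlled E hE) (g.isCoarseMap.controlled E hE), ?_⟩
    intro x y t hxy
    split_ifs
    exacts [Or.inr ⟨_, hxy, rfl⟩, Or.inl ⟨_, hxy, rfl⟩]
  · refine ⟨_, Q.coarse.union Q.coarse.diag (Q.coarse.union h (Q.coarse.inv h)), fun x => ?_⟩
    convert Filter.univ_mem
    refine Set.eq_univ_of_forall fun p => ?_
    simp only [Set.mem_ofPred_eq]
    split_ifs
    exacts [Or.inl rfl, Or.inr (Or.inr ⟨x, rfl⟩), Or.inr (Or.inl ⟨x, rfl⟩), Or.inl rfl]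
  · intro y
    refine ((finite_preimage hP f.isCoarseMap.proper (Set.finite_singleton y)).union
      (finite_preimage hP g.isCoarseMap.proper (Set.finite_singleton y))).subset ?_
    rintro x ⟨t, ht⟩
    split_ifs at ht
    exacts [Or.inr ht, Or.inl ht]

theorem ripsMap_comp (hP : P.coarse.LocallyFinite) (hQ : Q.coarse.LocallyFinite)
    (hR : R.coarse.LocallyFinite) (S : P.GeneratingSequence) (T : Q.GeneratingSequence)
    (U : R.GeneratingSequence) (f : P ⟶ Q) (g : Q ⟶ R) :
    ripsMap S T hP hQ f ≫ ripsMap T U hQ hR g = ripsMap S U hP hR (f ≫ g) :=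
  SigmaPair.Hom.ext (funext fun _ => RipsPoint.ext Finsupp.mapDomain_comp.symm)

theorem ripsMap_id (hP : P.coarse.LocallyFinite) (S : P.GeneratingSequence) :
    ripsMap S S hP hP (𝟙 P) = 𝟙 _ :=
  SigmaPair.Hom.ext (funext fun _ => RipsPoint.ext Finsupp.mapDomain_id)

end CoarsePair

/-! ## Existence of discretizations -/

namespace CoarseStructure

variable {X : Type u} {Y : Type v}

theorem areClose_refl (𝓔 : CoarseStructure X) (f : Y → X) : AreClose 𝓔 f f := by
  refine 𝓔.subset 𝓔.diag ?_
  rintro _ ⟨x, rfl⟩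
  exact rfl

theorem _root_.AreClose.symm {𝓔 : CoarseStructure X} {f g : Y → X} (h : AreClose 𝓔 f g) :
    AreClose 𝓔 g f := by
  refine 𝓔.subset (𝓔.inv h) ?_
  rintro _ ⟨x, rfl⟩
  exact ⟨x, rfl⟩

theorem _root_.AreClose.trans {𝓔 : CoarseStructure X} {f g h : Y → X} (hfg : AreClose 𝓔 f g)
    (hgh : AreClose 𝓔 g h) : AreClose 𝓔 f h := by
  refine 𝓔.subset (𝓔.comp hfg hgh) ?_
  rintro _ ⟨x, rfl⟩
  exact ⟨g x, ⟨x, rfl⟩, ⟨x, rfl⟩⟩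

theorem _root_.AreClose.comp_right {Z : Type*} {𝓔 : CoarseStructure X} {f g : Y → X}
    (h : AreClose 𝓔 f g) (k : Z → Y) : AreClose 𝓔 (f ∘ k) (g ∘ k) := by
  refine 𝓔.subset h ?_
  rintro _ ⟨x, rfl⟩
  exact ⟨k x, rfl⟩

theorem _root_.IsControlledMap.comp_areClose {Z : Type*} {𝓔 : CoarseStructure X}
    {𝓕 : CoarseStructure Y} {k : X → Y} (hk : IsControlledMap 𝓔 𝓕 k) {f g : Z → X}
    (h : AreClose 𝓔 f g) : AreClose 𝓕 (k ∘ f) (k ∘ g) := by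
  refine 𝓕.subset (hk _ h) ?_
  rintro _ ⟨x, rfl⟩
  exact ⟨_, ⟨x, rfl⟩, rfl⟩

theorem _root_.IsCoarseMap.of_areClose_id {𝓔 : CoarseStructure X} {p : X → X}
    (h : AreClose 𝓔 p id) : IsCoarseMap 𝓔 𝓔 p := by
  constructor
  · intro E hE
    refine 𝓔.subset (𝓔.comp h (𝓔.comp hE (𝓔.inv h))) ?_
    rintro _ ⟨⟨x, y⟩, hxy, rfl⟩
    exact ⟨x, ⟨x, rfl⟩, y, hxy, ⟨y, rfl⟩⟩
  · rintro B ⟨E, hE, y, hy⟩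
    refine Bounded.precompact ⟨_, 𝓔.comp (𝓔.inv h) hE, y, fun x hx => ?_⟩
    obtain ⟨_, rfl, hxy⟩ := hy hx
    exact ⟨_, rfl, p x, ⟨x, rfl⟩, hxy⟩

theorem _root_.IsCoarseMap.codRestrict {𝓔 : CoarseStructure X} {𝓕 : CoarseStructure Y} {f : X → Y}
    (hf : IsCoarseMap 𝓔 𝓕 f) {B : Set Y} (h : ∀ x, f x ∈ B) :
    IsCoarseMap 𝓔 (𝓕.restrict B) (Set.codRestrict f B h) := by
  constructor
  · intro E hE
    rw [controlled_restrict_iff]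
    refine 𝓕.subset (hf.controlled E hE) ?_
    rintro _ ⟨_, ⟨p, hp, rfl⟩, rfl⟩
    exact ⟨p, hp, rfl⟩
  · intro C hC
    exact (hf.proper _ hC.of_restrict).mono fun x hx => ⟨_, hx, rfl⟩

/-- In a coarse space of bornologically bounded geometry, bounded sets are covered by finitely many
`E`-balls for some entourage `E` independent of the bounded set. -/
theorem BornologicallyBoundedGeometry.exists_finite_cover {𝓔 : CoarseStructure X}
    (h : 𝓔.BornologicallyBoundedGeometry) : ∃ E, 𝓔.Controlled E ∧ (∀ x, ∃ z, (x, z) ∈ E) ∧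
      ∀ K, 𝓔.Bounded K → ∃ Z : Set X, Z.Finite ∧ ∀ x ∈ K, ∃ z ∈ Z, (x, z) ∈ E := by
  obtain ⟨X', ⟨E, hE, hd⟩, hf⟩ := h
  choose q hqX hqE using hd
  refine ⟨E, hE, fun x => ⟨q x, hqE x⟩, fun K hK => ⟨q '' K, ?_, fun x hx => ⟨_, ⟨x, hx, rfl⟩, hqE x⟩⟩⟩
  have hb : 𝓔.Bounded (q '' K) := by
    obtain ⟨F, hF, y, hy⟩ := hK
    refine ⟨E.inv.comp F, 𝓔.comp (𝓔.inv hE) hF, y, ?_⟩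
    rintro _ ⟨x, hx, rfl⟩
    obtain ⟨_, rfl, hxy⟩ := hy hx
    exact ⟨_, rfl, x, hqE x, hxy⟩
  refine ((hf.finite_of_precompact (hb.precompact.to_restrict (A := X'))).image
    Subtype.val).subset ?_
  rintro _ ⟨x, hx, rfl⟩
  exact ⟨⟨q x, hqX x⟩, ⟨x, hx, rfl⟩, rfl⟩

end CoarseStructure

section InvariantRel

variable {Γ : Type v} [Group Γ] {X : Type u} [MulAction Γ X] {E F : SetRel X X}

theorem IsInvariantRel.comp (hE : IsInvariantRel Γ E) (hF : IsInvariantRel Γ F) :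
    IsInvariantRel Γ (E.comp F) := by
  rintro γ x z ⟨y, h, h'⟩
  exact ⟨γ • y, hE γ x y h, hF γ y z h'⟩

theorem IsInvariantRel.inv (hE : IsInvariantRel Γ E) : IsInvariantRel Γ E.inv :=
  fun γ x y h => hE γ y x h

/-- A maximal set of points in pairwise `E`-separated orbits. -/
theorem exists_maximal_separated (hE : IsInvariantRel Γ E) (hsymm : ∀ x y, (x, y) ∈ E → (y, x) ∈ E)
    (hrefl : ∀ x, (x, x) ∈ E) :
    ∃ Y : Set X, (∀ y ∈ Y, ∀ y' ∈ Y, ∀ γ : Γ, (y, γ • y') ∈ E → y = y') ∧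
      ∀ x, ∃ y ∈ Y, ∃ γ : Γ, (γ • x, y) ∈ E := by
  obtain ⟨Y, hY⟩ := zorn_subset
    {Y : Set X | ∀ y ∈ Y, ∀ y' ∈ Y, ∀ γ : Γ, (y, γ • y') ∈ E → y = y'} (by
      intro c hc hchain
      refine ⟨⋃₀ c, ?_, fun s hs => Set.subset_sUnion_of_mem hs⟩
      rintro y ⟨s, hs, hys⟩ y' ⟨s', hs', hys'⟩ γ h
      rcases hchain.total hs hs' with h' | h'
      · exact hc hs' y (h' hys) y' hys' γ h
      · exact hc hs y hys y' (h' hys') γ h)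
  refine ⟨Y, hY.prop, fun x => ?_⟩
  by_contra! hx
  have hins : insert x Y ∈
      {Y : Set X | ∀ y ∈ Y, ∀ y' ∈ Y, ∀ γ : Γ, (y, γ • y') ∈ E → y = y'} := by
    rintro y (rfl | hy) y' (rfl | hy') γ h
    · rfl
    · have := hE γ⁻¹ _ _ h
      rw [inv_smul_smul] at this
      exact (hx y' hy' γ⁻¹ this).elim
    · exact (hx y hy γ (hsymm _ _ h)).elim
    · exact hY.prop y hy y' hy' γ h
  have hmem : x ∈ Y := hY.le_of_ge hins (Set.subset_insert x Y) (Set.mem_insert x Y)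
  exact hx x hmem 1 (by rw [one_smul]; exact hrefl x)

end InvariantRel

namespace CoarsePair

variable {Γ : Type v} [Group Γ]

theorem nonempty_generatingSequence (P : CoarsePair.{u} Γ) : Nonempty P.GeneratingSequence := by
  obtain ⟨F, hF, hc⟩ := P.countablyGenerated.exists_seq
  choose G hG hFG hGi using fun n => P.isocoarse (F n) (hF n)
  let D : ℕ → SetRel P.carrier P.carrier := fun n =>
    Nat.rec SetRel.id (fun n E => E ∪ G n) n
  have hD : ∀ n, D (n + 1) = D n ∪ G n := fun _ => rfl
  refine ⟨⟨D, rfl, monotone_nat_of_le_succ fun n => Set.subset_union_left, fun n => ?_, fun E hE => ?_,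
    fun n => ?_⟩⟩
  · induction n with
    | zero => exact P.coarse.diag
    | succ n ih => exact P.coarse.union ih (hG n)
  · obtain ⟨n, hn⟩ := hc E hE
    exact ⟨n + 1, fun p hp => Or.inr (hFG n (hn hp))⟩
  · induction n with
    | zero =>
      rintro γ x y (rfl : x = y)
      exact rfl
    | succ n ih =>
      rintro γ x y (h | h)
      exacts [Or.inl (ih γ x y h), Or.inr (hGi n γ x y h)]

/-- An equivariant idempotent map with locally finite image, close to the identity and
compatible with the subspace and with a further invariant subset. -/
theorem exists_equivariant_idempotent (P : CoarsePair.{u} Γ) (R : Set P.carrier)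
    (hR : ∀ (γ : Γ) x, γ • x ∈ R ↔ x ∈ R) :
    ∃ p : P.carrier → P.carrier, (∀ (γ : Γ) x, p (γ • x) = γ • p x) ∧ (∀ x, p (p x) = p x) ∧
      AreClose P.coarse p id ∧ (∀ x, p x ∈ P.sub ↔ x ∈ P.sub) ∧ (∀ x, p x ∈ R ↔ x ∈ R) ∧
      ∀ K, P.coarse.Bounded K → (Set.range p ∩ K).Finite := by
  have hA : ∀ (γ : Γ) x, γ • x ∈ P.sub ↔ x ∈ P.sub := fun γ x =>
    ⟨fun h => by simpa using P.smul_mem_sub γ⁻¹ _ h, P.smul_mem_sub γ x⟩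
  -- Finite covers by `E₀`-balls of every bounded set are the form in which bounded geometry enters;
  -- separation is then measured by the doubled entourage `E`, so that a single ball meets at most
  -- one orbit of a separated set.
  obtain ⟨E₀, hE₀, hE₀d, hE₀c⟩ := P.boundedGeometry.exists_finite_cover
  obtain ⟨E₁, hE₁, hE₀₁, hE₁i⟩ := P.isocoarse E₀ hE₀
  let E := E₁.comp E₁.inv
  have hE : P.coarse.Controlled E := P.coarse.comp hE₁ (P.coarse.inv hE₁)
  have hEi : IsInvariantRel Γ E := hE₁i.comp hE₁i.inv
  have hEsymm : ∀ x y, (x, y) ∈ E → (y, x) ∈ E := fun x y ⟨z, h, h'⟩ => ⟨z, h', h⟩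
  have hErefl : ∀ x, (x, x) ∈ E := fun x =>
    (hE₀d x).elim fun z hz => ⟨z, hE₀₁ hz, hE₀₁ hz⟩
  obtain ⟨Y, hYsep, hYdense⟩ := exists_maximal_separated hEi hEsymm hErefl
  -- in every orbit choose a point near a point of `Y`
  let Ω := MulAction.orbitRel.Quotient Γ P.carrier
  let mk : P.carrier → Ω := Quotient.mk _
  have hmk : ∀ (γ : Γ) x, mk (γ • x) = mk x := fun γ x =>
    Quotient.sound (s := MulAction.orbitRel Γ P.carrier) ⟨γ, rfl⟩
  have hσ : ∀ o : Ω, ∃ s y, mk s = o ∧ y ∈ Y ∧ (s, y) ∈ E := by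
    intro o
    obtain ⟨x, rfl⟩ := Quotient.exists_rep o
    obtain ⟨y, hy, γ, h⟩ := hYdense x
    exact ⟨γ • x, y, hmk γ x, hy, h⟩
  choose σ y hσo hyY hσy using hσ
  have hg : ∀ x, ∃ γ : Γ, γ • σ (mk x) = x := fun x =>
    Quotient.exact (s := MulAction.orbitRel Γ P.carrier) (hσo (mk x)).symm
  choose g hg using hg
  -- Orbits of one class have representatives near the same point of `Y`, with equal stabilizers and
  -- equal membership in the two subsets. They can be identified equivariantly while moving points
  -- only by `E.comp E.inv`.
  let cls : Ω → P.carrier × Subgroup Γ × Prop × Prop := fun o =>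
    (y o, MulAction.stabilizer Γ (σ o), σ o ∈ P.sub, σ o ∈ R)
  -- One orbit is chosen from each class; its own class is unchanged, and this makes `ρ`, and with
  -- it `p`, idempotent.
  let rep : Set.range cls → Ω := Set.rangeSplitting cls
  let ρ : Ω → Ω := fun o => rep ⟨cls o, o, rfl⟩
  have hρ : ∀ o, cls (ρ o) = cls o := fun o => Set.apply_rangeSplitting cls _
  have hρ' : ∀ o o', cls o = cls o' → ρ o = ρ o' := fun o o' h => by
    simp only [ρ, h]
  have hρy : ∀ o, y (ρ o) = y o := fun o => congrArg (fun c => c.1) (hρ o)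
  have hρs : ∀ o, MulAction.stabilizer Γ (σ (ρ o)) = MulAction.stabilizer Γ (σ o) := fun o =>
    congrArg (fun c => c.2.1) (hρ o)
  have hρA : ∀ o, (σ (ρ o) ∈ P.sub) = (σ o ∈ P.sub) := fun o => congrArg (fun c => c.2.2.1) (hρ o)
  have hρR : ∀ o, (σ (ρ o) ∈ R) = (σ o ∈ R) := fun o => congrArg (fun c => c.2.2.2) (hρ o)
  let p : P.carrier → P.carrier := fun x => g x • σ (ρ (mk x))
  -- Two elements carrying `σ (mk x)` to `x` differ by a stabilizer element, which also fixes `σ (ρ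
  -- (mk x))`. Hence the arbitrary choice of `g x` has no effect on `p`.
  have hp : ∀ (γ : Γ) x, γ • σ (mk x) = x → p x = γ • σ (ρ (mk x)) := by
    intro γ x h
    have h1 : γ⁻¹ * g x ∈ MulAction.stabilizer Γ (σ (mk x)) := by
      rw [MulAction.mem_stabilizer_iff, mul_smul, hg, inv_smul_eq_iff, h]
    rw [← hρs, MulAction.mem_stabilizer_iff, mul_smul, inv_smul_eq_iff] at h1
    exact h1
  have hmkp : ∀ x, mk (p x) = ρ (mk x) := fun x => (hmk _ _).trans (hσo _)
  have hρρ : ∀ o, ρ (ρ o) = ρ o := fun o => hρ' _ _ (hρ o)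
  refine ⟨p, fun γ x => ?_, fun x => ?_, ?_, fun x => ?_, fun x => ?_, fun K hK => ?_⟩
  · rw [hp (γ * g x) (γ • x) (by rw [hmk, mul_smul, hg]), hmk, mul_smul]
  · rw [hp (g x) (p x) (by rw [hmkp]), hmkp, hρρ]
  · refine P.coarse.subset (P.coarse.comp hE (P.coarse.inv hE)) ?_
    rintro _ ⟨x, rfl⟩
    refine ⟨g x • y (mk x), ?_, ?_⟩
    · have := hEi (g x) _ _ (hσy (ρ (mk x)))
      rwa [hρy] at this
    · have := hEi (g x) _ _ (hσy (mk x))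
      rwa [hg] at this
  · rw [hA, hρA, ← hA (g x), hg]
  · rw [hR, hρR, ← hR (g x), hg]
  · let K' : Set P.carrier := {z | ∃ k ∈ K, (k, z) ∈ E}
    have hK' : P.coarse.Bounded K' := by
      obtain ⟨F, hF, z, hz⟩ := hK
      refine ⟨E.inv.comp F, P.coarse.comp (P.coarse.inv hE) hF, z, ?_⟩
      rintro x ⟨k, hk, hkx⟩
      obtain ⟨_, rfl, h⟩ := hz hk
      exact ⟨_, rfl, k, hkx, h⟩
    -- Cover `K'` by finitely many `E₁`-balls. If two points of `Y` have translates in the same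
    -- ball, these are `E`-close, so separation makes the points equal.
    have hY' : {z ∈ Y | ∃ γ : Γ, γ • z ∈ K'}.Finite := by
      obtain ⟨Z, hZ, hZc⟩ := hE₀c K' hK'
      have : ∀ z ∈ {z ∈ Y | ∃ γ : Γ, γ • z ∈ K'}, ∃ b ∈ Z, ∃ γ : Γ, (γ • z, b) ∈ E₁ := by
        rintro z ⟨-, γ, h⟩
        obtain ⟨b, hb, h'⟩ := hZc _ h
        exact ⟨b, hb, γ, hE₀₁ h'⟩
      choose! b hb γ hγ using this
      refine Set.Finite.of_injOn (f := b) hb (fun z hz z' hz' h => ?_) hZ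
      have h1 := hγ z hz
      rw [h] at h1
      have h2 : (γ z • z, γ z' • z') ∈ E := ⟨b z', h1, hγ z' hz'⟩
      have h3 := hEi (γ z)⁻¹ _ _ h2
      rw [inv_smul_smul, smul_smul] at h3
      exact hYsep z hz.1 z' hz'.1 _ h3
    have hγfin : ∀ z : P.carrier, {γ : Γ | γ • z ∈ K'}.Finite := by
      intro z
      rcases Set.eq_empty_or_nonempty {γ : Γ | γ • z ∈ K'} with h | ⟨γ₀, h₀⟩
      · rw [h]; exact Set.finite_empty
      · refine Set.Finite.of_injOn (f := fun γ => γ * γ₀⁻¹) (fun γ hγ => ?_)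
          (mul_left_injective _).injOn (P.proper K' hK')
        refine ⟨γ₀ • z, h₀, ?_⟩
        rw [mul_smul, inv_smul_smul]
        exact hγ
    -- The stabilizer of a point in a bounded ball only contains elements moving the ball to meet
    -- itself. These are finitely many by properness, so finitely many stabilizers occur.
    have hGfin : ∀ z : P.carrier,
        {G : Subgroup Γ | ∃ s, (s, z) ∈ E ∧ MulAction.stabilizer Γ s = G}.Finite := by
      intro z
      have hb : P.coarse.Bounded {s | (s, z) ∈ E} := ⟨E, hE, z, fun s hs => ⟨z, rfl, hs⟩⟩
      refine Set.Finite.of_injOn (f := fun G : Subgroup Γ => (G : Set Γ)) ?_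
        SetLike.coe_injective.injOn (P.proper _ hb).finite_subsets
      rintro _ ⟨s, hs, rfl⟩ γ hγ
      exact ⟨s, hs, by rw [show γ • s = s from hγ]; exact hs⟩
    have hcls : ∀ x, p x ∈ K → (g x, cls (ρ (mk x))) ∈
        ⋃ z ∈ {z ∈ Y | ∃ γ : Γ, γ • z ∈ K'}, {γ : Γ | γ • z ∈ K'} ×ˢ ({z} : Set P.carrier) ×ˢ
          {G : Subgroup Γ | ∃ s, (s, z) ∈ E ∧ MulAction.stabilizer Γ s = G} ×ˢ
          (Set.univ : Set (Prop × Prop)) := by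
      intro x hx
      have hm : g x • y (ρ (mk x)) ∈ K' := ⟨p x, hx, hEi _ _ _ (hσy _)⟩
      simp only [Set.mem_iUnion]
      exact ⟨y (ρ (mk x)), ⟨hyY _, _, hm⟩, hm, rfl, ⟨_, hσy _, rfl⟩, trivial⟩
    have hx : ∀ k ∈ Set.range p ∩ K, ∃ x, p x = k := fun k hk => hk.1
    choose! x hx using hx
    -- A value `p x` is recovered from `g x` and the class of `ρ (mk x)`, since `ρ` depends only on
    -- the class and is idempotent.
    refine Set.Finite.of_injOn (f := fun k => (g (x k), cls (ρ (mk (x k)))))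
      (fun k hk => hcls _ (by rw [hx k hk]; exact hk.2)) (fun k hk k' hk' h => ?_)
      (hY'.biUnion fun z _ => (hγfin z).prod ((Set.finite_singleton z).prod
        ((hGfin z).prod Set.finite_univ)))
    obtain ⟨h1, h2⟩ := Prod.mk.inj h
    have h3 := hρ' _ _ h2
    rw [hρρ, hρρ] at h3
    rw [← hx k hk, ← hx k' hk']
    change g (x k) • σ (ρ (mk (x k))) = g (x k') • σ (ρ (mk (x k')))
    rw [h1, h3]

end CoarsePair

namespace Discretization

variable {Γ : Type v} [Group Γ] {P Q R : CoarsePair.{u} Γ}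

/-- A left inverse of the inclusion of a discretization which is close to the identity is a
retraction. -/
def Retraction.ofAreClose {D : Discretization P} (π : P ⟶ D.pair) (π_ι : D.ι ≫ π = 𝟙 _)
    (h : AreClose P.coarse (D.ι.toFun ∘ π.toFun) id) : D.Retraction where
  π := π
  π_ι := π_ι
  isCoarseEquivalence := by
    refine ⟨π.isCoarseMap, D.ι.toFun, D.ι.isCoarseMap, h, ?_⟩
    have : π.toFun ∘ D.ι.toFun = id := congrArg CoarsePair.Hom.toFun π_ι
    rw [this]
    exact CoarseStructure.areClose_refl _ _
  isCoarseEquivalence_sub := by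
    refine ⟨(CoarsePair.subspaceMap π).isCoarseMap, (CoarsePair.subspaceMap D.ι).toFun,
      (CoarsePair.subspaceMap D.ι).isCoarseMap, ?_, ?_⟩
    · refine CoarseStructure.controlled_restrict_iff.2 (P.coarse.subset h ?_)
      rintro _ ⟨_, ⟨x, rfl⟩, rfl⟩
      exact ⟨x.1, rfl⟩
    · have : (CoarsePair.subspaceMap π).toFun ∘ (CoarsePair.subspaceMap D.ι).toFun = id :=
        funext fun x => Subtype.ext (congrFun (congrArg CoarsePair.Hom.toFun π_ι) x.1)
      rw [this]
      exact CoarseStructure.areClose_refl _ _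

end Discretization

namespace RetractedDiscretization

variable {Γ : Type v} [Group Γ] {P Q R : CoarsePair.{u} Γ}

/-- The discretization is the image of `p`, and `p` itself is the retraction: closeness to the
identity gives density of the image in `X` and, as `p` preserves `A`, also in `A`. -/
theorem exists_of_idempotent (p : P.carrier → P.carrier) (hΓ : ∀ (γ : Γ) x, p (γ • x) = γ • p x)
    (hidem : ∀ x, p (p x) = p x) (hp : AreClose P.coarse p id) (hA : Set.MapsTo p P.sub P.sub)
    (hfin : ∀ K, P.coarse.Bounded K → (Set.range p ∩ K).Finite) :
    ∃ D : RetractedDiscretization P, ∀ x, D.ι.toFun (D.retraction.π.toFun x) = p x := by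
  have hsmul : ∀ (γ : Γ), ∀ x ∈ Set.range p, γ • x ∈ Set.range p := by
    rintro γ _ ⟨x, rfl⟩
    exact ⟨γ • x, hΓ γ x⟩
  let D : Discretization P :=
    { pts := Set.range p
      smul_mem := hsmul
      dense := ⟨_, hp.symm, fun x => ⟨p x, ⟨x, rfl⟩, ⟨x, rfl⟩⟩⟩
      dense_sub := ⟨_, ⟨_, hp.symm, rfl⟩, fun x => ⟨⟨p x.1, hA x.2⟩, ⟨x.1, rfl⟩, ⟨x.1, rfl⟩⟩⟩
      locallyFinite := fun K hK => by
        refine Set.Finite.of_finite_image ((hfin _ hK.of_restrict).subset ?_)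
          Subtype.val_injective.injOn
        rintro _ ⟨x, hx, rfl⟩
        exact ⟨x.2, ⟨x, hx, rfl⟩⟩
      gen := (CoarsePair.nonempty_generatingSequence _).some }
  let π : P ⟶ D.pair :=
    { toFun := Set.codRestrict p (Set.range p) fun x => ⟨x, rfl⟩
      isCoarseMap := (IsCoarseMap.of_areClose_id hp).codRestrict _
      map_smul := fun γ x => Subtype.ext (hΓ γ x)
      mapsTo := fun x hx => hA hx }
  refine ⟨⟨D, .ofAreClose π ?_ hp⟩, fun x => rfl⟩
  refine CoarsePair.Hom.ext (funext fun x => Subtype.ext ?_)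
  obtain ⟨y, hy⟩ := x.2
  change p x.1 = x.1
  rw [← hy, hidem]

theorem nonempty (P : CoarsePair.{u} Γ) : Nonempty (RetractedDiscretization P) := by
  -- The additional invariant set is irrelevant here and taken empty; it serves the discretizations
  -- adapted to an excision.
  obtain ⟨p, hΓ, hidem, hp, hA, -, hfin⟩ := P.exists_equivariant_idempotent ∅ fun _ _ => Iff.rfl
  obtain ⟨D, -⟩ := exists_of_idempotent p hΓ hidem hp (fun x hx => (hA x).2 hx) hfin
  exact ⟨D⟩

end RetractedDiscretization

/-! ### Homotopy equivalences and transport of exactness. -/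

namespace SigmaPair

variable {Γ : Type v} [Group Γ] {P Q R : SigmaPair.{u} Γ}

/-- Precomposition suffices below: the morphisms to be compared begin with the same identification
of a subspace or absolute pair with a Rips complex. -/
theorem Homotopic.precomp {f g : Q ⟶ R} (h : Homotopic f g) (k : P ⟶ Q) :
    Homotopic (k ≫ f) (k ≫ g) := by
  obtain ⟨H, hH, hΓ, hsub, h0, h1⟩ := h
  refine ⟨fun z => H (k.toFun z.1, z.2), fun m => ?_, fun γ x t => ?_, fun x hx t => ?_,
    fun x => h0 _, fun x => h1 _⟩
  · obtain ⟨n, hk, hkp⟩ := k.isProper m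
    obtain ⟨l, hl, hlp⟩ := hH n
    exact ⟨l, fun x t => hl ⟨_, hk x.2⟩ t, hlp.comp (hkp.prodMap isProperMap_id)⟩
  · exact (congrArg (fun y => H (y, t)) (k.map_smul γ x)).trans (hΓ γ _ t)
  · exact hsub _ (k.mapsTo hx) t

/-- Homotopy equivalences of pairs. -/
def IsHomotopyEquivalence (f : P ⟶ Q) : Prop :=
  ∃ g : Q ⟶ P, Homotopic (f ≫ g) (𝟙 P) ∧ Homotopic (g ≫ f) (𝟙 Q)

end SigmaPair

section Theories

variable {Γ : Type v} [Group Γ] {P Q : SigmaPair.{u} Γ}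

theorem IsHomologyTheory.isIso_of_isHomotopyEquivalence {E : HomologyData.{w} (SigmaPair.{u} Γ)}
    (hE : IsHomologyTheory E) {f : P ⟶ Q} (hf : SigmaPair.IsHomotopyEquivalence f) (p : ℤ) :
    IsIso (E.map p f) := by
  obtain ⟨g, h1, h2⟩ := hf
  refine ⟨E.map p g, ?_, ?_⟩
  · rw [← hE.map_comp, hE.homotopy p _ _ h1, hE.map_id]
  · rw [← hE.map_comp, hE.homotopy p _ _ h2, hE.map_id]

theorem IsCohomologyTheory.isIso_of_isHomotopyEquivalence
    {E : CohomologyData.{w} (SigmaPair.{u} Γ)}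
    (hE : IsCohomologyTheory E) {f : P ⟶ Q} (hf : SigmaPair.IsHomotopyEquivalence f) (p : ℤ) :
    IsIso (E.map p f) := by
  obtain ⟨g, h1, h2⟩ := hf
  refine ⟨E.map p g, ?_, ?_⟩
  · rw [← hE.map_comp, hE.homotopy p _ _ h2, hE.map_id]
  · rw [← hE.map_comp, hE.homotopy p _ _ h1, hE.map_id]

theorem IsHomologyTheory.isIso_of_isIso {E : HomologyData.{w} (SigmaPair.{u} Γ)}
    (hE : IsHomologyTheory E) (f : P ⟶ Q) [IsIso f] (p : ℤ) : IsIso (E.map p f) :=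
  ⟨E.map p (inv f), by rw [← hE.map_comp, IsIso.hom_inv_id, hE.map_id],
    by rw [← hE.map_comp, IsIso.inv_hom_id, hE.map_id]⟩

theorem IsCohomologyTheory.isIso_of_isIso {E : CohomologyData.{w} (SigmaPair.{u} Γ)}
    (hE : IsCohomologyTheory E) (f : P ⟶ Q) [IsIso f] (p : ℤ) : IsIso (E.map p f) :=
  ⟨E.map p (inv f), by rw [← hE.map_comp, IsIso.inv_hom_id, hE.map_id],
    by rw [← hE.map_comp, IsIso.hom_inv_id, hE.map_id]⟩

theorem AddCommGrpCat.exact_of_ladder {A B C A' B' C' : AddCommGrpCat.{w}} {f : A ⟶ B} {g : B ⟶ C}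
    {f' : A' ⟶ B'} {g' : B' ⟶ C'} {a : A ⟶ A'} {b : B ⟶ B'} {c : C ⟶ C'}
    (_ : IsIso a) (_ : IsIso b) (_ : IsIso c) (h1 : a ≫ f' = f ≫ b) (h2 : b ≫ g' = g ≫ c) (h : Function.Exact f g) :
    Function.Exact f' g' := by
  have h1' : ∀ x, f' (a x) = b (f x) := fun x => congrArg (fun k => k x) h1
  have h2' : ∀ x, g' (b x) = c (g x) := fun x => congrArg (fun k => k x) h2
  have hb : ∀ y, ∃ x, b x = y := fun y => ⟨inv b y, by
    rw [← AddCommGrpCat.comp_apply, IsIso.inv_hom_id]; rfl⟩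
  have ha : ∀ y, ∃ x, a x = y := fun y => ⟨inv a y, by
    rw [← AddCommGrpCat.comp_apply, IsIso.inv_hom_id]; rfl⟩
  have hb' : ∀ x y, b x = b y → x = y := fun x y h => by
    have := congrArg (inv b) h
    rwa [← AddCommGrpCat.comp_apply, ← AddCommGrpCat.comp_apply, IsIso.hom_inv_id] at this
  have hc' : ∀ x y, c x = c y → x = y := fun x y h => by
    have := congrArg (inv c) h
    rwa [← AddCommGrpCat.comp_apply, ← AddCommGrpCat.comp_apply, IsIso.hom_inv_id] at this
  intro y
  obtain ⟨y, rfl⟩ := hb y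
  constructor
  · intro hy
    obtain ⟨x, rfl⟩ := (h y).1 (hc' _ _ (by rw [← h2', hy, map_zero]))
    exact ⟨a x, h1' x⟩
  · rintro ⟨x, hx⟩
    obtain ⟨x, rfl⟩ := ha x
    rw [h1'] at hx
    rw [h2', (h y).2 ⟨x, hb' _ _ hx⟩, map_zero]

end Theories

/-! ### Rips complexes of subspaces and of absolute pairs. -/

namespace CoarsePair

variable {Γ : Type v} [Group Γ] {P Q R : CoarsePair.{u} Γ}

/-- Functoriality of `(X, A) ↦ (X, ∅)`. -/
def absoluteMap (f : P ⟶ Q) : P.absolute ⟶ Q.absolute where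
  toFun := f.toFun
  isCoarseMap := f.isCoarseMap
  map_smul := f.map_smul
  mapsTo := fun _ h => h.elim

theorem isHomotopyEquivalence_ripsMap (hP : P.coarse.LocallyFinite) (hQ : Q.coarse.LocallyFinite)
    (S : P.GeneratingSequence) (T : Q.GeneratingSequence) (f : P ⟶ Q) (g : Q ⟶ P)
    (h1 : AreClose P.coarse (g.toFun ∘ f.toFun) id) (h2 : AreClose Q.coarse (f.toFun ∘ g.toFun) id) :
    SigmaPair.IsHomotopyEquivalence (ripsMap S T hP hQ f) := by
  refine ⟨ripsMap T S hQ hP g, ?_, ?_⟩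
  · rw [ripsMap_comp, ← ripsMap_id hP S]
    exact homotopic_ripsMap_of_areClose hP hP S S h1
  · rw [ripsMap_comp, ← ripsMap_id hQ T]
    exact homotopic_ripsMap_of_areClose hQ hQ T T h2

theorem mapDomain_val_subtypeDomain {X : Type*} {A : Set X} {l : X →₀ ℝ}
    (hl : ∀ x ∈ l.support, x ∈ A) :
    Finsupp.mapDomain Subtype.val (l.subtypeDomain (· ∈ A)) = l := by
  ext x
  by_cases hx : x ∈ A
  · exact Finsupp.mapDomain_apply Subtype.val_injective _ (⟨x, hx⟩ : A)
  · rw [Finsupp.mapDomain_of_notMem_range _ _ (by simpa using hx)]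
    by_contra h
    exact hx (hl x (Finsupp.mem_support_iff.2 (Ne.symm h)))

section

variable (S : P.GeneratingSequence) (T : Q.GeneratingSequence)

theorem subspaceMap_ripsMap_comp_ripsSubspace (hP : P.coarse.LocallyFinite)
    (hQ : Q.coarse.LocallyFinite) (f : P ⟶ Q) :
    SigmaPair.subspaceMap (ripsMap S T hP hQ f) ≫ ripsSubspace T hQ =
      ripsSubspace S hP ≫ ripsMap S.restrict T.restrict (hP.restrict P.sub) (hQ.restrict Q.sub)
        (subspaceMap f) := by
  refine SigmaPair.Hom.ext (funext fun l => RipsPoint.ext ?_)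
  -- The square commutes strictly; extension by zero from `B` to `Y` is injective, and afterwards
  -- both sides are the pushforward of the same coordinates under `f`.
  refine Finsupp.mapDomain_injective (Subtype.val_injective (p := (· ∈ Q.sub))) ?_
  refine (mapDomain_val_subtypeDomain ((SigmaPair.subspaceMap (ripsMap S T hP hQ f)).toFun l).2).trans
    ?_
  change Finsupp.mapDomain f.toFun l.1.coords = Finsupp.mapDomain Subtype.val
    (Finsupp.mapDomain (f.mapsTo.restrict) (l.1.coords.subtypeDomain (· ∈ P.sub)))
  rw [← Finsupp.mapDomain_comp]
  conv_lhs => rw [← mapDomain_val_subtypeDomain l.2, ← Finsupp.mapDomain_comp]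
  rfl

instance isIso_ripsSubspace (hP : P.coarse.LocallyFinite) : IsIso (ripsSubspace S hP) := by
  let k : rips S.restrict (hP.restrict P.sub) ⟶ (rips S hP).subspace :=
    { toFun := fun l => ⟨l.map (P := P.subspace) (Q := P) Subtype.val
        (CoarseStructure.isCoarseMap_val P.coarse P.sub).controlled, fun x hx => by
          obtain ⟨x, -, rfl⟩ := exists_of_mem_support_mapDomain _ _ hx
          exact x.2⟩
      isProper := fun m => ⟨m, fun l hl => ((ripsSubspaceHomeo S hP m).symm ⟨l, hl⟩).2,
        (ripsSubspaceHomeo S hP m).symm.isClosedEmbedding.isProperMap⟩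
      map_smul := fun γ l => by
        refine Subtype.ext (RipsPoint.ext ?_)
        refine (Finsupp.mapDomain_comp (f := fun x : P.subspace.carrier => γ • x)
          (g := Subtype.val)).symm.trans ?_
        exact Finsupp.mapDomain_comp (f := Subtype.val) (g := fun x : P.carrier => γ • x)
      -- Vacuous: the coordinates sum to `1`, so no point is supported in the empty set.
      mapsTo := fun l hl => (l.isConvexCombination.exists_mem_support).elim fun x hx => hl x hx }
  refine ⟨k, SigmaPair.Hom.ext (funext fun l => Subtype.ext (RipsPoint.ext ?_)),
    SigmaPair.Hom.ext (funext fun l => RipsPoint.ext (Finsupp.ext fun x => ?_))⟩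
  · exact mapDomain_val_subtypeDomain l.2
  · exact Finsupp.mapDomain_apply Subtype.val_injective _ x

/-- A generating sequence of `X`, regardless of the subspace. -/
def GeneratingSequence.absolute : P.absolute.GeneratingSequence where
  ent := S.ent
  ent_zero := S.ent_zero
  mono := S.mono
  controlled := S.controlled
  cofinal := S.cofinal
  invariant := S.invariant

/-- The identification of `(𝒫(X), ∅)` with the Rips complex of `(X, ∅)`. -/
noncomputable def ripsAbsolute (hP : P.coarse.LocallyFinite) :
    (rips S hP).absolute ⟶ rips S.absolute hP where
  toFun l := ⟨l.coords, l.nonneg, l.sum_eq_one, l.controlled⟩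
  isProper m := ⟨m, fun _ hl => hl,
    (Homeomorph.mk (X := S.level m) (Y := S.absolute.level m)
      ⟨fun l => ⟨⟨l.1.coords, l.1.nonneg, l.1.sum_eq_one, l.1.controlled⟩, l.2⟩,
        fun l => ⟨⟨l.1.coords, l.1.nonneg, l.1.sum_eq_one, l.1.controlled⟩, l.2⟩,
        fun _ => rfl, fun _ => rfl⟩
      (continuous_to_level S.absolute (continuous_coord S m))
      (continuous_to_level S (continuous_coord S.absolute m))).isProperMap⟩
  map_smul _ _ := rfl
  mapsTo := fun _ h => h.elim

instance isIso_ripsAbsolute (hP : P.coarse.LocallyFinite) : IsIso (ripsAbsolute S hP) := by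
  let k : rips S.absolute hP ⟶ (rips S hP).absolute :=
    { toFun := fun l => ⟨l.coords, l.nonneg, l.sum_eq_one, l.controlled⟩
      isProper := fun m => ⟨m, fun _ hl => hl,
        (Homeomorph.mk (X := S.absolute.level m) (Y := S.level m)
          ⟨fun l => ⟨⟨l.1.coords, l.1.nonneg, l.1.sum_eq_one, l.1.controlled⟩, l.2⟩,
            fun l => ⟨⟨l.1.coords, l.1.nonneg, l.1.sum_eq_one, l.1.controlled⟩, l.2⟩,
            fun _ => rfl, fun _ => rfl⟩
          (continuous_to_level S (continuous_coord S.absolute m))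
          (continuous_to_level S.absolute (continuous_coord S m))).isProperMap⟩
      map_smul := fun _ _ => rfl
      mapsTo := fun l hl => (l.isConvexCombination.exists_mem_support).elim fun x hx => hl x hx }
  exact ⟨k, rfl, rfl⟩

theorem incl_comp_ripsAbsolute (hP : P.coarse.LocallyFinite) :
    SigmaPair.incl (rips S hP) ≫ ripsAbsolute S hP =
      ripsSubspace S hP ≫ ripsMap S.restrict S.absolute (hP.restrict P.sub) hP P.incl :=
  SigmaPair.Hom.ext (funext fun l => RipsPoint.ext (mapDomain_val_subtypeDomain l.2).symm)

theorem ripsAbsolute_comp_ripsMap (hP : P.coarse.LocallyFinite) :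
    ripsAbsolute S hP ≫ ripsMap S.absolute S hP hP P.toPair = SigmaPair.toPair (rips S hP) :=
  SigmaPair.Hom.ext (funext fun _ => RipsPoint.ext Finsupp.mapDomain_id)

end

end CoarsePair

/-! ### Functoriality up to homotopy for discretizations. -/

namespace Discretization

variable {Γ : Type v} [Group Γ] {P Q R : CoarsePair.{u} Γ}

theorem Retraction.apply_ι {D : Discretization P} (r : D.Retraction) (x : D.pair.carrier) :
    r.π.toFun (D.ι.toFun x) = x :=
  congrFun (congrArg CoarsePair.Hom.toFun r.π_ι) x

/-- Let `g` be a coarse inverse of `π`. Precomposing `g ∘ π ~ id` with `ι ∘ π` gives `ι ∘ π ~ g ∘ π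
∘ ι ∘ π`; since `π ∘ ι = id`, the right side is `g ∘ π`, which is close to the identity. -/
theorem Retraction.areClose {D : Discretization P} (r : D.Retraction) :
    AreClose P.coarse (D.ι.toFun ∘ r.π.toFun) id := by
  obtain ⟨-, g, hg, h, -⟩ := r.isCoarseEquivalence
  refine (h.symm.comp_right (D.ι.toFun ∘ r.π.toFun)).trans (AreClose.trans ?_ h)
  have : (g ∘ r.π.toFun) ∘ D.ι.toFun ∘ r.π.toFun = g ∘ r.π.toFun :=
    funext fun x => congrArg g (r.apply_ι _)
  change AreClose P.coarse ((g ∘ r.π.toFun) ∘ D.ι.toFun ∘ r.π.toFun) (g ∘ r.π.toFun)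
  rw [this]
  exact CoarseStructure.areClose_refl _ _

theorem Retraction.areClose_sub {D : Discretization P} (r : D.Retraction) :
    AreClose P.subspace.coarse
      ((CoarsePair.subspaceMap D.ι).toFun ∘ (CoarsePair.subspaceMap r.π).toFun) id := by
  refine CoarseStructure.controlled_restrict_iff.2 (P.coarse.subset r.areClose ?_)
  rintro _ ⟨_, ⟨x, rfl⟩, rfl⟩
  exact ⟨x.1, rfl⟩

/-- Inserting the retraction to a discretization into a composition changes it to a close map. -/
theorem Retraction.areClose_comp {D : Discretization P} (r : D.Retraction) {Z : Type*}
    (f : Z → P.carrier) (g : P ⟶ Q) :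
    AreClose Q.coarse (fun z => g.toFun (D.ι.toFun (r.π.toFun (f z)))) (fun z => g.toFun (f z)) :=
  (g.isCoarseMap.controlled.comp_areClose r.areClose).comp_right f

theorem ripsInduced_homotopic (D : Discretization P) (D' : Discretization Q) (r r' : D'.Retraction)
    (f : P ⟶ Q) : SigmaPair.Homotopic (D.ripsInduced D' r f) (D.ripsInduced D' r' f) := by
  refine CoarsePair.homotopic_ripsMap_of_areClose _ _ _ _ ?_
  have := r.areClose_comp (fun x => f.toFun (D.ι.toFun x)) r'.π
  simp only [r'.apply_ι] at this
  exact this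

/-- The composite inserts `ι ∘ π` between `f` and `g`. Since this is close to the identity,
functoriality holds up to homotopy. -/
theorem ripsInduced_comp_homotopic (D : Discretization P) (D' : Discretization Q)
    (D'' : Discretization R) (r : D'.Retraction) (r' : D''.Retraction) (f : P ⟶ Q) (g : Q ⟶ R) :
    SigmaPair.Homotopic (D.ripsInduced D' r f ≫ D'.ripsInduced D'' r' g)
      (D.ripsInduced D'' r' (f ≫ g)) := by
  have h : D.ripsInduced D' r f ≫ D'.ripsInduced D'' r' g = _ :=
    CoarsePair.ripsMap_comp (P := D.pair) (Q := D'.pair) (R := D''.pair) ..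
  rw [h]
  exact CoarsePair.homotopic_ripsMap_of_areClose _ _ _ _
    (r.areClose_comp (fun x => f.toFun (D.ι.toFun x)) (g ≫ r'.π))

theorem ripsInduced_id (D : Discretization P) (r : D.Retraction) :
    D.ripsInduced D r (𝟙 P) = 𝟙 _ := by
  rw [ripsInduced, Category.id_comp, r.π_ι]
  exact CoarsePair.ripsMap_id _ _

/-- This square gives naturality of the coarse connecting homomorphisms. After the common
identification of `𝒫(A')` with a Rips complex, each route is close to the retraction to the
discretization of `B` applied to `f` on `A'`. -/
theorem ripsSubspace_comp_homotopic (D : Discretization P) (Ds : Discretization P.subspace)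
    (rs : Ds.Retraction) (D' : Discretization Q) (r' : D'.Retraction)
    (Ds' : Discretization Q.subspace) (rs' : Ds'.Retraction) (f : P ⟶ Q) :
    SigmaPair.Homotopic
      (D.ripsSubspace Ds rs ≫ Ds.ripsInduced Ds' rs' (CoarsePair.subspaceMap f))
      (SigmaPair.subspaceMap (D.ripsInduced D' r' f) ≫ D'.ripsSubspace Ds' rs') := by
  have h : D.ripsSubspace Ds rs ≫ Ds.ripsInduced Ds' rs' (CoarsePair.subspaceMap f) = _ :=
    (Category.assoc _ _ _).trans (congrArg (_ ≫ ·)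
      (CoarsePair.ripsMap_comp (P := D.pair.subspace) (Q := Ds.pair) (R := Ds'.pair) ..))
  have h' : SigmaPair.subspaceMap (D.ripsInduced D' r' f) ≫ D'.ripsSubspace Ds' rs' = _ :=
    (Category.assoc _ _ _).symm.trans ((congrArg (· ≫ _)
      (CoarsePair.subspaceMap_ripsMap_comp_ripsSubspace (P := D.pair) (Q := D'.pair) ..)).trans
      ((Category.assoc _ _ _).trans (congrArg (_ ≫ ·)
        (CoarsePair.ripsMap_comp (P := D.pair.subspace) (Q := D'.pair.subspace)
          (R := Ds'.pair) ..))))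
  rw [h, h']
  refine SigmaPair.Homotopic.precomp (CoarsePair.homotopic_ripsMap_of_areClose _ _ _ _
    (AreClose.trans (g := fun x => rs'.π.toFun ((CoarsePair.subspaceMap f).toFun
      ((CoarsePair.subspaceMap D.ι).toFun x))) ?_ (AreClose.symm ?_))) _
  · exact rs.areClose_comp (CoarsePair.subspaceMap D.ι).toFun (CoarsePair.subspaceMap f ≫ rs'.π)
  · exact (rs'.π.isCoarseMap.controlled.comp_areClose r'.areClose_sub).comp_right
      (fun x => (CoarsePair.subspaceMap f).toFun ((CoarsePair.subspaceMap D.ι).toFun x))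

/-- The inverse includes the discretization of `A` into `A` and retracts it to `A'` by the
retraction belonging to `X'`. Both composites are close to identities because retractions are. -/
theorem isHomotopyEquivalence_ripsSubspace (D : Discretization P) (r : D.Retraction)
    (Ds : Discretization P.subspace) (rs : Ds.Retraction) :
    SigmaPair.IsHomotopyEquivalence (CoarsePair.ripsMap (P := D.pair.subspace) (Q := Ds.pair)
      (CoarsePair.GeneratingSequence.restrict D.gen) Ds.gen (D.locallyFinite.restrict _)
      Ds.locallyFinite (CoarsePair.subspaceMap D.ι ≫ rs.π)) := by
  refine CoarsePair.isHomotopyEquivalence_ripsMap _ _ _ _ _ (Ds.ι ≫ CoarsePair.subspaceMap r.π) ?_ ?_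
  · have := rs.areClose_comp (CoarsePair.subspaceMap D.ι).toFun (CoarsePair.subspaceMap r.π)
    refine this.trans ?_
    have h : (fun z => (CoarsePair.subspaceMap r.π).toFun ((CoarsePair.subspaceMap D.ι).toFun z)) =
      id := funext fun z => Subtype.ext (r.apply_ι z.1)
    rw [h]
    exact CoarseStructure.areClose_refl _ _
  · have := (rs.π.isCoarseMap.controlled.comp_areClose r.areClose_sub).comp_right Ds.ι.toFun
    refine this.trans ?_
    have h : (rs.π.toFun ∘ id) ∘ Ds.ι.toFun = id := funext fun z => rs.apply_ι z
    rw [h]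
    exact CoarseStructure.areClose_refl _ _

/-- For discretizations `X'` of `(X, A)` and `X''` of `(X, ∅)`, the morphism `𝒫(X') → 𝒫(X'')`. -/
noncomputable def ripsAbsolute (D : Discretization P) (D₀ : Discretization P.absolute)
    (r₀ : D₀.Retraction) : D.rips.absolute ⟶ D₀.rips :=
  CoarsePair.ripsAbsolute (P := D.pair) D.gen D.locallyFinite ≫
    CoarsePair.ripsMap (P := D.pair.absolute) (Q := D₀.pair) (CoarsePair.GeneratingSequence.absolute D.gen)
      D₀.gen D.locallyFinite D₀.locallyFinite (CoarsePair.absoluteMap D.ι ≫ r₀.π)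

theorem isHomotopyEquivalence_ripsAbsolute (D : Discretization P) (r : D.Retraction)
    (D₀ : Discretization P.absolute) (r₀ : D₀.Retraction) :
    SigmaPair.IsHomotopyEquivalence (CoarsePair.ripsMap (P := D.pair.absolute) (Q := D₀.pair)
      (CoarsePair.GeneratingSequence.absolute D.gen) D₀.gen D.locallyFinite
      D₀.locallyFinite (CoarsePair.absoluteMap D.ι ≫ r₀.π)) := by
  refine CoarsePair.isHomotopyEquivalence_ripsMap _ _ _ _ _ (D₀.ι ≫ CoarsePair.absoluteMap r.π) ?_ ?_
  · have := r₀.areClose_comp (CoarsePair.absoluteMap D.ι).toFun (CoarsePair.absoluteMap r.π)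
    refine this.trans ?_
    have h : (fun z => (CoarsePair.absoluteMap r.π).toFun ((CoarsePair.absoluteMap D.ι).toFun z)) =
      id := funext fun z => r.apply_ι z
    rw [h]
    exact CoarseStructure.areClose_refl _ _
  · have := (r₀.π.isCoarseMap.controlled.comp_areClose (𝓔 := P.absolute.coarse)
      r.areClose).comp_right D₀.ι.toFun
    refine this.trans ?_
    refine D₀.pair.coarse.subset D₀.pair.coarse.diag ?_
    rintro _ ⟨z, rfl⟩
    exact r₀.apply_ι z

/-- Together with `ripsAbsolute_comp_homotopic`, this provides the squares of the ladder from the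
exact sequence of `(𝒫(X'), 𝒫(A'))` to the coarse one, in which the three spaces are discretized
independently. -/
theorem incl_comp_ripsAbsolute_homotopic (D : Discretization P) (Ds : Discretization P.subspace)
    (rs : Ds.Retraction) (D₀ : Discretization P.absolute) (r₀ : D₀.Retraction) :
    SigmaPair.Homotopic (D.ripsSubspace Ds rs ≫ Ds.ripsInduced D₀ r₀ P.incl)
      (SigmaPair.incl D.rips ≫ D.ripsAbsolute D₀ r₀) := by
  have h : D.ripsSubspace Ds rs ≫ Ds.ripsInduced D₀ r₀ P.incl = _ :=
    (Category.assoc _ _ _).trans (congrArg (_ ≫ ·)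
      (CoarsePair.ripsMap_comp (P := D.pair.subspace) (Q := Ds.pair) (R := D₀.pair) ..))
  have h' : SigmaPair.incl D.rips ≫ D.ripsAbsolute D₀ r₀ = _ :=
    (Category.assoc _ _ _).symm.trans ((congrArg (· ≫ _)
      (CoarsePair.incl_comp_ripsAbsolute (P := D.pair) ..)).trans
      ((Category.assoc _ _ _).trans (congrArg (_ ≫ ·)
        (CoarsePair.ripsMap_comp (P := D.pair.subspace) (Q := D.pair.absolute)
          (R := D₀.pair) ..))))
  rw [h, h']
  exact SigmaPair.Homotopic.precomp (CoarsePair.homotopic_ripsMap_of_areClose _ _ _ _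
    (rs.areClose_comp (CoarsePair.subspaceMap D.ι).toFun (P.incl ≫ r₀.π))) _

theorem ripsAbsolute_comp_homotopic (D : Discretization P) (r : D.Retraction)
    (D₀ : Discretization P.absolute) (r₀ : D₀.Retraction) :
    SigmaPair.Homotopic (D.ripsAbsolute D₀ r₀ ≫ D₀.ripsInduced D r P.toPair)
      (SigmaPair.toPair D.rips) := by
  have h : D.ripsAbsolute D₀ r₀ ≫ D₀.ripsInduced D r P.toPair = _ :=
    (Category.assoc _ _ _).trans (congrArg (_ ≫ ·)
      (CoarsePair.ripsMap_comp (P := D.pair.absolute) (Q := D₀.pair) (R := D.pair) ..))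
  have h' : SigmaPair.toPair D.rips = _ :=
    (CoarsePair.ripsAbsolute_comp_ripsMap (P := D.pair) D.gen D.locallyFinite).symm
  rw [h, h']
  refine SigmaPair.Homotopic.precomp (CoarsePair.homotopic_ripsMap_of_areClose _ _ _ _ ?_) _
  refine (r₀.areClose_comp (CoarsePair.absoluteMap D.ι).toFun (P.toPair ≫ r.π)).trans ?_
  have h : (fun z => (P.toPair ≫ r.π).toFun ((CoarsePair.absoluteMap D.ι).toFun z)) = id :=
    funext fun z => r.apply_ι z
  rw [h]
  exact CoarseStructure.areClose_refl _ _

end Discretization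

/-! ### Homotopy invariance and the strong homotopy axiom. -/

namespace CoarseStructure

variable {X : Type u} {Y : Type v}

theorem isControlledMap_generate {S : Set (SetRel X X)} {𝓕 : CoarseStructure Y} {f : X → Y}
    (h : ∀ E ∈ S, 𝓕.Controlled (Prod.map f f '' E)) : IsControlledMap (generate S) 𝓕 f := by
  intro E hE
  replace hE : GenerateControlled S E := hE
  induction hE with
  | basic E hE => exact h E hE
  | diag =>
    refine 𝓕.subset 𝓕.diag ?_
    rintro _ ⟨⟨x, y⟩, (rfl : x = y), rfl⟩
    exact rfl
  | subset E E' _ h ih => exact 𝓕.subset ih (Set.image_mono h)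
  | inv E _ ih =>
    refine 𝓕.subset (𝓕.inv ih) ?_
    rintro _ ⟨⟨x, y⟩, hp, rfl⟩
    exact ⟨(y, x), hp, rfl⟩
  | comp E F _ _ ih ih' =>
    refine 𝓕.subset (𝓕.comp ih ih') ?_
    rintro _ ⟨⟨x, z⟩, ⟨y, h1, h2⟩, rfl⟩
    exact ⟨f y, ⟨(x, y), h1, rfl⟩, ⟨(y, z), h2, rfl⟩⟩
  | union E F _ _ ih ih' =>
    rw [Set.image_union]
    exact 𝓕.union ih ih'

theorem Precompact.image {𝓔 : CoarseStructure X} {𝓕 : CoarseStructure Y} {f : X → Y}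
    (hf : IsControlledMap 𝓔 𝓕 f) {K : Set X} (hK : 𝓔.Precompact K) : 𝓕.Precompact (f '' K) := by
  obtain ⟨F, hF, hb, rfl⟩ := hK
  refine ⟨Set.image f '' F, hF.image _, ?_, Set.image_sUnion⟩
  rintro _ ⟨L, hL, rfl⟩
  obtain ⟨E, hE, y, hy⟩ := hb L hL
  refine ⟨_, hf E hE, f y, ?_⟩
  rintro _ ⟨x, hx, rfl⟩
  obtain ⟨_, rfl, h⟩ := hy hx
  exact ⟨_, rfl, _, h, rfl⟩

theorem isControlledMap_fst_prod (𝓔 : CoarseStructure X) (𝓕 : CoarseStructure Y) :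
    IsControlledMap (𝓔.prod 𝓕) 𝓔 Prod.fst := by
  refine isControlledMap_generate ?_
  rintro _ ⟨E, F, hE, -, rfl⟩
  refine 𝓔.subset hE ?_
  rintro _ ⟨p, hp, rfl⟩
  exact hp.1

theorem isControlledMap_fst_cylinder (𝓔 : CoarseStructure X) {a b : ℝ}
    (U : X → Set (Set.Icc a b × Set.Icc a b)) : IsControlledMap (𝓔.cylinder U) 𝓔 Prod.fst := by
  refine isControlledMap_generate ?_
  rintro _ (⟨E, hE, rfl⟩ | rfl)
  · refine 𝓔.subset hE ?_
    rintro _ ⟨p, hp, rfl⟩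
    exact hp.1
  · refine 𝓔.subset 𝓔.diag ?_
    rintro _ ⟨p, hp, rfl⟩
    exact hp.1

end CoarseStructure

namespace Discretization

variable {Γ : Type v} [Group Γ] {P Q R : CoarsePair.{u} Γ}

/-- The points of a discretization in a precompact set. -/
theorem finite_preimage_ι (D : Discretization P) {K : Set P.carrier} (hK : P.coarse.Precompact K) :
    (D.ι.toFun ⁻¹' K).Finite :=
  D.locallyFinite.finite_of_precompact hK.to_restrict

/-- An equivariant family of paths in `Y` parametrized by `X` yields a homotopy between Rips
complexes of discretizations. -/
theorem ripsInduced_homotopic_of_family (D : Discretization P) (D' : Discretization Q)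
    (r : D'.Retraction) {f g : P ⟶ Q} (H : P.carrier → unitInterval → Q.carrier)
    (hΓ : ∀ (γ : Γ) x t, H (γ • x) t = γ • H x t)
    (hsub : ∀ x ∈ P.sub, ∀ t, H x t ∈ Q.sub)
    (h0 : ∀ x, H x 0 = f.toFun x) (h1 : ∀ x, H x 1 = g.toFun x)
    (hhor : ∀ E, P.coarse.Controlled E → ∃ F, Q.coarse.Controlled F ∧
      ∀ x y t, (x, y) ∈ E → (H x t, H y t) ∈ F)
    (hvert : ∃ F, Q.coarse.Controlled F ∧
      ∀ x, {p | (H x p.1, H x p.2) ∈ F} ∈ 𝓝ˢ (Set.diagonal unitInterval))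
    (hproper : ∀ B, Q.coarse.Bounded B → P.coarse.Precompact {x | ∃ t, H x t ∈ B}) :
    SigmaPair.Homotopic (D.ripsInduced D' r f) (D.ripsInduced D' r g) := by
  refine CoarsePair.homotopic_ripsMap (P := D.pair) (Q := D'.pair) _ _ _ _
    (fun x t => r.π.toFun (H (D.ι.toFun x) t)) ?_ ?_ ?_ ?_ ?_ ?_ ?_
  · intro γ x t
    rw [D.ι.map_smul, hΓ, r.π.map_smul]
  · exact fun x hx t => r.π.mapsTo (hsub _ hx t)
  · exact fun x => congrArg r.π.toFun (h0 _)
  · exact fun x => congrArg r.π.toFun (h1 _)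
  · intro E hE
    obtain ⟨F, hF, hEF⟩ := hhor _ (D.ι.isCoarseMap.controlled E hE)
    exact ⟨_, r.π.isCoarseMap.controlled F hF,
      fun x y t hxy => ⟨(_, _), hEF _ _ t ⟨_, hxy, rfl⟩, rfl⟩⟩
  · obtain ⟨F, hF, h⟩ := hvert
    refine ⟨_, r.π.isCoarseMap.controlled F hF, fun x => ?_⟩
    filter_upwards [h (D.ι.toFun x)] with p hp
    exact ⟨_, hp, rfl⟩
  · intro y
    -- The preimage of a vertex under the retraction is a finite union of bounded sets. For each of
    -- them the paths meeting it start over a precompact set, which contains finitely many points of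
    -- the discretization.
    obtain ⟨F, hF, hb, hu⟩ := r.π.isCoarseMap.proper {y}
      ⟨_, D'.pair.coarse.diag, y, fun z hz => ⟨y, rfl, hz⟩⟩
    refine (hF.biUnion fun L hL => D.finite_preimage_ι (hproper L (hb L hL))).subset ?_
    rintro x ⟨t, ht⟩
    have : H (D.ι.toFun x) t ∈ ⋃₀ F := hu ▸ ht
    obtain ⟨L, hL, hx⟩ := this
    exact Set.mem_biUnion hL ⟨t, hx⟩

/-- The sets `U x` yield vertical control of exactly the pointwise kind that
`ripsInduced_homotopic_of_family` accepts; no width uniform in `x` is needed. It remains to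
reparametrize `[a, b]` affinely by the unit interval. -/
theorem ripsInduced_homotopic_of_generalizedCoarselyHomotopic (D : Discretization P)
    (D' : Discretization Q) (r : D'.Retraction) {f g : P ⟶ Q}
    (h : CoarsePair.GeneralizedCoarselyHomotopic f g) :
    SigmaPair.Homotopic (D.ripsInduced D' r f) (D.ripsInduced D' r g) := by
  obtain ⟨a, b, hab, U, H, hU, -, hH, hΓ, hsub, h0, h1⟩ := h
  have hmem : ∀ t : unitInterval, a + t * (b - a) ∈ Set.Icc a b := fun t =>
    ⟨by nlinarith [t.2.1], by nlinarith [t.2.2]⟩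
  let φ : unitInterval → Set.Icc a b := fun t => ⟨a + t * (b - a), hmem t⟩
  have hφ : Continuous φ := Continuous.subtype_mk (by fun_prop) _
  refine D.ripsInduced_homotopic_of_family D' r (fun x t => H (x, φ t)) (fun γ x t => hΓ γ x _)
    (fun x hx t => hsub x hx _) (fun x => ?_) (fun x => ?_) (fun E hE => ?_) ?_ (fun B hB => ?_)
  · rw [← h0]
    exact congrArg (fun s => H (x, s)) (Subtype.ext (by simp [φ]))
  · rw [← h1]
    exact congrArg (fun s => H (x, s)) (Subtype.ext (by simp [φ]))
  · exact ⟨_, hH.controlled _ (.basic _ (Or.inl ⟨E, hE, rfl⟩)),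
      fun x y t hxy => ⟨((x, φ t), (y, φ t)), ⟨hxy, rfl⟩, rfl⟩⟩
  · refine ⟨_, hH.controlled _ (.basic _ (Or.inr rfl)), fun x => ?_⟩
    have ht : Filter.Tendsto (Prod.map φ φ) (𝓝ˢ (Set.diagonal unitInterval))
        (𝓝ˢ (Set.diagonal (Set.Icc a b))) := by
      refine (hφ.prodMap hφ).tendsto_nhdsSet ?_
      rintro ⟨s, t⟩ (rfl : s = t)
      exact rfl
    filter_upwards [ht (hU x)] with p hp
    exact ⟨((x, φ p.1), (x, φ p.2)), ⟨rfl, hp⟩, rfl⟩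
  · refine (CoarseStructure.Precompact.image (CoarseStructure.isControlledMap_fst_cylinder _ U)
      (hH.proper B hB)).mono ?_
    rintro x ⟨t, ht⟩
    exact ⟨(x, φ t), ht, rfl⟩

/-- The line is compressed to the open unit interval, and `f` and `g` are put at the two ends. Over
a fixed `x` the homotopy is eventually constant in both directions, so nothing happens near the
ends, while in the interior consecutive integers give uniformly close values. -/
theorem ripsInduced_homotopic_of_coarselyHomotopic (D : Discretization P)
    (D' : Discretization Q) (r : D'.Retraction) {f g : P ⟶ Q}
    (h : CoarsePair.CoarselyHomotopic f g) :
    SigmaPair.Homotopic (D.ripsInduced D' r f) (D.ripsInduced D' r g) := by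
  classical
  obtain ⟨H, ρm, ρp, hΓ, hsub, -, -, hm, hp, hctrl, hcoarse⟩ := h
  -- This function tends to `-∞` at `0` and to `+∞` at `1`; its floor serves as the integer time.
  let u : unitInterval → ℝ := fun t => 1 / (1 - (t : ℝ)) - 1 / (t : ℝ)
  let K : P.carrier → unitInterval → Q.carrier := fun x t =>
    if t = 0 then f.toFun x else if t = 1 then g.toFun x else H (x, ⌊u t⌋)
  have hK0 : ∀ x, K x 0 = f.toFun x := fun x => if_pos rfl
  have hK1 : ∀ x, K x 1 = g.toFun x := fun x => by simp [K]
  have hK : ∀ x t, t ≠ 0 → t ≠ 1 → K x t = H (x, ⌊u t⌋) := fun x t h h' => by simp [K, h, h']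
  -- A single entourage for all `x`: values of `H` at the same point and at integer times differing
  -- by at most `1`.
  have hvb : Q.coarse.Controlled _ := hctrl _ (.basic _ ⟨SetRel.id, {p | |p.1 - p.2| ≤ 1},
    P.coarse.diag, ⟨1, fun p hp => hp⟩, rfl⟩)
  refine D.ripsInduced_homotopic_of_family D' r K ?_ ?_ hK0 hK1 ?_ ⟨_, hvb, ?_⟩ ?_
  · intro γ x t
    simp only [K]
    split_ifs
    exacts [f.map_smul γ x, g.map_smul γ x, hΓ γ x _]
  · intro x hx t
    simp only [K]
    split_ifs
    exacts [f.mapsTo hx, g.mapsTo hx, hsub x hx _]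
  · intro E hE
    refine ⟨_, Q.coarse.union (f.isCoarseMap.controlled E hE) (Q.coarse.union
      (g.isCoarseMap.controlled E hE) (hctrl _ (.basic _ ⟨E, SetRel.id, hE,
        CoarseStructure.int.diag, rfl⟩))), fun x y t hxy => ?_⟩
    simp only [K]
    split_ifs
    · exact Or.inl ⟨_, hxy, rfl⟩
    · exact Or.inr (Or.inl ⟨_, hxy, rfl⟩)
    · exact Or.inr (Or.inr ⟨((x, _), (y, _)), ⟨hxy, rfl⟩, rfl⟩)
  · intro x
    have hrefl : ∀ y : P.carrier, ∀ n : ℤ, (H (y, n), H (y, n)) ∈ Prod.map H H ''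
        {p : (P.carrier × ℤ) × P.carrier × ℤ | (p.1.1, p.2.1) ∈ (SetRel.id : SetRel _ _) ∧
          (p.1.2, p.2.2) ∈ {p : ℤ × ℤ | |p.1 - p.2| ≤ 1}} := fun y n =>
      ⟨((y, n), (y, n)), ⟨rfl, by simp⟩, rfl⟩
    rw [mem_nhdsSet_iff_forall]
    rintro ⟨t₀, t⟩ (rfl : t₀ = t)
    rw [nhds_prod_eq]
    rcases eq_or_ne t₀ 0 with rfl | h0
    · -- near `0` the path is constant
      have hev : ∀ᶠ t : unitInterval in 𝓝 0, K x t = f.toFun x := by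
        -- For such `t` one has `1 / t > |ρm x| + 2` and, as `t < 1/2`, also `1 / (1 - t) ≤ 2`.
        -- Hence `u t < -|ρm x| ≤ ρm x`, and the homotopy has already reached `f`.
        have hε : (0 : ℝ) < 1 / (|(ρm x : ℝ)| + 2) := by positivity
        have : ∀ᶠ t : unitInterval in 𝓝 0, (t : ℝ) < 1 / (|(ρm x : ℝ)| + 2) :=
          continuous_subtype_val.continuousAt.eventually_lt continuousAt_const hε
        filter_upwards [this] with t ht
        rcases eq_or_ne t 0 with rfl | h
        · exact hK0 x
        have ht0 : (0 : ℝ) < t := lt_of_le_of_ne t.2.1 fun h' => h (Subtype.ext h'.symm)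
        have h2 : (1 : ℝ) / (|(ρm x : ℝ)| + 2) ≤ 1 / 2 :=
          one_div_le_one_div_of_le (by norm_num) (by linarith [abs_nonneg (ρm x : ℝ)])
        have h1 : t ≠ 1 := by
          rintro rfl
          rw [Set.Icc.coe_one] at ht
          linarith
        rw [hK x t h h1]
        refine hm x _ (Int.floor_le_iff.2 ?_)
        have h3 : |(ρm x : ℝ)| + 2 < 1 / t := by
          rwa [lt_one_div (by positivity) ht0]
        have h4 : 1 / (1 - (t : ℝ)) ≤ 2 := by
          rw [div_le_iff₀ (by linarith)]
          linarith
        have := neg_abs_le (ρm x : ℝ)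
        simp only [u]
        linarith
      filter_upwards [hev.prod_mk hev] with p hp
      rw [hp.1, hp.2, ← hm x (ρm x) le_rfl]
      exact hrefl _ _
    rcases eq_or_ne t₀ 1 with rfl | h1
    · have hev : ∀ᶠ t : unitInterval in 𝓝 1, K x t = g.toFun x := by
        have hε : (1 : ℝ) - 1 / (|(ρp x : ℝ)| + 2) < (1 : unitInterval) := by
          rw [Set.Icc.coe_one, sub_lt_self_iff]
          positivity
        have : ∀ᶠ t : unitInterval in 𝓝 1, 1 - 1 / (|(ρp x : ℝ)| + 2) < (t : ℝ) :=
          continuousAt_const.eventually_lt continuous_subtype_val.continuousAt hε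
        filter_upwards [this] with t ht
        rcases eq_or_ne t 1 with rfl | h
        · exact hK1 x
        have ht1 : (t : ℝ) < 1 := lt_of_le_of_ne t.2.2 fun h' => h (Subtype.ext h')
        have h2 : (1 : ℝ) / (|(ρp x : ℝ)| + 2) ≤ 1 / 2 :=
          one_div_le_one_div_of_le (by norm_num) (by linarith [abs_nonneg (ρp x : ℝ)])
        have h0' : t ≠ 0 := by
          rintro rfl
          rw [Set.Icc.coe_zero] at ht
          linarith
        rw [hK x t h0' h]
        refine hp x _ (Int.le_floor.2 ?_)
        have h3 : |(ρp x : ℝ)| + 2 < 1 / (1 - (t : ℝ)) := by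
          rw [lt_one_div (by positivity) (by linarith)]
          linarith
        have h4 : 1 / (t : ℝ) ≤ 2 := by
          rw [div_le_iff₀ (by linarith)]
          linarith
        have := le_abs_self (ρp x : ℝ)
        simp only [u]
        linarith
      filter_upwards [hev.prod_mk hev] with p hp'
      rw [hp'.1, hp'.2, ← hp x (ρp x) le_rfl]
      exact hrefl _ _
    · have hev : ∀ᶠ t : unitInterval in 𝓝 t₀, K x t = H (x, ⌊u t⌋) := by
        filter_upwards [isOpen_ne.mem_nhds h0, isOpen_ne.mem_nhds h1] with t h h'
        exact hK x t h h'
      have hut : ContinuousAt u t₀ := by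
        have h0' : (t₀ : ℝ) ≠ 0 := fun h => h0 (Subtype.ext h)
        have h1' : 1 - (t₀ : ℝ) ≠ 0 := fun h => h1 (Subtype.ext (by
          rw [Set.Icc.coe_one]; linarith))
        exact (continuousAt_const.div
          (continuous_const.sub continuous_subtype_val).continuousAt h1').sub
          (continuousAt_const.div continuous_subtype_val.continuousAt h0')
      -- Two times near `t₀` then have `u`-values less than `1` apart, so their floors differ by at
      -- most `1`, even across an integer.
      have hev' : ∀ᶠ t : unitInterval in 𝓝 t₀, |u t - u t₀| < 1 / 2 :=
        Metric.continuousAt_iff'.1 hut (1 / 2) (by norm_num)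
      filter_upwards [(hev.and hev').prod_mk (hev.and hev')] with p hp'
      rw [hp'.1.1, hp'.2.1]
      refine ⟨((x, ⌊u p.1⌋), (x, ⌊u p.2⌋)), ⟨rfl, ?_⟩, rfl⟩
      have h3 : |u p.1 - u p.2| < 1 := by
        have := hp'.1.2
        have := hp'.2.2
        rw [abs_lt] at *
        constructor <;> linarith
      have h4 := abs_lt.1 h3
      have h5 := Int.floor_le (u p.1)
      have h6 := Int.lt_floor_add_one (u p.1)
      have h7 := Int.floor_le (u p.2)
      have h8 := Int.lt_floor_add_one (u p.2)
      change |⌊u p.1⌋ - ⌊u p.2⌋| ≤ 1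
      have h9 : ((⌊u p.1⌋ - ⌊u p.2⌋ : ℤ) : ℝ) < 2 := by push_cast; linarith
      have h10 : (-2 : ℝ) < ((⌊u p.1⌋ - ⌊u p.2⌋ : ℤ) : ℝ) := by push_cast; linarith
      have h11 : ⌊u p.1⌋ - ⌊u p.2⌋ < 2 := by exact_mod_cast h9
      have h12 : -2 < ⌊u p.1⌋ - ⌊u p.2⌋ := by exact_mod_cast h10
      rw [abs_le]
      constructor <;> omega
  · intro B hB
    -- Properness is assembled from three pieces: before `ρm` the path is at `f`, after `ρp` at `g`,
    -- and in between `H` is proper, so that the relevant part of the product projects to a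
    -- precompact set.
    have h3 := CoarseStructure.Precompact.image (CoarseStructure.isControlledMap_fst_prod P.coarse
      CoarseStructure.int) (CoarseStructure.Precompact.image
        (CoarseStructure.isCoarseMap_val _ _).controlled (hcoarse.proper B hB))
    obtain ⟨F₁, hF₁, hb₁, hu₁⟩ := f.isCoarseMap.proper B hB
    obtain ⟨F₂, hF₂, hb₂, hu₂⟩ := g.isCoarseMap.proper B hB
    obtain ⟨F₃, hF₃, hb₃, hu₃⟩ := h3
    have hunion : P.coarse.Precompact (⋃₀ (F₁ ∪ F₂ ∪ F₃)) :=
      ⟨_, (hF₁.union hF₂).union hF₃, by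
        rintro L ((hL | hL) | hL)
        exacts [hb₁ L hL, hb₂ L hL, hb₃ L hL], rfl⟩
    refine hunion.mono ?_
    rintro x ⟨t, ht⟩
    rw [Set.sUnion_union, Set.sUnion_union, ← hu₁, ← hu₂, ← hu₃]
    simp only [K] at ht
    split_ifs at ht
    · exact Or.inl (Or.inl ht)
    · exact Or.inl (Or.inr ht)
    · by_cases h1 : ⌊u t⌋ ≤ ρm x
      · rw [hm x _ h1] at ht
        exact Or.inl (Or.inl ht)
      by_cases h2 : ρp x ≤ ⌊u t⌋
      · rw [hp x _ h2] at ht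
        exact Or.inl (Or.inr ht)
      · exact Or.inr ⟨_, ⟨⟨(x, ⌊u t⌋), (not_le.1 h1).le, (not_le.1 h2).le⟩, ht, rfl⟩, rfl⟩

end Discretization

/-! ### Weights, cutoffs and affine homotopies for the excision argument. -/

section Weight

variable {X Y : Type*}

/-- The total weight of a formal linear combination on a set of points. -/
noncomputable def weight (A : Set X) (l : X →₀ ℝ) : ℝ :=
  Finsupp.linearCombination ℝ (A.indicator fun _ => (1 : ℝ)) l

theorem indicator_one_nonneg (A : Set X) (x : X) : 0 ≤ A.indicator (fun _ => (1 : ℝ)) x :=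
  Set.indicator_nonneg (fun _ _ => zero_le_one) x

theorem weight_add_smul (A : Set X) (a b : X →₀ ℝ) (s t : ℝ) :
    weight A (s • a + t • b) = s * weight A a + t * weight A b := by
  simp [weight]

theorem weight_mapDomain (A : Set Y) (f : X → Y) (l : X →₀ ℝ) :
    weight A (Finsupp.mapDomain f l) = weight (f ⁻¹' A) l := by
  rw [weight, Finsupp.linearCombination_mapDomain]
  rfl

theorem IsConvexCombination.weight_nonneg {l : X →₀ ℝ} (hl : IsConvexCombination l) (A : Set X) :
    0 ≤ weight A l :=
  linearCombination_nonneg hl.nonneg fun x _ => indicator_one_nonneg A x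

theorem IsConvexCombination.weight_mono {l : X →₀ ℝ} (hl : IsConvexCombination l) {A B : Set X}
    (h : A ⊆ B) : weight A l ≤ weight B l :=
  linearCombination_mono hl.nonneg fun x _ =>
    Set.indicator_le_indicator_of_subset h (fun _ => zero_le_one) x

theorem IsConvexCombination.weight_le_one {l : X →₀ ℝ} (hl : IsConvexCombination l) (A : Set X) :
    weight A l ≤ 1 := by
  rw [← hl.total]
  exact linearCombination_mono hl.nonneg fun x _ => Set.indicator_le_self' (fun _ _ => zero_le_one) x

theorem IsConvexCombination.weight_eq_one {l : X →₀ ℝ} (hl : IsConvexCombination l) {A : Set X}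
    (h : ∀ x ∈ l.support, x ∈ A) : weight A l = 1 := by
  rw [← hl.total]
  exact linearCombination_congr fun x hx => Set.indicator_of_mem (h x hx) _

theorem exists_of_weight_ne_zero {l : X →₀ ℝ} {A : Set X} (h : weight A l ≠ 0) :
    ∃ x ∈ l.support, x ∈ A := by
  obtain ⟨x, hx, h⟩ := exists_of_linearCombination_ne_zero h
  exact ⟨x, hx, Set.mem_of_indicator_ne_zero h⟩

theorem IsConvexCombination.weight_compl {l : X →₀ ℝ} (hl : IsConvexCombination l) (A : Set X) :
    weight A l = 1 - weight Aᶜ l := by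
  rw [eq_sub_iff_add_eq, ← hl.total, weight, weight]
  simp only [Finsupp.linearCombination_apply]
  rw [← Finsupp.sum_add]
  refine Finsupp.sum_congr fun x _ => ?_
  by_cases hx : x ∈ A <;> simp [hx]

/-- A cutoff function: `s / max s (1/4)` vanishes exactly for `s = 0` and equals `1` for
`s ≥ 1/4`. -/
noncomputable def cutoff (s : ℝ) : ℝ := s * (max s (1 / 4))⁻¹

theorem continuous_inv_max : Continuous fun s : ℝ => (max s (1 / 4))⁻¹ :=
  (continuous_id.max continuous_const).inv₀ fun s =>
    (lt_max_of_lt_right (by norm_num : (0 : ℝ) < 1 / 4)).ne'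

theorem continuous_cutoff : Continuous cutoff := continuous_id.mul continuous_inv_max

theorem inv_max_pos (s : ℝ) : 0 < (max s (1 / 4))⁻¹ :=
  inv_pos.2 (lt_max_of_lt_right (by norm_num))

theorem cutoff_nonneg {s : ℝ} (hs : 0 ≤ s) : 0 ≤ cutoff s := mul_nonneg hs (inv_max_pos s).le

theorem cutoff_le_one (s : ℝ) : cutoff s ≤ 1 := by
  rw [cutoff, ← div_eq_mul_inv, div_le_one (lt_max_of_lt_right (by norm_num))]
  exact le_max_left _ _

theorem cutoff_eq_one {s : ℝ} (hs : 1 / 4 ≤ s) : cutoff s = 1 := by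
  rw [cutoff, max_eq_left hs, mul_inv_cancel₀ (by linarith)]

theorem cutoff_ne_zero {s : ℝ} (hs : cutoff s ≠ 0) : s ≠ 0 := by
  rintro rfl
  exact hs (zero_mul _)

end Weight

namespace CoarsePair

variable {Γ : Type v} [Group Γ] {P Q : CoarsePair.{u} Γ}

theorem smul_mem_sub_iff (P : CoarsePair.{u} Γ) (γ : Γ) (x : P.carrier) :
    γ • x ∈ P.sub ↔ x ∈ P.sub :=
  ⟨fun h => by simpa using P.smul_mem_sub γ⁻¹ _ h, P.smul_mem_sub γ x⟩

theorem weight_coords_smul {A : Set P.carrier} (hA : ∀ (γ : Γ) x, γ • x ∈ A ↔ x ∈ A) (γ : Γ)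
    (l : P.RipsPoint) : weight A (γ • l).coords = weight A l.coords := by
  rw [RipsPoint.coords_smul, weight_mapDomain]
  congr 1
  exact Set.ext fun x => hA γ x

end CoarsePair

namespace SigmaPair

variable {Γ : Type v} [Group Γ] {P Q : CoarsePair.{u} Γ} {S : P.GeneratingSequence}
  {T : Q.GeneratingSequence} {W V : SigmaPair.{u} Γ}

theorem isClosed_finalTopology {X : SigmaPair.{u} Γ} {B : Set X.carrier}
    (hB : ∀ n, IsClosed {x : X.filt n | x.1 ∈ B}) : IsClosed[X.finalTopology] B :=
  isClosed_iSup_iff.2 fun n => isClosed_coinduced.2 (hB n)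

/-- The inclusion of `(X ∖ U, N ∖ U)` into `(X, N)` is an excision if the closure of `U` is contained
in the interior of `N`. -/
theorem isExcision_of_closed {X : SigmaPair.{u} Γ} {A N C O : Set X.carrier}
    (hA : ∀ n, IsClosed {x : X.filt n | x.1 ∈ A}) (hAΓ : ∀ (γ : Γ), ∀ x ∈ A, γ • x ∈ A)
    (hN : ∀ n, IsClosed {x : X.filt n | x.1 ∈ N}) (hNΓ : ∀ (γ : Γ), ∀ x ∈ N, γ • x ∈ N)
    (hC : ∀ n, IsClosed {x : X.filt n | x.1 ∈ C}) (hO : ∀ n, IsClosed {x : X.filt n | x.1 ∈ Oᶜ})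
    (hAC : Aᶜ ⊆ C) (hCO : C ⊆ O) (hON : O ⊆ N)
    (k : (X.withSub A hA hAΓ).subspace.withSub (Subtype.val ⁻¹' N)
      (fun n => (hN n).preimage ((X.withSub A hA hAΓ).isClosedEmbedding_subToFilt n).continuous)
      (fun γ x hx => hNΓ γ x.1 hx) ⟶ X.withSub N hN hNΓ)
    (hk : ∀ x, k.toFun x = x.1) : IsExcision k := by
  have hk' : k.toFun = Subtype.val := funext hk
  have hmaps : ∀ n, Set.MapsTo k.toFun (Subtype.val ⁻¹' X.filt n) (X.filt n) := fun n x hx => by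
    rw [hk']
    exact hx
  refine ⟨?_, fun n => ⟨hmaps n, ?_⟩, fun n => ?_, ?_, ?_⟩
  · rw [hk']
    exact Subtype.val_injective
  · have h : Set.MapsTo.restrict k.toFun _ _ (hmaps n) = (X.withSub A hA hAΓ).subToFilt n :=
      funext fun x => Subtype.ext (hk x.1)
    exact Eq.mpr (congrArg IsClosedEmbedding h)
      ((X.withSub A hA hAΓ).isClosedEmbedding_subToFilt n)
  · rw [hk']
    rfl
  · rw [hk']
    rfl
  · have hrange : Set.range k.toFun = A := by
      rw [hk']
      exact Subtype.range_coe
    rw [hrange]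
    let := X.finalTopology
    have h1 : IsClosed C := isClosed_finalTopology hC
    have h2 : IsOpen O := isClosed_compl_iff.1 (isClosed_finalTopology hO)
    exact (closure_minimal hAC h1).trans (hCO.trans (interior_maximal hON h2))

namespace RipsEmbedding

theorem continuous_weight (hP : P.coarse.LocallyFinite) (e : RipsEmbedding W S) (A : Set P.carrier)
    (m : ℕ) : Continuous fun w : W.filt m => weight A (e.toFun w.1).coords :=
  CoarsePair.continuous_linearCombination hP S (e.isClosedEmbedding m).continuous
    fun _ => continuous_const

/-- Properness of a morphism in terms of supports. -/
theorem exists_finite_of_hom (hQ : Q.coarse.LocallyFinite)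
    (e : RipsEmbedding W S) (e' : RipsEmbedding V T) (hP : P.coarse.LocallyFinite) (f : W ⟶ V)
    (m : ℕ) (y : Q.carrier) : ∃ U : Set P.carrier, U.Finite ∧ ∀ w ∈ W.filt m,
      y ∈ (e'.toFun (f.toFun w)).coords.support → ∃ x ∈ U, x ∈ (e.toFun w).coords.support := by
  obtain ⟨n, hn, hp⟩ := f.isProper m
  have h1 := (e'.isClosedEmbedding n).isCompact_preimage
    (CoarsePair.isCompact_level_of_finite T n (CoarsePair.finite_neighbors T hQ n y))
  obtain ⟨U, hU, h⟩ := CoarsePair.IsCompact.exists_finite_support S hP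
    ((hp.isCompact_preimage h1).image (e.isClosedEmbedding m).continuous)
  refine ⟨U, hU, fun w hw hy => ?_⟩
  obtain ⟨x, hx⟩ := (e.toFun w).isConvexCombination.exists_mem_support
  refine ⟨x, h _ ⟨⟨w, hw⟩, ?_, rfl⟩ x hx, hx⟩
  exact fun z hz => (e'.mem_filt n _).1 (hn hw) z hz y hy

theorem continuous_coords_of_hom (e' : RipsEmbedding V T) (f : W ⟶ V) (m : ℕ) (y : Q.carrier) :
    Continuous fun w : W.filt m => (e'.toFun (f.toFun w.1)).coords y := by
  obtain ⟨n, hn, hp⟩ := f.isProper m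
  exact (CoarsePair.continuous_coord T n y).comp
    ((e'.isClosedEmbedding n).continuous.comp hp.continuous)

/-- The affine homotopy between two morphisms. -/
theorem homotopic_of_affine (hP : P.coarse.LocallyFinite) (hQ : Q.coarse.LocallyFinite)
    (e : RipsEmbedding W S) (e' : RipsEmbedding V T) (f g : W ⟶ V)
    (hctrl : ∀ m, ∃ E, Q.coarse.Controlled E ∧ ∀ w ∈ W.filt m,
      ∀ y ∈ (e'.toFun (f.toFun w)).coords.support, ∀ y' ∈ (e'.toFun (g.toFun w)).coords.support,
        (y, y') ∈ E)
    (hmem : ∀ w (t : unitInterval) (l : Q.RipsPoint),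
      l.coords = (1 - t : ℝ) • (e'.toFun (f.toFun w)).coords +
        (t : ℝ) • (e'.toFun (g.toFun w)).coords → ∃ v, e'.toFun v = l)
    (hsub : ∀ w ∈ W.sub, ∀ (t : unitInterval) v,
      (e'.toFun v).coords = (1 - t : ℝ) • (e'.toFun (f.toFun w)).coords +
        (t : ℝ) • (e'.toFun (g.toFun w)).coords → v ∈ V.sub) : Homotopic f g := by
  let d : W.carrier → unitInterval → Q.carrier →₀ ℝ := fun w t =>
    (1 - t : ℝ) • (e'.toFun (f.toFun w)).coords + (t : ℝ) • (e'.toFun (g.toFun w)).coords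
  have hd : ∀ w t, IsConvexCombination (d w t) := fun w t =>
    (e'.toFun _).isConvexCombination.add_smul (e'.toFun _).isConvexCombination
      (sub_nonneg.2 t.2.2) t.2.1 (sub_add_cancel _ _)
  have hds : ∀ w t, ∀ y ∈ (d w t).support, y ∈ (e'.toFun (f.toFun w)).coords.support ∨
      y ∈ (e'.toFun (g.toFun w)).coords.support := fun w t y hy =>
    (mem_support_of_mem_support_add_smul hy).imp And.right And.right
  have key : ∀ m, ∃ E, Q.coarse.Controlled E ∧ ∀ w ∈ W.filt m, ∀ t,
      ∀ y ∈ (d w t).support, ∀ y' ∈ (d w t).support, (y, y') ∈ E := by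
    intro m
    obtain ⟨E, hE, h⟩ := hctrl m
    -- Two vertices from the same endpoint of the segment are compared through a vertex of the other
    -- endpoint.
    refine ⟨(E ∪ E.inv) ∪ (E ∪ E.inv).comp (E ∪ E.inv), ?_, fun w hw t y hy y' hy' => ?_⟩
    · have := Q.coarse.union hE (Q.coarse.inv hE)
      exact Q.coarse.union this (Q.coarse.comp this this)
    · obtain ⟨z, hz⟩ := (e'.toFun (f.toFun w)).isConvexCombination.exists_mem_support
      obtain ⟨z', hz'⟩ := (e'.toFun (g.toFun w)).isConvexCombination.exists_mem_support
      rcases hds w t y hy with h1 | h1 <;> rcases hds w t y' hy' with h2 | h2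
      · exact Or.inr ⟨z', Or.inl (h w hw y h1 z' hz'), Or.inr (h w hw y' h2 z' hz')⟩
      · exact Or.inl (Or.inl (h w hw y h1 y' h2))
      · exact Or.inl (Or.inr (h w hw y' h2 y h1))
      · exact Or.inr ⟨z, Or.inr (h w hw z hz y h1), Or.inl (h w hw z hz y' h2)⟩
  have hK : ∀ w t, ∃ v, (e'.toFun v).coords = d w t := by
    intro w t
    obtain ⟨m, hm⟩ := W.exists_mem_filt w
    obtain ⟨E, hE, h⟩ := key m
    -- The target may be a proper closed subspace of the Rips complex, so it has to be known that
    -- the segment remains in it.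
    obtain ⟨v, hv⟩ := hmem w t (.ofConvex (d w t) (hd w t)
      (Q.coarse.subset hE fun q hq => h w hm t q.1 hq.1 q.2 hq.2)) rfl
    exact ⟨v, by rw [hv]; rfl⟩
  choose K hK using hK
  have hext : ∀ v v', (e'.toFun v).coords = (e'.toFun v').coords → v = v' := fun v v' h =>
    e'.injective (CoarsePair.RipsPoint.ext h)
  have hF : IsProperFamily e e' K := by
    refine ⟨fun m => ?_, fun m y => ?_, fun m y => ?_⟩
    · simpa only [hK] using key m
    · simp only [hK]
      exact ((continuous_const.sub (continuous_subtype_val.comp continuous_snd)).mul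
        ((e'.continuous_coords_of_hom f m y).comp continuous_fst)).add
        ((continuous_subtype_val.comp continuous_snd).mul
        ((e'.continuous_coords_of_hom g m y).comp continuous_fst))
    · obtain ⟨U, hU, h⟩ := exists_finite_of_hom hQ e e' hP f m y
      obtain ⟨U', hU', h'⟩ := exists_finite_of_hom hQ e e' hP g m y
      refine ⟨U ∪ U', hU.union hU', fun w hw t hy => ?_⟩
      rw [hK] at hy
      rcases hds w t y hy with hy | hy
      · obtain ⟨x, hx, hx'⟩ := h w hw hy
        exact ⟨x, Or.inl hx, hx'⟩
      · obtain ⟨x, hx, hx'⟩ := h' w hw hy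
        exact ⟨x, Or.inr hx, hx'⟩
  refine hF.homotopic hP hQ (fun γ w t => hext _ _ ?_) (fun w hw t => hsub w hw t _ (hK w t))
    (fun w => hext _ _ ?_) (fun w => hext _ _ ?_)
  · rw [hK, e'.map_smul, CoarsePair.RipsPoint.coords_smul, hK]
    simp only [d, f.map_smul, g.map_smul, e'.map_smul, CoarsePair.RipsPoint.coords_smul,
      Finsupp.mapDomain_add, Finsupp.mapDomain_smul]
  · rw [hK]
    simp [d]
  · rw [hK]
    simp [d]

end RipsEmbedding

end SigmaPair

/-- The individual `κ x` need not have total `1`, only their average. This is needed where mass is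
removed at some vertices and restored at others. -/
theorem IsConvexCombination.linearCombination_of_total {X Y : Type*} {l : X →₀ ℝ}
    (hl : ∀ x, 0 ≤ l x) {κ : X → Y →₀ ℝ} (hκ : ∀ x ∈ l.support, ∀ y, 0 ≤ κ x y)
    (h : Finsupp.linearCombination ℝ
      (fun x => Finsupp.linearCombination ℝ (fun _ => (1 : ℝ)) (κ x)) l = 1) :
    IsConvexCombination (Finsupp.linearCombination ℝ κ l) where
  nonneg y := by
    rw [linearCombination_coord]
    exact linearCombination_nonneg hl fun x hx => hκ x hx y
  total := by rw [linearCombination_linearCombination, h]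

/-- The uniform distribution on a nonempty finite set. -/
theorem exists_uniform {X : Type*} [DecidableEq X] (B : Finset X) (hB : B.Nonempty) :
    IsConvexCombination (∑ a ∈ B, Finsupp.single a ((B.card : ℝ)⁻¹)) ∧
      (∑ a ∈ B, Finsupp.single a ((B.card : ℝ)⁻¹)).support ⊆ B := by
  have hc : (B.card : ℝ) ≠ 0 := by exact_mod_cast hB.card_pos.ne'
  refine ⟨⟨fun y => ?_, ?_⟩, fun y hy => ?_⟩
  · rw [Finsupp.finsetSum_apply]
    refine Finset.sum_nonneg fun a _ => ?_
    rw [Finsupp.single_apply]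
    split_ifs <;> positivity
  · simp [hc]
  · rw [Finsupp.mem_support_iff, Finsupp.finsetSum_apply] at hy
    obtain ⟨a, ha, h⟩ := Finset.exists_ne_zero_of_sum_ne_zero hy
    rw [Finsupp.single_apply] at h
    split_ifs at h with hay
    · exact hay ▸ ha
    · exact (h rfl).elim

/-! ### The thickening of the subspace deforms onto the subspace. -/

namespace CoarsePair

variable {Γ : Type v} [Group Γ] {P Q : CoarsePair.{u} Γ}

/-- An equivariant way to spread points of a locally finite `X` over nearest points of `A`. -/
theorem exists_equivariant_kernel (hP : P.coarse.LocallyFinite) (S : P.GeneratingSequence) :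
    ∃ τ : P.carrier → P.carrier →₀ ℝ, (∀ x, IsConvexCombination (τ x)) ∧
      (∀ (γ : Γ) x, Finsupp.mapDomain (fun y => γ • y) (τ x) = τ (γ • x)) ∧
      ∀ n x, (∃ a ∈ P.sub, (x, a) ∈ S.ent n) → ∀ y ∈ (τ x).support, y ∈ P.sub ∧ (x, y) ∈ S.ent n := by
  classical
  -- The least index is constant on orbits, and minimality makes the distance estimate valid for
  -- every admissible `n`. If no entourage relates `x` to `A`, the default value is `0`.
  let k : P.carrier → ℕ := fun x => sInf {n | ∃ a ∈ P.sub, (x, a) ∈ S.ent n}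
  have hfin : ∀ x, {a | a ∈ P.sub ∧ (x, a) ∈ S.ent (k x)}.Finite := fun x =>
    (hP _ ⟨_, P.coarse.inv (S.controlled (k x)), x, fun a ha => ⟨x, rfl, ha⟩⟩).subset
      fun a ha => ha.2
  -- All nearest points are used, with equal weights: the stabilizer of `x` may permute them, so a
  -- single choice could break equivariance. The singleton serves only points unrelated to `A`.
  let B : P.carrier → Finset P.carrier := fun x =>
    if (hfin x).toFinset.Nonempty then (hfin x).toFinset else {x}
  have hB : ∀ x, (B x).Nonempty := by
    intro x
    by_cases h : (hfin x).toFinset.Nonempty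
    · simp only [B, if_pos h, h]
    · simp only [B, if_neg h, Finset.singleton_nonempty]
  have hent : ∀ n (γ : Γ) x a, (γ • x, γ • a) ∈ S.ent n ↔ (x, a) ∈ S.ent n := fun n =>
    IsInvariantRel.iff (S.invariant n)
  have hk : ∀ (γ : Γ) x, k (γ • x) = k x := by
    intro γ x
    simp only [k]
    congr 1
    ext n
    constructor
    · rintro ⟨a, ha, h⟩
      refine ⟨γ⁻¹ • a, P.smul_mem_sub _ _ ha, ?_⟩
      rwa [← hent n γ, smul_inv_smul]
    · rintro ⟨a, ha, h⟩
      exact ⟨γ • a, P.smul_mem_sub _ _ ha, (hent n γ x a).2 h⟩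
  have hset : ∀ (γ : Γ) x,
      (hfin (γ • x)).toFinset = (hfin x).toFinset.image (fun y => γ • y) := by
    intro γ x
    ext a
    simp only [Set.Finite.mem_toFinset, Finset.mem_image]
    constructor
    · rintro ⟨ha, h⟩
      refine ⟨γ⁻¹ • a, ⟨P.smul_mem_sub _ _ ha, ?_⟩, smul_inv_smul _ _⟩
      rwa [← hent _ γ, smul_inv_smul, ← hk γ]
    · rintro ⟨a, ⟨ha, h⟩, rfl⟩
      exact ⟨P.smul_mem_sub _ _ ha, by rw [hk]; exact (hent _ γ x a).2 h⟩
  have hBΓ : ∀ (γ : Γ) x, B (γ • x) = (B x).image (fun y => γ • y) := by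
    intro γ x
    simp only [B, hset, Finset.image_nonempty]
    split_ifs
    · rfl
    · exact (Finset.image_singleton _ _).symm
  refine ⟨fun x => ∑ a ∈ B x, Finsupp.single a (((B x).card : ℝ)⁻¹),
    fun x => (exists_uniform (B x) (hB x)).1, fun γ x => ?_, fun n x hx y hy => ?_⟩
  · have hinj : Function.Injective fun y : P.carrier => γ • y := MulAction.injective γ
    beta_reduce
    rw [hBΓ, Finset.sum_image hinj.injOn, Finset.card_image_of_injective _ hinj]
    simp only [Finsupp.mapDomain_finsetSum, Finsupp.mapDomain_single]
  · have hy' := (exists_uniform (B x) (hB x)).2 hy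
    have hne : (hfin x).toFinset.Nonempty := by
      have : k x ∈ {n | ∃ a ∈ P.sub, (x, a) ∈ S.ent n} := Nat.sInf_mem ⟨n, hx⟩
      obtain ⟨a, ha⟩ := this
      exact ⟨a, (hfin x).mem_toFinset.2 ha⟩
    simp only [B, if_pos hne, Set.Finite.mem_toFinset] at hy'
    exact ⟨hy'.1, S.mono (Nat.sInf_le hx) hy'.2⟩

section Thickening

variable (T : Q.GeneratingSequence) (hQ : Q.coarse.LocallyFinite)

/-- The points of the Rips complex whose weight on `A` is at least `1 / 4`. -/
def thickening (Q : CoarsePair.{u} Γ) : Set Q.RipsPoint := {l | 1 / 4 ≤ weight Q.sub l.coords}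

theorem isClosed_thickening (n : ℕ) :
    IsClosed {l : (rips T hQ).filt n | l.1 ∈ thickening Q} :=
  isClosed_le continuous_const
    ((SigmaPair.RipsEmbedding.refl T hQ).continuous_weight hQ Q.sub n)

theorem smul_mem_thickening (γ : Γ) (l : Q.RipsPoint) (hl : l ∈ thickening Q) :
    γ • l ∈ thickening Q := by
  change 1 / 4 ≤ weight Q.sub (γ • l).coords
  rw [weight_coords_smul Q.smul_mem_sub_iff]
  exact hl

/-- The pair consisting of the Rips complex and a closed neighbourhood of `𝒫(A)`. -/
noncomputable def thickenedRips : SigmaPair.{u} Γ :=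
  (rips T hQ).withSub (thickening Q) (isClosed_thickening T hQ) smul_mem_thickening

/-- `thickenedRips` has the same underlying space as `rips`. -/
noncomputable def thickenedRipsEmbedding : (thickenedRips T hQ).RipsEmbedding T :=
  (SigmaPair.RipsEmbedding.refl T hQ).withSub

/-- The inclusion of `(𝒫(X), 𝒫(A))` into its thickening. -/
noncomputable def toThickenedRips : rips T hQ ⟶ thickenedRips T hQ where
  toFun := id
  isProper m := ⟨m, fun _ hx => hx, isProperMap_id⟩
  map_smul _ _ := rfl
  mapsTo l hl := by
    change 1 / 4 ≤ weight Q.sub l.coords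
    rw [l.isConvexCombination.weight_eq_one hl]
    norm_num

/-- The coefficients of the deformation of the thickening onto `𝒫(A)`. -/
noncomputable def pushCoeff (l : Q.carrier →₀ ℝ) (x : Q.carrier) : ℝ :=
  1 - cutoff (weight Q.sub l) +
    (max (weight Q.sub l) (1 / 4))⁻¹ * Q.sub.indicator (fun _ => (1 : ℝ)) x

/-- The deformation of the thickening onto `𝒫(A)`. -/
noncomputable def pushCoords (l : Q.carrier →₀ ℝ) : Q.carrier →₀ ℝ :=
  Finsupp.linearCombination ℝ (fun x => Finsupp.single x (pushCoeff l x)) l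

theorem pushCoeff_nonneg (l : Q.carrier →₀ ℝ) (x : Q.carrier) : 0 ≤ pushCoeff l x :=
  add_nonneg (sub_nonneg.2 (cutoff_le_one _))
    (mul_nonneg (inv_max_pos _).le (indicator_one_nonneg _ _))

/-- Every vertex keeps the proportion `1 - cutoff w` of its mass, with `w` the weight on `A`.
Vertices in `A` receive in addition their mass divided by `max w (1/4)`, in total `w / max w (1/4)`,
which is exactly the removed `cutoff w`. -/
theorem isConvexCombination_pushCoords {l : Q.carrier →₀ ℝ} (hl : IsConvexCombination l) :
    IsConvexCombination (pushCoords l) := by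
  classical
  refine .linearCombination_of_total hl.nonneg (fun x _ y => ?_) ?_
  · rw [Finsupp.single_apply]
    split_ifs
    exacts [pushCoeff_nonneg l x, le_rfl]
  · simp only [Finsupp.linearCombination_single, smul_eq_mul, mul_one]
    have h : pushCoeff l = (fun _ : Q.carrier => 1 - cutoff (weight Q.sub l)) +
        (max (weight Q.sub l) (1 / 4))⁻¹ • Q.sub.indicator (fun _ => (1 : ℝ)) := rfl
    have h' : Finsupp.linearCombination ℝ (pushCoeff l) l =
        Finsupp.linearCombination ℝ (fun _ => 1 - cutoff (weight Q.sub l)) l +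
          (max (weight Q.sub l) (1 / 4))⁻¹ * weight Q.sub l := by
      rw [h, weight]
      simp only [Finsupp.linearCombination_apply, Finsupp.sum, Pi.add_apply, Pi.smul_apply,
        smul_eq_mul, mul_add, Finset.sum_add_distrib, Finset.mul_sum]
      congr 1
      exact Finset.sum_congr rfl fun x _ => by ring
    rw [h', hl.linearCombination_const, cutoff]
    ring

theorem support_pushCoords (l : Q.carrier →₀ ℝ) : (pushCoords l).support ⊆ l.support := by
  intro y hy
  obtain ⟨x, hx, hy⟩ := exists_of_mem_support_linearCombination hy
  have := Finsupp.support_single_subset hy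
  rwa [Finset.mem_singleton.1 this]

theorem mem_sub_of_mem_support_pushCoords {l : Q.carrier →₀ ℝ} (hl : 1 / 4 ≤ weight Q.sub l)
    {y : Q.carrier} (hy : y ∈ (pushCoords l).support) : y ∈ Q.sub := by
  obtain ⟨x, hx, hy⟩ := exists_of_mem_support_linearCombination hy
  have h1 := Finset.mem_singleton.1 (Finsupp.support_single_subset hy)
  subst h1
  by_contra h
  rw [Finsupp.mem_support_iff, Finsupp.single_eq_same, pushCoeff, cutoff_eq_one hl,
    Set.indicator_of_notMem h] at hy
  simp at hy

/-- On `A` the coefficient is `1 - w / max w (1/4) + 1 / max w (1/4)`, at least `1` because `w ≤ 1`.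
This keeps the segment from the pushed point to the original inside the thickening. -/
theorem weight_le_weight_pushCoords {l : Q.carrier →₀ ℝ} (hl : IsConvexCombination l) :
    weight Q.sub l ≤ weight Q.sub (pushCoords l) := by
  rw [weight, weight, pushCoords, linearCombination_linearCombination]
  refine linearCombination_mono hl.nonneg fun x hx => ?_
  rw [Finsupp.linearCombination_single, smul_eq_mul]
  by_cases h : x ∈ Q.sub
  · rw [pushCoeff, Set.indicator_of_mem h, mul_one, mul_one, cutoff]
    have h1 : weight Q.sub l ≤ 1 := hl.weight_le_one _
    have := mul_nonneg (sub_nonneg.2 h1) (inv_max_pos (weight Q.sub l)).le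
    linarith
  · rw [Set.indicator_of_notMem h, mul_zero]

/-- The deformation of the thickening onto `𝒫(A)`, as a map of Rips complexes. -/
noncomputable def RipsPoint.push (l : Q.RipsPoint) : Q.RipsPoint :=
  .ofConvex (pushCoords l.coords) (isConvexCombination_pushCoords l.isConvexCombination)
    (Q.coarse.subset l.controlled fun _ hp =>
      ⟨support_pushCoords _ hp.1, support_pushCoords _ hp.2⟩)

theorem RipsPoint.push_smul (γ : Γ) (l : Q.RipsPoint) : (γ • l).push = γ • l.push := by
  refine RipsPoint.ext (Eq.symm ?_)
  refine mapDomain_linearCombination (fun y => γ • y) (fun x => γ • x) (fun x => ?_) l.coords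
  rw [Finsupp.mapDomain_single, pushCoeff, pushCoeff, weight_coords_smul Q.smul_mem_sub_iff]
  congr 3
  by_cases h : x ∈ Q.sub
  · rw [Set.indicator_of_mem h, Set.indicator_of_mem (Q.smul_mem_sub γ x h)]
  · rw [Set.indicator_of_notMem h, Set.indicator_of_notMem (mt (Q.smul_mem_sub_iff γ x).1 h)]

theorem isProperFamily_push : SigmaPair.RipsEmbedding.IsProperFamily (thickenedRipsEmbedding T hQ)
    (.refl T hQ) (fun l (_ : Unit) => RipsPoint.push l) := by
  classical
  refine ⟨fun m => ⟨_, T.controlled m, fun l hl _ y hy y' hy' => hl y (support_pushCoords _ hy) y'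
    (support_pushCoords _ hy')⟩, fun m y => ?_, fun m y => ⟨{y}, Set.finite_singleton y,
    fun l hl _ hy => ⟨y, rfl, support_pushCoords _ hy⟩⟩⟩
  have hw : Continuous fun z : T.level m × Unit => weight Q.sub z.1.1.coords :=
    ((SigmaPair.RipsEmbedding.refl T hQ).continuous_weight hQ Q.sub m).comp continuous_fst
  refine (continuous_linearCombination hQ T (m := m) (L := fun z : T.level m × Unit => z.1)
    (w := fun x z => Finsupp.single x (pushCoeff z.1.1.coords x) y) continuous_fst
    fun x => ?_).congr fun z => (linearCombination_coord _ _ _).symm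
  simp only [Finsupp.single_apply]
  split_ifs
  · exact (continuous_const.sub (continuous_cutoff.comp hw)).add
      ((continuous_inv_max.comp hw).mul continuous_const)
  · exact continuous_const

/-- The deformation of the thickening onto `𝒫(A)`, as a morphism. -/
noncomputable def pushHom : thickenedRips T hQ ⟶ rips T hQ where
  toFun := RipsPoint.push
  isProper := (isProperFamily_push T hQ).isProper hQ hQ
  map_smul := RipsPoint.push_smul
  mapsTo _ hl _ hy := mem_sub_of_mem_support_pushCoords hl hy

/-- Pushing only shrinks supports, so a point and its image lie in a common simplex and are joined
by a segment. The segment stays in `𝒫(A)` by supports, and in the thickening because the weight is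
affine along it. -/
theorem isHomotopyEquivalence_toThickenedRips :
    SigmaPair.IsHomotopyEquivalence (toThickenedRips T hQ) := by
  refine ⟨pushHom T hQ, ?_, ?_⟩
  · refine SigmaPair.RipsEmbedding.homotopic_of_affine hQ hQ (.refl T hQ) (.refl T hQ) _ _
      (fun m => ⟨_, T.controlled m, fun l hl y hy y' hy' => hl y (support_pushCoords _ hy) y' hy'⟩)
      (fun _ _ l _ => ⟨l, rfl⟩) (fun l hl t v hv x hx => ?_)
    rw [show v.coords = _ from hv] at hx
    rcases mem_support_of_mem_support_add_smul hx with h | h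
    · exact hl x (support_pushCoords _ h.2)
    · exact hl x h.2
  · refine SigmaPair.RipsEmbedding.homotopic_of_affine hQ hQ (thickenedRipsEmbedding T hQ)
      (thickenedRipsEmbedding T hQ) _ _
      (fun m => ⟨_, T.controlled m, fun l hl y hy y' hy' => hl y (support_pushCoords _ hy) y' hy'⟩)
      (fun _ _ l _ => ⟨l, rfl⟩) (fun l hl t v hv => ?_)
    have hw := weight_le_weight_pushCoords (RipsPoint.isConvexCombination l)
    have hl' : 1 / 4 ≤ weight Q.sub (RipsPoint.coords l) := hl
    change 1 / 4 ≤ weight Q.sub (RipsPoint.coords v)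
    rw [show RipsPoint.coords v = (1 - t : ℝ) • pushCoords (RipsPoint.coords l) +
      (t : ℝ) • RipsPoint.coords l from hv, weight_add_smul]
    have h1 := mul_le_mul_of_nonneg_left (hl'.trans hw) (sub_nonneg.2 t.2.2)
    have h2 := mul_le_mul_of_nonneg_left hl' t.2.1
    linarith

end Thickening

end CoarsePair

/-! ### Excision for Rips complexes of locally finite spaces. -/

namespace CoarsePair

variable {Γ : Type v} [Group Γ] {P Q : CoarsePair.{u} Γ}

open Classical in
/-- For `z = f x`, the convex combination of `x` and `τ x` with weight `φ` on the latter. -/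
noncomputable def shrinkKernel (f : P ⟶ Q) (τ : P.carrier → P.carrier →₀ ℝ) (φ : ℝ)
    (z : Q.carrier) : P.carrier →₀ ℝ :=
  if h : z ∈ Set.range f.toFun then (1 - φ) • Finsupp.single h.choose 1 + φ • τ h.choose else 0

/-- Drop the vertices outside the image of `f`, and move the others by `τ` according to the weight on
the subspace. -/
noncomputable def shrinkCoords (f : P ⟶ Q) (τ : P.carrier → P.carrier →₀ ℝ) (l : Q.carrier →₀ ℝ) :
    P.carrier →₀ ℝ :=
  Finsupp.linearCombination ℝ (fun z => (1 - weight (Set.range f.toFun)ᶜ l)⁻¹ •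
    shrinkKernel f τ (cutoff (weight Q.sub l)) z) l

section Shrink

variable {f : P ⟶ Q} {τ : P.carrier → P.carrier →₀ ℝ}

theorem shrinkKernel_apply (hf : Function.Injective f.toFun) (φ : ℝ) (x : P.carrier) :
    shrinkKernel f τ φ (f.toFun x) = (1 - φ) • Finsupp.single x 1 + φ • τ x := by
  have h : f.toFun x ∈ Set.range f.toFun := ⟨x, rfl⟩
  have h' : h.choose = x := hf h.choose_spec
  rw [shrinkKernel, dif_pos h, h']

theorem shrinkKernel_of_notMem (φ : ℝ) {z : Q.carrier} (hz : z ∉ Set.range f.toFun) :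
    shrinkKernel f τ φ z = 0 := dif_neg hz

theorem isConvexCombination_shrinkKernel (hf : Function.Injective f.toFun)
    (hτ : ∀ x, IsConvexCombination (τ x)) {φ : ℝ} (h0 : 0 ≤ φ) (h1 : φ ≤ 1) (x : P.carrier) :
    IsConvexCombination (shrinkKernel f τ φ (f.toFun x)) := by
  rw [shrinkKernel_apply hf]
  exact (IsConvexCombination.single x).add_smul (hτ x) (sub_nonneg.2 h1) h0 (sub_add_cancel _ _)

/-- After dropping the vertices outside the image, mass at least `1/2` remains, so dividing by it is
legitimate; the moves by `τ` preserve total mass. -/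
theorem isConvexCombination_shrinkCoords (hf : Function.Injective f.toFun)
    (hτ : ∀ x, IsConvexCombination (τ x)) {l : Q.carrier →₀ ℝ} (hl : IsConvexCombination l)
    (hc : weight (Set.range f.toFun)ᶜ l ≤ 1 / 2) : IsConvexCombination (shrinkCoords f τ l) := by
  have h0 := cutoff_nonneg (hl.weight_nonneg Q.sub)
  have h1 := cutoff_le_one (weight Q.sub l)
  have hc' : 0 < 1 - weight (Set.range f.toFun)ᶜ l := by linarith
  refine .linearCombination_of_total hl.nonneg (fun z _ y => ?_) ?_
  · by_cases hz : z ∈ Set.range f.toFun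
    · obtain ⟨x, rfl⟩ := hz
      exact mul_nonneg (inv_nonneg.2 hc'.le)
        ((isConvexCombination_shrinkKernel hf hτ h0 h1 x).nonneg y)
    · rw [shrinkKernel_of_notMem _ hz, smul_zero]
      exact le_rfl
  · have h : ∀ z ∈ l.support, Finsupp.linearCombination ℝ (fun _ => (1 : ℝ))
        ((1 - weight (Set.range f.toFun)ᶜ l)⁻¹ • shrinkKernel f τ (cutoff (weight Q.sub l)) z) =
        (1 - weight (Set.range f.toFun)ᶜ l)⁻¹ •
          (Set.range f.toFun).indicator (fun _ => (1 : ℝ)) z := by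
      intro z _
      rw [map_smul]
      congr 1
      by_cases hz : z ∈ Set.range f.toFun
      · rw [Set.indicator_of_mem hz]
        obtain ⟨x, rfl⟩ := hz
        exact (isConvexCombination_shrinkKernel hf hτ h0 h1 x).total
      · rw [shrinkKernel_of_notMem _ hz, Set.indicator_of_notMem hz, map_zero]
    rw [linearCombination_congr h]
    have h2 : ∀ c : ℝ, Finsupp.linearCombination ℝ (fun z => c •
        (Set.range f.toFun).indicator (fun _ => (1 : ℝ)) z) l =
        c * weight (Set.range f.toFun) l := by
      intro c
      rw [weight]
      simp only [Finsupp.linearCombination_apply, Finsupp.sum, smul_eq_mul, Finset.mul_sum]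
      exact Finset.sum_congr rfl fun x _ => by ring
    have h3 := hl.weight_compl (Set.range f.toFun)
    rw [h2, show weight (Set.range f.toFun) l = 1 - weight (Set.range f.toFun)ᶜ l by linarith,
      inv_mul_cancel₀ hc'.ne']

/-- Each alternative keeps the inequality needed later: unmoved vertices disappear once the cutoff
is `1`, so the thickening lands over `A`, and vertices move only if the simplex has a vertex in `A`,
which supplies the nearby target. -/
theorem exists_of_mem_support_shrinkCoords (hf : Function.Injective f.toFun) {l : Q.carrier →₀ ℝ}
    {x : P.carrier} (hx : x ∈ (shrinkCoords f τ l).support) :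
    ∃ x₀, f.toFun x₀ ∈ l.support ∧ (cutoff (weight Q.sub l) ≠ 1 ∧ x = x₀ ∨
      weight Q.sub l ≠ 0 ∧ x ∈ (τ x₀).support) := by
  obtain ⟨z, hz, hx⟩ := exists_of_mem_support_linearCombination hx
  replace hx := Finsupp.support_smul hx
  by_cases hzr : z ∈ Set.range f.toFun
  · obtain ⟨x₀, rfl⟩ := hzr
    rw [shrinkKernel_apply hf] at hx
    refine ⟨x₀, hz, ?_⟩
    rcases mem_support_of_mem_support_add_smul hx with ⟨h, h'⟩ | ⟨h, h'⟩
    · exact Or.inl ⟨fun h1 => h (sub_eq_zero.2 h1.symm),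
        Finset.mem_singleton.1 (Finsupp.support_single_subset h')⟩
    · exact Or.inr ⟨cutoff_ne_zero h, h'⟩
  · rw [shrinkKernel_of_notMem _ hzr] at hx
    exact (Finset.notMem_empty _ hx).elim

theorem smul_mem_range_iff (f : P ⟶ Q) (γ : Γ) (z : Q.carrier) :
    γ • z ∈ Set.range f.toFun ↔ z ∈ Set.range f.toFun := by
  constructor
  · rintro ⟨x, hx⟩
    exact ⟨γ⁻¹ • x, by rw [f.map_smul, hx, inv_smul_smul]⟩
  · rintro ⟨x, rfl⟩
    exact ⟨γ • x, f.map_smul γ x⟩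

theorem smul_mem_compl_range_iff (f : P ⟶ Q) (γ : Γ) (z : Q.carrier) :
    γ • z ∈ (Set.range f.toFun)ᶜ ↔ z ∈ (Set.range f.toFun)ᶜ :=
  not_congr (smul_mem_range_iff f γ z)

theorem shrinkCoords_smul (hf : Function.Injective f.toFun)
    (hτΓ : ∀ (γ : Γ) x, Finsupp.mapDomain (fun y => γ • y) (τ x) = τ (γ • x)) (γ : Γ)
    (l : Q.RipsPoint) : shrinkCoords f τ (γ • l).coords =
      Finsupp.mapDomain (fun x => γ • x) (shrinkCoords f τ l.coords) := by
  refine Eq.symm (mapDomain_linearCombination (fun y => γ • y) (fun x => γ • x) (fun z => ?_) l.coords)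
  rw [Finsupp.mapDomain_smul, weight_coords_smul Q.smul_mem_sub_iff,
    weight_coords_smul (smul_mem_compl_range_iff f)]
  congr 1
  by_cases hz : z ∈ Set.range f.toFun
  · obtain ⟨x, rfl⟩ := hz
    rw [← f.map_smul, shrinkKernel_apply hf, shrinkKernel_apply hf, Finsupp.mapDomain_add,
      Finsupp.mapDomain_smul, Finsupp.mapDomain_smul, hτΓ, Finsupp.mapDomain_single]
  · rw [shrinkKernel_of_notMem _ hz, shrinkKernel_of_notMem _ (mt (smul_mem_range_iff f γ z).1 hz),
      Finsupp.mapDomain_zero]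

/-- Here the coarse excision condition enters. If the weight on `A` is nonzero, some vertex of the
simplex is in `A`, so each vertex in the image of `f` lies in the `E_m`-penumbra of `A`, hence in
the `F`-penumbra of the part of `A` in the image. The kernel `τ` therefore moves it by an entourage
depending only on `m`. -/
theorem exists_controlled_shrinkCoords (hf : IsExcision f) (S : P.GeneratingSequence)
    (T : Q.GeneratingSequence)
    (hτ : ∀ n x, (∃ a ∈ P.sub, (x, a) ∈ S.ent n) →
      ∀ y ∈ (τ x).support, y ∈ P.sub ∧ (x, y) ∈ S.ent n) (m : ℕ) :
    ∃ G, P.coarse.Controlled G ∧ ∀ l ∈ T.level m, ∀ x ∈ (shrinkCoords f τ l.coords).support,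
      ∃ x₀, f.toFun x₀ ∈ l.coords.support ∧ (x, x₀) ∈ G ∧
        (cutoff (weight Q.sub l.coords) = 1 → x ∈ P.sub) := by
  obtain ⟨hinj, hcoarse, -, hsub, hexc⟩ := hf
  obtain ⟨F, hF, hpen⟩ := hexc _ (T.controlled m)
  have hF' : P.coarse.Controlled (Prod.map f.toFun f.toFun ⁻¹' F) :=
    (hcoarse _).2 (Q.coarse.subset hF (Set.image_preimage_subset _ _))
  obtain ⟨n, hn⟩ := S.cofinal _ hF'
  refine ⟨SetRel.id ∪ (S.ent n).inv, P.coarse.union P.coarse.diag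
    (P.coarse.inv (S.controlled n)), fun l hl x hx => ?_⟩
  obtain ⟨x₀, hx₀, h⟩ := exists_of_mem_support_shrinkCoords hinj hx
  refine ⟨x₀, hx₀, ?_⟩
  rcases h with ⟨h1, rfl⟩ | ⟨h1, h2⟩
  · exact ⟨Or.inl rfl, fun h => (h1 h).elim⟩
  · obtain ⟨a, ha, haA⟩ := exists_of_weight_ne_zero h1
    obtain ⟨_, ⟨hbA, b, rfl⟩, hb⟩ := hpen ⟨⟨a, haA, hl _ hx₀ a ha⟩, x₀, rfl⟩
    obtain ⟨h3, h4⟩ := hτ n x₀ ⟨b, by rw [hsub]; exact hbA, hn hb⟩ x h2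
    exact ⟨Or.inr h4, fun _ => h3⟩

end Shrink

section Cut

variable (S : P.GeneratingSequence) (T : Q.GeneratingSequence) (hP : P.coarse.LocallyFinite)
  (hQ : Q.coarse.LocallyFinite) (f : P ⟶ Q)

/-- The points of the Rips complex whose weight outside the image of `f` is at most `1 / 2`. -/
def cut (f : P ⟶ Q) : Set Q.RipsPoint := {l | weight (Set.range f.toFun)ᶜ l.coords ≤ 1 / 2}

theorem isClosed_cut (n : ℕ) : IsClosed {l : (rips T hQ).filt n | l.1 ∈ cut f} :=
  isClosed_le ((SigmaPair.RipsEmbedding.refl T hQ).continuous_weight hQ _ n) continuous_const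

theorem smul_mem_cut (γ : Γ) (l : Q.RipsPoint) (hl : l ∈ cut f) : γ • l ∈ cut f := by
  change weight (Set.range f.toFun)ᶜ (γ • l).coords ≤ 1 / 2
  rw [weight_coords_smul (smul_mem_compl_range_iff f)]
  exact hl

/-- The Rips complex with the whole space as subspace pair `cut f`. -/
noncomputable def cutRips₀ : SigmaPair.{u} Γ :=
  (rips T hQ).withSub (cut f) (isClosed_cut T hQ f) (smul_mem_cut f)

/-- The closed subspace `cut f` of the Rips complex, relative to the thickening of the subspace. -/
noncomputable def cutRips : SigmaPair.{u} Γ :=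
  (cutRips₀ T hQ f).subspace.withSub (Subtype.val ⁻¹' thickening Q)
    (fun n => (isClosed_thickening T hQ n).preimage
      ((cutRips₀ T hQ f).isClosedEmbedding_subToFilt n).continuous)
    (fun γ x hx => smul_mem_thickening γ x.1 hx)

/-- `cutRips` as a closed subspace of the Rips complex. -/
noncomputable def cutRipsEmbedding : (cutRips T hQ f).RipsEmbedding T :=
  ((SigmaPair.RipsEmbedding.refl T hQ).withSub (B := cut f)
    (hB := isClosed_cut T hQ f) (hΓ := smul_mem_cut f)).subspace.withSub

/-- The inclusion `cutRips → thickenedRips`. -/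
noncomputable def cutIncl : cutRips T hQ f ⟶ thickenedRips T hQ where
  toFun := Subtype.val
  isProper m := ⟨m, fun _ hx => hx, ((cutRips₀ T hQ f).isClosedEmbedding_subToFilt m).isProperMap⟩
  map_smul _ _ := rfl
  mapsTo _ h := h

/-- The removed points have weight above `1/2` on the complement of the image, so their closure has
weight at least `1/2` there, hence also on `A`. The open set of weight above `1/4` on `A` separates
this closure from the boundary of the thickening. -/
theorem isExcision_cutIncl (hf : (Set.range f.toFun)ᶜ ⊆ Q.sub) :
    SigmaPair.IsExcision (cutIncl T hQ f) := by
  refine SigmaPair.isExcision_of_closed (X := rips T hQ) (A := cut f) (N := thickening Q)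
    (C := {l | 1 / 2 ≤ weight (Set.range f.toFun)ᶜ l.coords})
    (O := {l | 1 / 4 < weight Q.sub l.coords}) (isClosed_cut T hQ f) (smul_mem_cut f)
    (isClosed_thickening T hQ) smul_mem_thickening (fun n => ?_) (fun n => ?_) ?_ ?_ ?_
    (cutIncl T hQ f) (fun _ => rfl)
  · exact isClosed_le continuous_const
      ((SigmaPair.RipsEmbedding.refl T hQ).continuous_weight hQ _ n)
  · convert isClosed_le ((SigmaPair.RipsEmbedding.refl T hQ).continuous_weight hQ Q.sub n)
      (continuous_const (y := (1 / 4 : ℝ))) using 1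
    exact Set.ext fun l => not_lt (b := weight Q.sub (RipsPoint.coords l.1)) (a := 1 / 4)
  · exact fun l hl => (not_le (a := weight (Set.range f.toFun)ᶜ (RipsPoint.coords l))).1 hl |>.le
  · intro l hl
    have h1 := RipsPoint.isConvexCombination l |>.weight_mono hf
    have h2 : 1 / 2 ≤ weight (Set.range f.toFun)ᶜ (RipsPoint.coords l) := hl
    change 1 / 4 < weight Q.sub (RipsPoint.coords l)
    linarith
  · exact fun l hl => le_of_lt (show 1 / 4 < weight Q.sub (RipsPoint.coords l) from hl)

theorem weight_compl_range_mapDomain (l : P.carrier →₀ ℝ) :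
    weight (Set.range f.toFun)ᶜ (Finsupp.mapDomain f.toFun l) = 0 := by
  by_contra h
  obtain ⟨y, hy, hy'⟩ := exists_of_weight_ne_zero h
  obtain ⟨x, -, rfl⟩ := exists_of_mem_support_mapDomain _ _ hy
  exact hy' ⟨x, rfl⟩

/-- Affine linear extension of `f`, with values in `cutRips`. -/
noncomputable def toCut (l : P.RipsPoint) : (cutRips T hQ f).carrier :=
  ⟨RipsPoint.map f.toFun f.isCoarseMap.controlled l, by
    change weight _ (Finsupp.mapDomain f.toFun l.coords) ≤ 1 / 2
    rw [weight_compl_range_mapDomain]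
    norm_num⟩

theorem isProperFamily_toCut : SigmaPair.RipsEmbedding.IsProperFamily (.refl S hP)
    (cutRipsEmbedding T hQ f) (fun l (_ : Unit) => toCut T hQ f l) := by
  refine ⟨fun m => ⟨_, f.isCoarseMap.controlled _ (S.controlled m), ?_⟩, fun m y => ?_,
    fun m y => ⟨_, finite_preimage hP f.isCoarseMap.proper (Set.finite_singleton y), ?_⟩⟩
  · intro l hl _ y hy y' hy'
    obtain ⟨x, hx, rfl⟩ := exists_of_mem_support_mapDomain _ _ hy
    obtain ⟨x', hx', rfl⟩ := exists_of_mem_support_mapDomain _ _ hy'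
    exact ⟨(x, x'), hl x hx x' hx', rfl⟩
  · exact (continuous_mapDomain S (m := m) (fun y => finite_preimage hP f.isCoarseMap.proper
      (Set.finite_singleton y)) y).comp continuous_fst
  · intro l _ _ hy
    obtain ⟨x, hx, h⟩ := exists_of_mem_support_mapDomain _ _ hy
    exact ⟨x, h, hx⟩

/-- Affine linear extension of `f` as a morphism to `cutRips`. -/
noncomputable def toCutHom : rips S hP ⟶ cutRips T hQ f where
  toFun := toCut T hQ f
  isProper := (isProperFamily_toCut S T hP hQ f).isProper hP hQ
  map_smul γ l := Subtype.ext ((ripsMap S T hP hQ f).map_smul γ l)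
  mapsTo _ hl := (toThickenedRips T hQ).mapsTo ((ripsMap S T hP hQ f).mapsTo hl)

/-- In this square `cutIncl` is an excision and `toCutHom` and `toThickenedRips` are homotopy
equivalences; the fourth morphism then induces isomorphisms too. -/
theorem toCutHom_comp_cutIncl :
    toCutHom S T hP hQ f ≫ cutIncl T hQ f = ripsMap S T hP hQ f ≫ toThickenedRips T hQ := rfl

/-- The homotopy inverse drops the vertices outside the image of `f`, renormalizes, and uses `τ` to
bring the thickening into the subspace. It displaces supports in a uniformly controlled way on each
stage, so both composites are joined to identities by segments. -/
theorem isHomotopyEquivalence_toCutHom (hf : IsExcision f) :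
    SigmaPair.IsHomotopyEquivalence (toCutHom S T hP hQ f) := by
  have hinj := hf.1
  have hcoarse := hf.2.1
  have hsub := hf.2.2.2.1
  obtain ⟨τ, hτ, hτΓ, hτS⟩ := exists_equivariant_kernel hP S
  have hG := exists_controlled_shrinkCoords hf S T hτS
  have hpull : ∀ m, P.coarse.Controlled (Prod.map f.toFun f.toFun ⁻¹' T.ent m) := fun m =>
    (hcoarse _).2 (Q.coarse.subset (T.controlled m) (Set.image_preimage_subset _ _))
  have hG' : ∀ m, ∃ G, P.coarse.Controlled G ∧ ∀ l ∈ T.level m,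
      ∀ x ∈ (shrinkCoords f τ l.coords).support, ∀ x' ∈ (shrinkCoords f τ l.coords).support,
        (x, x') ∈ G := by
    intro m
    obtain ⟨G, hG, h⟩ := hG m
    refine ⟨G.comp (SetRel.comp (Prod.map f.toFun f.toFun ⁻¹' T.ent m) G.inv),
      P.coarse.comp hG (P.coarse.comp (hpull m) (P.coarse.inv hG)), fun l hl x hx x' hx' => ?_⟩
    obtain ⟨x₀, h0, h1, -⟩ := h l hl x hx
    obtain ⟨x₀', h0', h1', -⟩ := h l hl x' hx'
    exact ⟨x₀, h1, x₀', hl _ h0 _ h0', h1'⟩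
  let r : (cutRips T hQ f).carrier → P.RipsPoint := fun w =>
    .ofConvex (shrinkCoords f τ (RipsPoint.coords w.1))
      (isConvexCombination_shrinkCoords hinj hτ (RipsPoint.isConvexCombination w.1) w.2) (by
        obtain ⟨m, hm⟩ := (rips T hQ).exists_mem_filt w.1
        obtain ⟨G, hG, h⟩ := hG' m
        exact P.coarse.subset hG fun q hq => h w.1 hm q.1 hq.1 q.2 hq.2)
  have hr : SigmaPair.RipsEmbedding.IsProperFamily (cutRipsEmbedding T hQ f) (.refl S hP)
      (fun w (_ : Unit) => r w) := by
    refine ⟨fun m => ?_, fun m y => ?_, fun m y => ?_⟩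
    · obtain ⟨G, hG, h⟩ := hG' m
      exact ⟨G, hG, fun w hw _ => h w.1 hw⟩
    · have hw : ∀ A : Set Q.carrier, Continuous fun z : (cutRips T hQ f).filt m × Unit =>
          weight A ((cutRipsEmbedding T hQ f).toFun z.1.1).coords := fun A =>
        ((cutRipsEmbedding T hQ f).continuous_weight hQ A m).comp continuous_fst
      -- On the cut the renormalizing denominator is at least `1/2`, so its inverse is continuous.
      have hc : ∀ z : (cutRips T hQ f).filt m × Unit,
          1 - weight (Set.range f.toFun)ᶜ ((cutRipsEmbedding T hQ f).toFun z.1.1).coords ≠ 0 := by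
        intro z
        have h : weight (Set.range f.toFun)ᶜ ((cutRipsEmbedding T hQ f).toFun z.1.1).coords ≤ 1 / 2 :=
          z.1.1.2
        have h' : 0 < 1 - weight (Set.range f.toFun)ᶜ
          ((cutRipsEmbedding T hQ f).toFun z.1.1).coords := by linarith
        exact h'.ne'
      have hcut := continuous_cutoff.comp (hw Q.sub)
      refine (continuous_linearCombination hQ T
        (L := fun z : (cutRips T hQ f).filt m × Unit =>
          (⟨(cutRipsEmbedding T hQ f).toFun z.1.1, z.1.2⟩ : T.level m))
        (w := fun x z => ((1 - weight (Set.range f.toFun)ᶜ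
            ((cutRipsEmbedding T hQ f).toFun z.1.1).coords)⁻¹ •
          shrinkKernel f τ (cutoff (weight Q.sub
            ((cutRipsEmbedding T hQ f).toFun z.1.1).coords)) x) y)
        (((cutRipsEmbedding T hQ f).isClosedEmbedding m).continuous.comp continuous_fst)
        fun x => ?_).congr fun z => (linearCombination_coord _ _ _).symm
      simp only [Finsupp.smul_apply, smul_eq_mul]
      refine ((continuous_const.sub (hw _)).inv₀ hc).mul ?_
      by_cases hx : x ∈ Set.range f.toFun
      · obtain ⟨x, rfl⟩ := hx
        simp only [shrinkKernel_apply hinj, Finsupp.add_apply, Finsupp.smul_apply, smul_eq_mul]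
        exact ((continuous_const.sub hcut).mul continuous_const).add (hcut.mul continuous_const)
      · simp only [shrinkKernel_of_notMem _ hx]
        exact continuous_const
    · obtain ⟨G, hG, h⟩ := hG m
      -- A vertex `y` of the image comes from a vertex `f x₀` with `x₀` close to `y`; local
      -- finiteness leaves finitely many candidates.
      refine ⟨f.toFun '' {x₀ | (y, x₀) ∈ G}, ((hP _ ⟨_, P.coarse.inv hG, y,
        fun x hx => ⟨y, rfl, hx⟩⟩).image _), fun w hw _ hy => ?_⟩
      obtain ⟨x₀, h0, h1, -⟩ := h w.1 hw y hy
      exact ⟨_, ⟨x₀, h1, rfl⟩, h0⟩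
  have hrsub : ∀ w : (cutRips T hQ f).carrier, w ∈ (cutRips T hQ f).sub →
      ∀ x ∈ (r w).coords.support, x ∈ P.sub := by
    intro w hw x hx
    obtain ⟨m, hm⟩ := (rips T hQ).exists_mem_filt w.1
    obtain ⟨G, -, h⟩ := hG m
    obtain ⟨x₀, -, -, h'⟩ := h w.1 hm x hx
    exact h' (cutoff_eq_one hw)
  let rHom : cutRips T hQ f ⟶ rips S hP :=
    { toFun := r
      isProper := hr.isProper hQ hP
      map_smul := fun γ w => RipsPoint.ext (shrinkCoords_smul hinj hτΓ γ w.1)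
      mapsTo := hrsub }
  refine ⟨rHom, ?_, ?_⟩
  · refine SigmaPair.RipsEmbedding.homotopic_of_affine hP hP (.refl S hP) (.refl S hP) _ _
      (fun m => ?_) (fun _ _ l _ => ⟨l, rfl⟩) (fun l hl t v hv x hx => ?_)
    · obtain ⟨n, hn⟩ := T.cofinal _ (f.isCoarseMap.controlled _ (S.controlled m))
      obtain ⟨G, hGc, h⟩ := hG n
      refine ⟨G.comp (S.ent m), P.coarse.comp hGc (S.controlled m), fun l hl x hx x' hx' => ?_⟩
      obtain ⟨x₀, h0, h1, -⟩ := h (toCut T hQ f l).1 (by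
        intro y hy y' hy'
        obtain ⟨a, ha, rfl⟩ := exists_of_mem_support_mapDomain _ _ hy
        obtain ⟨a', ha', rfl⟩ := exists_of_mem_support_mapDomain _ _ hy'
        exact hn ⟨(a, a'), hl a ha a' ha', rfl⟩) x hx
      obtain ⟨x₁, h2, h3⟩ := exists_of_mem_support_mapDomain _ _ h0
      exact ⟨x₀, h1, hl x₀ (hinj h3 ▸ h2) x' hx'⟩
    · rw [show v.coords = _ from hv] at hx
      rcases mem_support_of_mem_support_add_smul hx with h | h
      · exact hrsub _ ((toCutHom S T hP hQ f).mapsTo hl) x h.2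
      · exact hl x h.2
  · refine SigmaPair.RipsEmbedding.homotopic_of_affine hQ hQ (cutRipsEmbedding T hQ f)
      (cutRipsEmbedding T hQ f) _ _ (fun m => ?_) (fun w t l hl => ?_) (fun w hw t v hv => ?_)
    · obtain ⟨G, hGc, h⟩ := hG m
      refine ⟨SetRel.comp (Prod.map f.toFun f.toFun '' G) (T.ent m),
        Q.coarse.comp (f.isCoarseMap.controlled G hGc) (T.controlled m),
        fun w hw y hy y' hy' => ?_⟩
      obtain ⟨x, hx, rfl⟩ := exists_of_mem_support_mapDomain _ _ hy
      obtain ⟨x₀, h0, h1, -⟩ := h w.1 hw x hx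
      exact ⟨f.toFun x₀, ⟨_, h1, rfl⟩, hw _ h0 y' hy'⟩
    -- The composite has weight `0` outside the image of `f` and the original point at most `1/2`,
    -- so the segment between them stays in the cut.
    · refine ⟨⟨l, ?_⟩, rfl⟩
      change weight _ l.coords ≤ 1 / 2
      have h1 : weight (Set.range f.toFun)ᶜ
        ((cutRipsEmbedding T hQ f).toFun ((toCutHom S T hP hQ f).toFun (rHom.toFun w))).coords = 0 :=
        weight_compl_range_mapDomain f _
      have h2 : weight (Set.range f.toFun)ᶜ ((cutRipsEmbedding T hQ f).toFun w).coords ≤ 1 / 2 := w.2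
      rw [hl, weight_add_smul]
      erw [h1]
      have h3 := mul_le_mul_of_nonneg_left h2 t.2.1
      have h4 := t.2.2
      have h5 : (t : ℝ) * weight (Set.range f.toFun)ᶜ
        ((cutRipsEmbedding T hQ f).toFun ((𝟙 (cutRips T hQ f) : _ ⟶ _).toFun w)).coords ≤ t * (1 / 2) := h3
      linarith
    · change 1 / 4 ≤ weight Q.sub ((cutRipsEmbedding T hQ f).toFun v).coords
      have h1 : 1 / 4 ≤ weight Q.sub
          ((cutRipsEmbedding T hQ f).toFun ((toCutHom S T hP hQ f).toFun (rHom.toFun w))).coords :=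
        (toThickenedRips T hQ).mapsTo ((ripsMap S T hP hQ f).mapsTo (hrsub w hw))
      have h2 : 1 / 4 ≤ weight Q.sub ((cutRipsEmbedding T hQ f).toFun w).coords := hw
      rw [hv, weight_add_smul]
      have h3 : (t : ℝ) * (1 / 4) ≤ (t : ℝ) * weight Q.sub
        ((cutRipsEmbedding T hQ f).toFun ((𝟙 (cutRips T hQ f) : _ ⟶ _).toFun w)).coords :=
        mul_le_mul_of_nonneg_left h2 t.2.1
      have h4 : (1 - t : ℝ) * (1 / 4) ≤ (1 - t : ℝ) * weight Q.sub
        ((cutRipsEmbedding T hQ f).toFun ((toCutHom S T hP hQ f ).toFun (rHom.toFun w))).coords :=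
        mul_le_mul_of_nonneg_left h1 (sub_nonneg.2 t.2.2)
      have h5 : (1 - t : ℝ) * (1 / 4) ≤ (1 - t : ℝ) * weight Q.sub
        ((cutRipsEmbedding T hQ f).toFun ((rHom ≫ toCutHom S T hP hQ f ).toFun w)).coords := h4
      linarith

end Cut

end CoarsePair

/-! ### From locally finite spaces to general excisions. -/

namespace CoarsePair

variable {Γ : Type v} [Group Γ] {P Q : CoarsePair.{u} Γ}

theorem _root_.IsHomologyTheory.isIso_ripsMap_of_isExcision
    {E : HomologyData.{w} (SigmaPair.{u} Γ)} (hE : IsHomologyTheory E) (S : P.GeneratingSequence)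
    (T : Q.GeneratingSequence) (hP : P.coarse.LocallyFinite) (hQ : Q.coarse.LocallyFinite)
    {f : P ⟶ Q} (hf : IsExcision f) (p : ℤ) : IsIso (E.map p (ripsMap S T hP hQ f)) := by
  have h1 := hE.isIso_of_isHomotopyEquivalence (isHomotopyEquivalence_toCutHom S T hP hQ f hf) p
  have h2 := hE.isIso_of_isHomotopyEquivalence (isHomotopyEquivalence_toThickenedRips T hQ) p
  have h3 : IsIso (E.map p (cutIncl T hQ f)) :=
    hE.excision p _ (isExcision_cutIncl T hQ f hf.2.2.1)
  have h := congrArg (E.map p) (toCutHom_comp_cutIncl S T hP hQ f)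
  rw [hE.map_comp, hE.map_comp] at h
  exact IsIso.of_isIso_fac_right h.symm

theorem _root_.IsCohomologyTheory.isIso_ripsMap_of_isExcision
    {E : CohomologyData.{w} (SigmaPair.{u} Γ)} (hE : IsCohomologyTheory E)
    (S : P.GeneratingSequence) (T : Q.GeneratingSequence) (hP : P.coarse.LocallyFinite)
    (hQ : Q.coarse.LocallyFinite) {f : P ⟶ Q} (hf : IsExcision f) (p : ℤ) :
    IsIso (E.map p (ripsMap S T hP hQ f)) := by
  have h1 := hE.isIso_of_isHomotopyEquivalence (isHomotopyEquivalence_toCutHom S T hP hQ f hf) p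
  have h2 := hE.isIso_of_isHomotopyEquivalence (isHomotopyEquivalence_toThickenedRips T hQ) p
  have h3 : IsIso (E.map p (cutIncl T hQ f)) :=
    hE.excision p _ (isExcision_cutIncl T hQ f hf.2.2.1)
  have h := congrArg (E.map p) (toCutHom_comp_cutIncl S T hP hQ f)
  rw [hE.map_comp, hE.map_comp] at h
  exact IsIso.of_isIso_fac_left h.symm

/-- An excision is an excision between suitable discretizations. -/
theorem IsExcision.exists_discretizations {f : P ⟶ Q} (hf : IsExcision f) :
    ∃ (D : RetractedDiscretization P) (D' : RetractedDiscretization Q),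
      IsExcision (D.ι ≫ f ≫ D'.retraction.π) := by
  obtain ⟨hinj, hcoarse, hcompl, hsub, hpen⟩ := hf
  -- Because `p` preserves and reflects both `A` and the image of `f`, it restricts along `f` to an
  -- idempotent `q` on the source, giving discretizations that match under `f`.
  obtain ⟨p, hpΓ, hpp, hp, hpA, hpR, hpfin⟩ :=
    Q.exists_equivariant_idempotent (Set.range f.toFun) (smul_mem_range_iff f)
  choose q hq using fun x => (hpR (f.toFun x)).2 ⟨x, rfl⟩
  have hmem : ∀ x, x ∈ P.sub ↔ f.toFun x ∈ Q.sub := fun x => by rw [hsub]; rfl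
  have hqq : ∀ x, q (q x) = q x := fun x => hinj (by rw [hq, hq, hpp])
  have hqclose : AreClose P.coarse q id := by
    refine (hcoarse _).2 (Q.coarse.subset hp ?_)
    rintro _ ⟨_, ⟨x, rfl⟩, rfl⟩
    exact ⟨f.toFun x, Prod.ext (hq x).symm rfl⟩
  obtain ⟨D', hD'⟩ := RetractedDiscretization.exists_of_idempotent p hpΓ hpp hp
    (fun x hx => (hpA x).2 hx) hpfin
  obtain ⟨D, hD⟩ := RetractedDiscretization.exists_of_idempotent q
    (fun γ x => hinj (by rw [hq, f.map_smul, f.map_smul, hpΓ, hq])) hqq hqclose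
    (fun x hx => (hmem _).2 (by rw [hq]; exact (hpA _).2 ((hmem x).1 hx))) (by
      rintro K ⟨E, hE, y, hK⟩
      refine Set.Finite.of_finite_image ((hpfin (f.toFun '' K)
        ⟨_, (hcoarse E).1 hE, f.toFun y, ?_⟩).subset ?_) hinj.injOn
      · rintro _ ⟨x, hx, rfl⟩
        obtain ⟨_, rfl, h⟩ := hK hx
        exact ⟨_, rfl, (x, _), h, rfl⟩
      · rintro _ ⟨_, ⟨⟨x, rfl⟩, hx⟩, rfl⟩
        exact ⟨⟨f.toFun x, (hq x).symm⟩, q x, hx, rfl⟩)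
  have hι : Function.Injective D.ι.toFun := Subtype.val_injective
  have hι' : Function.Injective D'.ι.toFun := Subtype.val_injective
  have hg : ∀ z, D'.ι.toFun ((D.ι ≫ f ≫ D'.retraction.π).toFun z) = f.toFun (D.ι.toFun z) := by
    intro z
    have h := hD (D.ι.toFun z)
    rw [D.retraction.apply_ι] at h
    exact (hD' _).trans ((hq _).symm.trans (congrArg f.toFun h.symm))
  have hgq : ∀ x, D'.ι.toFun ((D.ι ≫ f ≫ D'.retraction.π).toFun (D.retraction.π.toFun x)) =
      p (f.toFun x) := fun x => by rw [hg, hD, hq]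
  refine ⟨D, D', fun z w h => hι (hinj ?_), fun E => ?_, fun y hy => ?_, Set.ext fun z => ?_,
    fun E hE => ?_⟩
  · rw [← hg, ← hg, h]
  · refine CoarseStructure.controlled_restrict_iff.trans ((hcoarse _).trans
      (Iff.trans ?_ CoarseStructure.controlled_restrict_iff.symm))
    refine iff_of_eq (congrArg _ ((Set.image_image _ _ _).trans
      ((Set.image_congr fun z _ => ?_).trans (Set.image_image _ _ _).symm)))
    exact Prod.ext (hg z.1).symm (hg z.2).symm
  · by_contra h
    -- If `y` were outside the subspace, it would come from some `x` under `f`; as `p` fixes `y`,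
    -- the retraction of `x` would then be mapped to `y`.
    obtain ⟨x, hx⟩ := not_not.1 (mt (@hcompl (D'.ι.toFun y)) h)
    refine hy ⟨D.retraction.π.toFun x, hι' ?_⟩
    rw [hgq, hx, ← hD', D'.retraction.apply_ι]
  · refine (hmem (D.ι.toFun z)).trans ?_
    rw [← hg]
    rfl
  · obtain ⟨F, hF, h⟩ := hpen _ (CoarseStructure.controlled_restrict_iff.1 hE)
    -- The nearby point given by the excision condition need not belong to the discretization.
    -- Applying `p` moves it there by one further entourage, without leaving the subspace or the
    -- image of `f`.
    refine ⟨_, ⟨_, Q.coarse.comp hF hp.symm, rfl⟩, ?_⟩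
    rintro _ ⟨⟨a, ha, haE⟩, z, rfl⟩
    obtain ⟨_, ⟨hb, x, rfl⟩, hbF⟩ := h ⟨⟨D'.ι.toFun a, ha, _, haE, rfl⟩,
      ⟨D.ι.toFun z, (hg z).symm⟩⟩
    refine ⟨(D.ι ≫ f ≫ D'.retraction.π).toFun (D.retraction.π.toFun x), ⟨?_, _, rfl⟩, ?_⟩
    · have := (hpA _).2 hb
      rw [← hgq] at this
      exact this
    · refine ⟨f.toFun x, hbF, f.toFun x, Prod.ext rfl (hgq x).symm⟩

end CoarsePair

/-! ### Verification of the axioms for the coarsified theories. -/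

section Coarsification

variable {Γ : Type v} [Group Γ]

/-- For cohomology the comparison maps point from the coarse sequence back to the topological one,
so the ladder has to be inverted. -/
theorem AddCommGrpCat.exact_of_ladder_symm {A B C A' B' C' : AddCommGrpCat.{w}} {f : A ⟶ B}
    {g : B ⟶ C} {f' : A' ⟶ B'} {g' : B' ⟶ C'} {a : A' ⟶ A} {b : B' ⟶ B} {c : C' ⟶ C}
    (_ : IsIso a) (_ : IsIso b) (_ : IsIso c) (h1 : f' ≫ b = a ≫ f) (h2 : g' ≫ c = b ≫ g)
    (h : Function.Exact f g) : Function.Exact f' g' := by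
  refine exact_of_ladder (a := inv a) (b := inv b) (c := inv c) inferInstance inferInstance
    inferInstance ?_ ?_ h
  · rw [IsIso.inv_comp_eq, ← Category.assoc, ← h1, Category.assoc, IsIso.hom_inv_id,
      Category.comp_id]
  · rw [IsIso.inv_comp_eq, ← Category.assoc, ← h2, Category.assoc, IsIso.hom_inv_id,
      Category.comp_id]

namespace IsHomologyTheory

variable {E : HomologyData.{w} (SigmaPair.{u} Γ)}

theorem map_ripsInduced_comp (hE : IsHomologyTheory E) (p : ℤ) {P Q R : CoarsePair.{u} Γ}
    (D : Discretization P) (D' : Discretization Q) (D'' : Discretization R) (r : D'.Retraction)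
    (r' : D''.Retraction) (f : P ⟶ Q) (g : Q ⟶ R) :
    E.map p (D.ripsInduced D' r f) ≫ E.map p (D'.ripsInduced D'' r' g) =
      E.map p (D.ripsInduced D'' r' (f ≫ g)) := by
  rw [← hE.map_comp]
  exact hE.homotopy p _ _ (D.ripsInduced_comp_homotopic D' D'' r r' f g)

theorem map_ripsInduced_id (hE : IsHomologyTheory E) (p : ℤ) {P : CoarsePair.{u} Γ}
    (D : Discretization P) (r : D.Retraction) : E.map p (D.ripsInduced D r (𝟙 P)) = 𝟙 _ := by
  rw [D.ripsInduced_id]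
  exact hE.map_id p _

theorem independentOfDiscretization (hE : IsHomologyTheory E) : E.IndependentOfDiscretization where
  retraction p _ _ D D' r r' f := hE.homotopy p _ _ (D.ripsInduced_homotopic D' r r' f)
  -- The inverse is the comparison in the opposite direction, since both composites reduce to the
  -- morphism induced by the identity on one discretization.
  isIso p _ D D' := ⟨E.map p (D'.comparison D), by
      refine (hE.map_ripsInduced_comp p ..).trans ?_
      rw [Category.id_comp]
      exact hE.map_ripsInduced_id p .., by
      refine (hE.map_ripsInduced_comp p ..).trans ?_
      rw [Category.id_comp]
      exact hE.map_ripsInduced_id p ..⟩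
  refl p _ D := hE.map_ripsInduced_id p _ _
  trans p _ D D' D'' := by
    refine (hE.map_ripsInduced_comp p ..).trans ?_
    rw [Category.id_comp]
    rfl

theorem isIso_ripsSubspace (hE : IsHomologyTheory E) (p : ℤ) {P : CoarsePair.{u} Γ}
    (D : Discretization P) (r : D.Retraction) (Ds : Discretization P.subspace)
    (rs : Ds.Retraction) : IsIso (E.map p (D.ripsSubspace Ds rs)) := by
  have h0 := CoarsePair.isIso_ripsSubspace (P := D.pair) D.gen D.locallyFinite
  have h1 := hE.isIso_of_isIso (CoarsePair.ripsSubspace (P := D.pair) D.gen D.locallyFinite) p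
  have h2 := hE.isIso_of_isHomotopyEquivalence (D.isHomotopyEquivalence_ripsSubspace r Ds rs) p
  exact hE.map_comp p _ _ ▸ IsIso.comp_isIso' h1 h2

theorem isIso_ripsAbsolute (hE : IsHomologyTheory E) (p : ℤ) {P : CoarsePair.{u} Γ}
    (D : Discretization P) (r : D.Retraction) (D₀ : Discretization P.absolute)
    (r₀ : D₀.Retraction) : IsIso (E.map p (D.ripsAbsolute D₀ r₀)) := by
  have h0 := CoarsePair.isIso_ripsAbsolute (P := D.pair) D.gen D.locallyFinite
  have h1 := hE.isIso_of_isIso (CoarsePair.ripsAbsolute (P := D.pair) D.gen D.locallyFinite) p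
  have h2 := hE.isIso_of_isHomotopyEquivalence (D.isHomotopyEquivalence_ripsAbsolute r D₀ r₀) p
  exact hE.map_comp p _ _ ▸ IsIso.comp_isIso' h1 h2

theorem map_ripsSubspace_comp (hE : IsHomologyTheory E) (p : ℤ) {P Q : CoarsePair.{u} Γ}
    (D : Discretization P) (Ds : Discretization P.subspace) (rs : Ds.Retraction)
    (D' : Discretization Q) (r' : D'.Retraction) (Ds' : Discretization Q.subspace)
    (rs' : Ds'.Retraction) (f : P ⟶ Q) :
    E.map p (D.ripsSubspace Ds rs) ≫
        E.map p (Ds.ripsInduced Ds' rs' (CoarsePair.subspaceMap f)) =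
      E.map p (SigmaPair.subspaceMap (D.ripsInduced D' r' f)) ≫
        E.map p (D'.ripsSubspace Ds' rs') := by
  rw [← hE.map_comp, ← hE.map_comp]
  exact hE.homotopy p _ _ (D.ripsSubspace_comp_homotopic Ds rs D' r' Ds' rs' f)

theorem map_ripsSubspace_comp_incl (hE : IsHomologyTheory E) (p : ℤ) {P : CoarsePair.{u} Γ}
    (D : Discretization P) (Ds : Discretization P.subspace) (rs : Ds.Retraction)
    (D₀ : Discretization P.absolute) (r₀ : D₀.Retraction) :
    E.map p (D.ripsSubspace Ds rs) ≫ E.map p (Ds.ripsInduced D₀ r₀ P.incl) =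
      E.map p (SigmaPair.incl D.rips) ≫ E.map p (D.ripsAbsolute D₀ r₀) := by
  rw [← hE.map_comp, ← hE.map_comp]
  exact hE.homotopy p _ _ (D.incl_comp_ripsAbsolute_homotopic Ds rs D₀ r₀)

theorem map_ripsAbsolute_comp_toPair (hE : IsHomologyTheory E) (p : ℤ) {P : CoarsePair.{u} Γ}
    (D : Discretization P) (r : D.Retraction) (D₀ : Discretization P.absolute)
    (r₀ : D₀.Retraction) :
    E.map p (D.ripsAbsolute D₀ r₀) ≫ E.map p (D₀.ripsInduced D r P.toPair) =
      E.map p (SigmaPair.toPair D.rips) ≫ 𝟙 _ := by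
  rw [← hE.map_comp, Category.comp_id]
  exact hE.homotopy p _ _ (D.ripsAbsolute_comp_homotopic r D₀ r₀)

/-- The given discretizations need not be compatible with the excision. The induced map is factored
through adapted ones, and the outer two factors are comparison isomorphisms. -/
theorem isIso_induced_of_isExcision (hE : IsHomologyTheory E) (p : ℤ) {P Q : CoarsePair.{u} Γ}
    {f : P ⟶ Q} (hf : CoarsePair.IsExcision f) (D : RetractedDiscretization P)
    (D' : RetractedDiscretization Q) : IsIso (E.map p (D.induced D' f)) := by
  obtain ⟨D₁, D₁', h⟩ := hf.exists_discretizations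
  have h1 : IsIso (E.map p (D₁.induced D₁' f)) :=
    hE.isIso_ripsMap_of_isExcision (P := D₁.pair) (Q := D₁'.pair) _ _ _ _ h p
  have h2 := hE.independentOfDiscretization.isIso p D D₁
  have h3 := hE.independentOfDiscretization.isIso p D₁' D'
  have h4 : (E.map p (D.comparison D₁) ≫ E.map p (D₁.induced D₁' f)) ≫
      E.map p (D₁'.comparison D') = E.map p (D.induced D' f) := by
    refine (congrArg (· ≫ _) (hE.map_ripsInduced_comp p ..)).trans
      ((hE.map_ripsInduced_comp p ..).trans ?_)
    rw [Category.id_comp, Category.comp_id]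
    rfl
  exact h4 ▸ IsIso.comp_isIso' (IsIso.comp_isIso' h2 h1) h3

theorem coarsification (hE : IsHomologyTheory E)
    (c : ∀ P : CoarsePair.{u} Γ, RetractedDiscretization P) :
    IsHomologyTheory (E.coarsification c) where
  map_id p P := hE.map_ripsInduced_id p _ _
  map_comp p _ _ _ f g := (hE.map_ripsInduced_comp p ..).symm
  bdry_natural p P Q f := by
    refine (Category.assoc _ _ _).symm.trans ((congrArg (· ≫ _) (hE.bdry_natural p _)).trans
      ((Category.assoc _ _ _).trans ?_))
    refine (congrArg (_ ≫ ·) ?_).trans (Category.assoc _ _ _).symm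
    exact (hE.map_ripsSubspace_comp p ..).symm
  homotopy p P Q f g h := hE.homotopy p _ _
    ((c P).ripsInduced_homotopic_of_coarselyHomotopic (c Q).toDiscretization (c Q).retraction h)
  exact_absolute p P := by
    have h1 := hE.isIso_ripsSubspace p (c P).toDiscretization (c P).retraction
      (c P.subspace).toDiscretization (c P.subspace).retraction
    have h2 := hE.isIso_ripsAbsolute p (c P).toDiscretization (c P).retraction
      (c P.absolute).toDiscretization (c P.absolute).retraction
    -- The ladder compares the sequence of `(𝒫(X'), 𝒫(A'))` with the one built from the separately
    -- chosen discretizations of `A` and `(X, ∅)`; the relative terms agree literally.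
    exact AddCommGrpCat.exact_of_ladder h1 h2 (IsIso.id _) (hE.map_ripsSubspace_comp_incl p ..)
      (hE.map_ripsAbsolute_comp_toPair p ..) (hE.exact_absolute p (c P).rips)
  exact_pair p P := by
    have h1 := hE.isIso_ripsSubspace p (c P).toDiscretization (c P).retraction
      (c P.subspace).toDiscretization (c P.subspace).retraction
    have h2 := hE.isIso_ripsAbsolute (p + 1) (c P).toDiscretization (c P).retraction
      (c P.absolute).toDiscretization (c P.absolute).retraction
    exact AddCommGrpCat.exact_of_ladder h2 (IsIso.id _) h1 (hE.map_ripsAbsolute_comp_toPair (p + 1) ..)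
      (Category.id_comp _) (hE.exact_pair p (c P).rips)
  exact_subspace p P := by
    have h1 := hE.isIso_ripsSubspace p (c P).toDiscretization (c P).retraction
      (c P.subspace).toDiscretization (c P.subspace).retraction
    have h2 := hE.isIso_ripsAbsolute p (c P).toDiscretization (c P).retraction
      (c P.absolute).toDiscretization (c P.absolute).retraction
    exact AddCommGrpCat.exact_of_ladder (IsIso.id _) h1 h2 (Category.id_comp _)
      (hE.map_ripsSubspace_comp_incl p ..) (hE.exact_subspace p (c P).rips)
  excision p _ _ _ hf := hE.isIso_induced_of_isExcision p hf _ _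

theorem strongHomotopy_coarsification (hE : IsHomologyTheory E)
    (c : ∀ P : CoarsePair.{u} Γ, RetractedDiscretization P) :
    (E.coarsification c).StrongHomotopy := fun p P Q _ _ h => hE.homotopy p _ _
  ((c P).ripsInduced_homotopic_of_generalizedCoarselyHomotopic (c Q).toDiscretization
    (c Q).retraction h)

theorem isHomologyIso_coarsification (hE : IsHomologyTheory E)
    (c c' : ∀ P : CoarsePair.{u} Γ, RetractedDiscretization P) :
    IsHomologyIso (E.coarsification c) (E.coarsification c')
      fun p P => E.map p ((c P).comparison (c' P)) where
  isIso p P := hE.independentOfDiscretization.isIso p _ _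
  natural p P Q f := by
    refine (hE.map_ripsInduced_comp p ..).trans (Eq.trans ?_ (hE.map_ripsInduced_comp p ..).symm)
    rw [Category.id_comp, Category.comp_id]
  bdry p P := by
    -- Compatibility with the boundary is the naturality square for the identity of `P`, with a
    -- different discretization at each end.
    refine (Category.assoc _ _ _).trans ((congrArg (_ ≫ ·) (hE.map_ripsSubspace_comp p _ _ _
      (c' P).toDiscretization (c' P).retraction _ _ (𝟙 P))).trans ?_)
    refine (Category.assoc _ _ _).symm.trans (Eq.trans ?_ (Category.assoc _ _ _))
    exact congrArg (· ≫ _) (hE.bdry_natural p _).symm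

end IsHomologyTheory
-- The dual verification for cohomology.
namespace IsCohomologyTheory

variable {E : CohomologyData.{w} (SigmaPair.{u} Γ)}

theorem map_ripsInduced_comp (hE : IsCohomologyTheory E) (p : ℤ) {P Q R : CoarsePair.{u} Γ}
    (D : Discretization P) (D' : Discretization Q) (D'' : Discretization R) (r : D'.Retraction)
    (r' : D''.Retraction) (f : P ⟶ Q) (g : Q ⟶ R) :
    E.map p (D'.ripsInduced D'' r' g) ≫ E.map p (D.ripsInduced D' r f) =
      E.map p (D.ripsInduced D'' r' (f ≫ g)) := by
  rw [← hE.map_comp]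
  exact hE.homotopy p _ _ (D.ripsInduced_comp_homotopic D' D'' r r' f g)

theorem map_ripsInduced_id (hE : IsCohomologyTheory E) (p : ℤ) {P : CoarsePair.{u} Γ}
    (D : Discretization P) (r : D.Retraction) : E.map p (D.ripsInduced D r (𝟙 P)) = 𝟙 _ := by
  rw [D.ripsInduced_id]
  exact hE.map_id p _

theorem independentOfDiscretization (hE : IsCohomologyTheory E) :
    E.IndependentOfDiscretization where
  retraction p _ _ D D' r r' f := hE.homotopy p _ _ (D.ripsInduced_homotopic D' r r' f)
  isIso p _ D D' := ⟨E.map p (D'.comparison D), by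
      refine (hE.map_ripsInduced_comp p ..).trans ?_
      rw [Category.id_comp]
      exact hE.map_ripsInduced_id p .., by
      refine (hE.map_ripsInduced_comp p ..).trans ?_
      rw [Category.id_comp]
      exact hE.map_ripsInduced_id p ..⟩
  refl p _ D := hE.map_ripsInduced_id p _ _
  trans p _ D D' D'' := by
    refine (hE.map_ripsInduced_comp p ..).trans ?_
    rw [Category.id_comp]
    rfl

theorem isIso_ripsSubspace (hE : IsCohomologyTheory E) (p : ℤ) {P : CoarsePair.{u} Γ}
    (D : Discretization P) (r : D.Retraction) (Ds : Discretization P.subspace)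
    (rs : Ds.Retraction) : IsIso (E.map p (D.ripsSubspace Ds rs)) := by
  have h0 := CoarsePair.isIso_ripsSubspace (P := D.pair) D.gen D.locallyFinite
  have h1 := hE.isIso_of_isIso (CoarsePair.ripsSubspace (P := D.pair) D.gen D.locallyFinite) p
  have h2 := hE.isIso_of_isHomotopyEquivalence (D.isHomotopyEquivalence_ripsSubspace r Ds rs) p
  exact hE.map_comp p _ _ ▸ IsIso.comp_isIso' h2 h1

theorem isIso_ripsAbsolute (hE : IsCohomologyTheory E) (p : ℤ) {P : CoarsePair.{u} Γ}
    (D : Discretization P) (r : D.Retraction) (D₀ : Discretization P.absolute)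
    (r₀ : D₀.Retraction) : IsIso (E.map p (D.ripsAbsolute D₀ r₀)) := by
  have h0 := CoarsePair.isIso_ripsAbsolute (P := D.pair) D.gen D.locallyFinite
  have h1 := hE.isIso_of_isIso (CoarsePair.ripsAbsolute (P := D.pair) D.gen D.locallyFinite) p
  have h2 := hE.isIso_of_isHomotopyEquivalence (D.isHomotopyEquivalence_ripsAbsolute r D₀ r₀) p
  exact hE.map_comp p _ _ ▸ IsIso.comp_isIso' h2 h1

theorem map_ripsSubspace_comp (hE : IsCohomologyTheory E) (p : ℤ) {P Q : CoarsePair.{u} Γ}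
    (D : Discretization P) (Ds : Discretization P.subspace) (rs : Ds.Retraction)
    (D' : Discretization Q) (r' : D'.Retraction) (Ds' : Discretization Q.subspace)
    (rs' : Ds'.Retraction) (f : P ⟶ Q) :
    E.map p (Ds.ripsInduced Ds' rs' (CoarsePair.subspaceMap f)) ≫
        E.map p (D.ripsSubspace Ds rs) =
      E.map p (D'.ripsSubspace Ds' rs') ≫
        E.map p (SigmaPair.subspaceMap (D.ripsInduced D' r' f)) := by
  rw [← hE.map_comp, ← hE.map_comp]
  exact hE.homotopy p _ _ (D.ripsSubspace_comp_homotopic Ds rs D' r' Ds' rs' f)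

theorem map_ripsSubspace_comp_incl (hE : IsCohomologyTheory E) (p : ℤ) {P : CoarsePair.{u} Γ}
    (D : Discretization P) (Ds : Discretization P.subspace) (rs : Ds.Retraction)
    (D₀ : Discretization P.absolute) (r₀ : D₀.Retraction) :
    E.map p (Ds.ripsInduced D₀ r₀ P.incl) ≫ E.map p (D.ripsSubspace Ds rs) =
      E.map p (D.ripsAbsolute D₀ r₀) ≫ E.map p (SigmaPair.incl D.rips) := by
  rw [← hE.map_comp, ← hE.map_comp]
  exact hE.homotopy p _ _ (D.incl_comp_ripsAbsolute_homotopic Ds rs D₀ r₀)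

theorem map_ripsAbsolute_comp_toPair (hE : IsCohomologyTheory E) (p : ℤ) {P : CoarsePair.{u} Γ}
    (D : Discretization P) (r : D.Retraction) (D₀ : Discretization P.absolute)
    (r₀ : D₀.Retraction) :
    E.map p (D₀.ripsInduced D r P.toPair) ≫ E.map p (D.ripsAbsolute D₀ r₀) =
      𝟙 _ ≫ E.map p (SigmaPair.toPair D.rips) := by
  rw [← hE.map_comp, Category.id_comp]
  exact hE.homotopy p _ _ (D.ripsAbsolute_comp_homotopic r D₀ r₀)

theorem isIso_induced_of_isExcision (hE : IsCohomologyTheory E) (p : ℤ) {P Q : CoarsePair.{u} Γ}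
    {f : P ⟶ Q} (hf : CoarsePair.IsExcision f) (D : RetractedDiscretization P)
    (D' : RetractedDiscretization Q) : IsIso (E.map p (D.induced D' f)) := by
  obtain ⟨D₁, D₁', h⟩ := hf.exists_discretizations
  have h1 : IsIso (E.map p (D₁.induced D₁' f)) :=
    hE.isIso_ripsMap_of_isExcision (P := D₁.pair) (Q := D₁'.pair) _ _ _ _ h p
  have h2 := hE.independentOfDiscretization.isIso p D D₁
  have h3 := hE.independentOfDiscretization.isIso p D₁' D'
  have h4 : E.map p (D₁'.comparison D') ≫ E.map p (D₁.induced D₁' f) ≫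
      E.map p (D.comparison D₁) = E.map p (D.induced D' f) := by
    refine (congrArg (_ ≫ ·) (hE.map_ripsInduced_comp p ..)).trans
      ((hE.map_ripsInduced_comp p ..).trans ?_)
    rw [Category.id_comp, Category.comp_id]
    rfl
  -- Contravariance reverses the order of the three factors.
  exact h4 ▸ IsIso.comp_isIso' h3 (IsIso.comp_isIso' h1 h2)

theorem coarsification (hE : IsCohomologyTheory E)
    (c : ∀ P : CoarsePair.{u} Γ, RetractedDiscretization P) :
    IsCohomologyTheory (E.coarsification c) where
  map_id p P := hE.map_ripsInduced_id p _ _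
  map_comp p _ _ _ f g := (hE.map_ripsInduced_comp p ..).symm
  cobdry_natural p P Q f := by
    refine (Category.assoc _ _ _).trans ((congrArg (_ ≫ ·) (hE.cobdry_natural p _)).trans
      ((Category.assoc _ _ _).symm.trans ?_))
    refine (congrArg (· ≫ _) ?_).trans (Category.assoc _ _ _)
    exact (hE.map_ripsSubspace_comp p ..).symm
  homotopy p P Q f g h := hE.homotopy p _ _
    ((c P).ripsInduced_homotopic_of_coarselyHomotopic (c Q).toDiscretization (c Q).retraction h)
  exact_absolute p P := by
    have h1 := hE.isIso_ripsSubspace p (c P).toDiscretization (c P).retraction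
      (c P.subspace).toDiscretization (c P.subspace).retraction
    have h2 := hE.isIso_ripsAbsolute p (c P).toDiscretization (c P).retraction
      (c P.absolute).toDiscretization (c P.absolute).retraction
    exact AddCommGrpCat.exact_of_ladder_symm (IsIso.id _) h2 h1
      (hE.map_ripsAbsolute_comp_toPair p ..) (hE.map_ripsSubspace_comp_incl p ..)
      (hE.exact_absolute p (c P).rips)
  exact_subspace p P := by
    have h1 := hE.isIso_ripsSubspace p (c P).toDiscretization (c P).retraction
      (c P.subspace).toDiscretization (c P.subspace).retraction
    have h2 := hE.isIso_ripsAbsolute p (c P).toDiscretization (c P).retraction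
      (c P.absolute).toDiscretization (c P.absolute).retraction
    exact AddCommGrpCat.exact_of_ladder_symm h2 h1 (IsIso.id _)
      (hE.map_ripsSubspace_comp_incl p ..) (Category.comp_id _) (hE.exact_subspace p (c P).rips)
  exact_pair p P := by
    have h1 := hE.isIso_ripsSubspace p (c P).toDiscretization (c P).retraction
      (c P.subspace).toDiscretization (c P.subspace).retraction
    have h2 := hE.isIso_ripsAbsolute (p + 1) (c P).toDiscretization (c P).retraction
      (c P.absolute).toDiscretization (c P.absolute).retraction
    exact AddCommGrpCat.exact_of_ladder_symm h1 (IsIso.id _) h2 (Category.comp_id _)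
      (hE.map_ripsAbsolute_comp_toPair (p + 1) ..) (hE.exact_pair p (c P).rips)
  excision p _ _ _ hf := hE.isIso_induced_of_isExcision p hf _ _

theorem strongHomotopy_coarsification (hE : IsCohomologyTheory E)
    (c : ∀ P : CoarsePair.{u} Γ, RetractedDiscretization P) :
    (E.coarsification c).StrongHomotopy := fun p P Q _ _ h => hE.homotopy p _ _
  ((c P).ripsInduced_homotopic_of_generalizedCoarselyHomotopic (c Q).toDiscretization
    (c Q).retraction h)

theorem isCohomologyIso_coarsification (hE : IsCohomologyTheory E)
    (c c' : ∀ P : CoarsePair.{u} Γ, RetractedDiscretization P) :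
    IsCohomologyIso (E.coarsification c) (E.coarsification c')
      fun p P => E.map p ((c' P).comparison (c P)) where
  isIso p P := hE.independentOfDiscretization.isIso p _ _
  natural p P Q f := by
    refine (hE.map_ripsInduced_comp p ..).trans (Eq.trans ?_ (hE.map_ripsInduced_comp p ..).symm)
    rw [Category.id_comp, Category.comp_id]
  cobdry p P := by
    refine (Category.assoc _ _ _).trans ((congrArg (_ ≫ ·) (hE.cobdry_natural p _)).trans
      ((Category.assoc _ _ _).symm.trans ?_))
    refine (congrArg (· ≫ _) ?_).trans (Category.assoc _ _ _)
    exact (hE.map_ripsSubspace_comp p _ _ _ (c P).toDiscretization (c P).retraction _ _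
      (𝟙 P)).symm

end IsCohomologyTheory

end Coarsification

theorem mainTheorem1 {Γ : Type v} [Group Γ] :
    -- discretizations of the required type exist
    (∀ P : CoarsePair.{u} Γ, Nonempty (RetractedDiscretization P)) ∧
    -- homology
    (∀ E : HomologyData.{w} (SigmaPair.{u} Γ), IsHomologyTheory E →
      E.IndependentOfDiscretization ∧
      (∀ c : ∀ P : CoarsePair.{u} Γ, RetractedDiscretization P,
        IsHomologyTheory (E.coarsification c) ∧ (E.coarsification c).StrongHomotopy) ∧
      (∀ c c' : ∀ P : CoarsePair.{u} Γ, RetractedDiscretization P,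
        IsHomologyIso (E.coarsification c) (E.coarsification c')
          fun p P => E.map p ((c P).comparison (c' P)))) ∧
    -- cohomology
    (∀ E : CohomologyData.{w} (SigmaPair.{u} Γ), IsCohomologyTheory E →
      E.IndependentOfDiscretization ∧
      (∀ c : ∀ P : CoarsePair.{u} Γ, RetractedDiscretization P,
        IsCohomologyTheory (E.coarsification c) ∧ (E.coarsification c).StrongHomotopy) ∧
      (∀ c c' : ∀ P : CoarsePair.{u} Γ, RetractedDiscretization P,
        IsCohomologyIso (E.coarsification c) (E.coarsification c')
          fun p P => E.map p ((c' P).comparison (c P)))) := by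
  exact ⟨RetractedDiscretization.nonempty, fun E hE => ⟨hE.independentOfDiscretization,
    fun c => ⟨hE.coarsification c, hE.strongHomotopy_coarsification c⟩,
    hE.isHomologyIso_coarsification⟩, fun E hE => ⟨hE.independentOfDiscretization,
    fun c => ⟨hE.coarsification c, hE.strongHomotopy_coarsification c⟩,
    hE.isCohomologyIso_coarsification⟩⟩
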